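/- **Setting.** Put $h_u=\begin{pmatrix}1&0\\-u&1\end{pmatrix}$, $p_{a,b}=\begin{pmatrix}a&b\\0&a^{-1}\end{pmatrix}$ and $\Delta=\{(a,b):0<a\le 1,\ 1-a<b\le 1\}$. * An *affine lattice* is a set $\Lambda=g\mathbb Z^2+v$ with $g\in SL_2(\mathbb R)$, $v\in\mathbb R^2$; $\Omega$ is the set of affine lattices that contain a vector $(\alpha,0)$ with $0<\alpha\le 1$. * A *doubled slit torus* $\omega$ is the translation surface made of two copies of a torus $\mathbb R^2/g\mathbb Z^2$, $g\in SL_2(\mathbb R)$, glued crosswise along a slit with holonomy $s\notin g\mathbb Z^2$ (it depends on $s$ only modulo $2g\mathbb Z^2$). $\Lambda_\omega$ is the set of holonomy vectors of its oriented saddle connections, and $\mathcal W$ is the set of doubled slit tori for which $\Lambda_\omega$ contains a vector $(\alpha,0)$ with $0<\alpha\le1$. In both cases $R(x)=\min\{u>0:h_ux \text{ lies in the transversal}\}$ is the first return time to the transversal ($\Omega$ or $\mathcal W$) and $T(x)=h_{R(x)}x$ is the return map. Let $0=s_0<s_1<s_2<\cdots$, where $s_1<s_2<\cdots$ are the slopes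 of the vectors of $\Lambda$ (respectively $\Lambda_\omega$) in the strip $\{0<x\le1,\ y>0\}$. The gaps are the numbers $s_{i}-s_{i-1}$, $i\ge1$. **Measures.** The following are the probability measures on the transversals that are induced, through the flow $h_u$, by the invariant measures of the ambient spaces. * $m_\Omega$ is proportional to $\alpha\,ds\,db\,da\,d\alpha$ on the affine lattices $h_sp_{a,b}\mathbb Z^2+(\alpha,0)^{T}$, $(a,b)\in\Delta$, $0\le s<(ab)^{-1}$, $0<\alpha\le1$ (induced by Haar measure). * For an integer $q>0$, the torsion measure $m_q$ is proportional to $db\,da$ on the affine lattices $p_{a,b}\mathbb Z^2+(ka/q,0)^{T}$ with $1\le k\le q$, $\gcd(k,q)=1$, $0<a\le q/k$, $1-a<b\le1$; these are the elements of $\Omega$ for which $v$ has exact order $q$ in $\mathbb R^2/g\mathbb Z^2$. * $m_{\mathcal W}$ is proportional to the sum of $db\,da\,ds'$ on the surfaces with $g=p_{a,b}$, $(a,b)\in\Delta$, and slit $s'\in\mathbb R^2/2g\mathbb Z^2$, and of $\alpha\,ds\,db\,da\,d\alpha$ on the surfaces with $g=h_sp_{a,b}$ and slit congruent modulo $g\mathbb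 Z^2$ to $(\alpha,0)^T$ or to $(-\alpha,0)^T$ (with $a,b,s,\alpha$ as for $m_\Omega$; both signs and all four classes of slits modulo $2g\mathbb Z^2$ are counted). A point $x$ of the transversal is *generic* for such a measure $m$ if $\frac1N\sum_{i<N}\chi_{\{R\in I\}}(T^ix)\to m(R\in I)$ for every interval $I$. Put $g_m(t)=\frac{d}{dt}\,m(R^{-1}(0,t))$ and $g=g_{m_\Omega}$, $g_q=g_{m_q}$, $f=g_{m_{\mathcal W}}$. **Theorem.** For each of the measures $m=m_\Omega$, $m_q$ ($q\ge1$), $m_{\mathcal W}$ the function $g_m$ is integrable, and for every $m$-generic point of the transversal and every interval $I$ the proportion of the first $N$ gaps that lie in $I$ tends to $\int_I g_m(t)\,dt$ as $N\to\infty$. Moreover, as $t\to\infty$: 1. For affine lattices generic for $m_\Omega$: $\;t^{-2}\ll\int_t^\infty g(x)\,dx\ll t^{-1}$. 2. There is support at zero: $\int_0^\varepsilon g(t)\,dt>0$ for every $\varepsilon>0$. 3. For affine lattices generic for a torsion measure $m_q$, $q\ge 1$: $\;\int_t^\infty g_q(x)\,dx\asymp t^{-2}$ (the constants may depend on $q$).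 4. For doubled slit tori generic for $m_{\mathcal W}$: $\;\int_t^\infty f(x)\,dx\sim c\,t^{-2}$ for some constant $c>0$, that is, the ratio of $\int_t^\infty f$ and $t^{-2}$ converges to a positive constant. 5. There is support at zero: $\int_0^\varepsilon f(t)\,dt>0$ for every $\varepsilon>0$. -/

import Mathlib

open Set Filter Topology MeasureTheory Asymptotics

noncomputable section

/-- Vectors of the plane. -/
abbrev Plane := Fin 2 → ℝ

/-- A pair `(g, v)`. It presents
* the affine lattice `gℤ² + v` (equivalently the torus `ℝ² / gℤ²` marked at `0` and `v`), and
* when `v ∉ gℤ²`, the doubled slit torus `ω` made of two copies of the torus `ℝ² / gℤ²` that are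
  cut along the projection of the segment from `0` to `v` and glued crosswise along the slit.
Affine lattices are pairs up to `g ↦ gγ` (`γ ∈ SL₂(ℤ)`) and `v ↦ v + gℤ²`. Doubled slit tori are
pairs up to `g ↦ gγ` and `v ↦ v + 2gℤ²`, since the glued surface is the double cover of the torus
branched over `0` and `v`, and it depends only on the class of the slit modulo `2`. So forgetting
the slit is the four-to-one map from doubled slit tori to affine lattices.
All notions below are invariant under these changes of the presentation. -/
@[ext]
structure TorusPair where
  g : Matrix (Fin 2) (Fin 2) ℝ
  v : Plane

instance : MeasurableSpace TorusPair :=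
  MeasurableSpace.comap (fun ω : TorusPair => ((fun i j => ω.g i j : Fin 2 → Fin 2 → ℝ), ω.v))
    inferInstance

/-- The lattice `gℤ²`. -/
def lattice (g : Matrix (Fin 2) (Fin 2) ℝ) : Set Plane :=
  {x | ∃ m n : ℤ, x = g.mulVec ![(m : ℝ), (n : ℝ)]}

/-- The affine lattice `gℤ² + v`. -/
def affineLattice (ω : TorusPair) : Set Plane :=
  {x | ∃ w ∈ lattice ω.g, x = w + ω.v}

/-- The space of (unimodular) affine lattices. -/
def affineLatticeSpace : Set TorusPair := {ω | ω.g.det = 1}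

/-- The space of doubled slit tori (two tori of area one glued along a slit). -/
def slitTorusSpace : Set TorusPair := {ω | ω.g.det = 1 ∧ ω.v ∉ lattice ω.g}

/-- The points of the plane that lie over the two marked points of the torus. -/
def markedPoints (ω : TorusPair) : Set Plane := lattice ω.g ∪ affineLattice ω

/-- The holonomy vectors of the oriented saddle connections of the doubled slit torus.
The surface is a double cover of the torus `ℝ² / gℤ²` branched exactly over the two marked points,
and the cone points are the two branch points. Hence the saddle connections are exactly the lifts
of the straight segments that join marked points (distinct or not) of the torus and have no marked
point in their interior; such a segment lifts from either sheet, with the same holonomy. -/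
def saddleHolonomies (ω : TorusPair) : Set Plane :=
  {w | ∃ p ∈ markedPoints ω, ∃ r ∈ markedPoints ω,
    p ≠ r ∧ Disjoint (openSegment ℝ p r) (markedPoints ω) ∧ w = r - p}

/-- The matrix `h_u` of the horocycle flow. -/
def horoMatrix (u : ℝ) : Matrix (Fin 2) (Fin 2) ℝ := !![1, 0; -u, 1]

/-- The horocycle flow. -/
def horocycle (u : ℝ) (ω : TorusPair) : TorusPair :=
  ⟨horoMatrix u * ω.g, (horoMatrix u).mulVec ω.v⟩

/-! In what follows `H` assigns to `ω` a set of vectors in the plane: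
`H = affineLattice` for affine lattices, `H = saddleHolonomies` for doubled slit tori. -/

/-- The transversal: the pairs with a horizontal vector of length at most one.
(`Ω` for affine lattices, `𝒲` for doubled slit tori.) -/
def transversal (H : TorusPair → Set Plane) : Set TorusPair :=
  {ω | ∃ α : ℝ, 0 < α ∧ α ≤ 1 ∧ ![α, 0] ∈ H ω}

/-- The first return time to the transversal under the horocycle flow. -/
def returnTime (H : TorusPair → Set Plane) (ω : TorusPair) : ℝ :=
  sInf {u : ℝ | 0 < u ∧ horocycle u ω ∈ transversal H}

/-- The first return map. -/
def returnMap (H : TorusPair → Set Plane) (ω : TorusPair) : TorusPair :=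
  horocycle (returnTime H ω) ω

/-- The slopes of the vectors in the vertical strip `0 < x ≤ 1`, `y > 0`. -/
def stripSlopes (H : TorusPair → Set Plane) (ω : TorusPair) : Set ℝ :=
  {σ | ∃ w ∈ H ω, 0 < w 0 ∧ w 0 ≤ 1 ∧ 0 < w 1 ∧ σ = w 1 / w 0}

/-- The slopes in the strip in increasing order, `s₁ < s₂ < ⋯`, preceded by `s₀ = 0`. -/
def slopeSeq (H : TorusPair → Set Plane) (ω : TorusPair) : ℕ → ℝ
  | 0 => 0
  | n + 1 => sInf {σ | σ ∈ stripSlopes H ω ∧ slopeSeq H ω n < σ}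

open Classical in
/-- The proportion of the first `N` slope gaps that lie in `I`. -/
def gapProportion (H : TorusPair → Set Plane) (ω : TorusPair) (I : Set ℝ) (N : ℕ) : ℝ :=
  (((Finset.range N).filter
    (fun i => slopeSeq H ω (i + 1) - slopeSeq H ω i ∈ I)).card : ℝ) / (N : ℝ)

/-- `ω` is generic for the measure `m` on the transversal: along the orbit of the return map, the
Birkhoff averages of the indicator functions of the events `{return time ∈ I}`, with `I` an
interval, converge to the measures of these events. -/
def IsGeneric (H : TorusPair → Set Plane) (m : Measure TorusPair) (ω : TorusPair) : Prop :=
  ∀ I : Set ℝ, I.OrdConnected →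
    Tendsto
      (fun N : ℕ => (∑ i ∈ Finset.range N,
        ({ω' | returnTime H ω' ∈ I} : Set TorusPair).indicator (fun _ => (1 : ℝ))
          ((returnMap H)^[i] ω)) / (N : ℝ))
      atTop (𝓝 (m {ω' | returnTime H ω' ∈ I}).toReal)

/-- The density `t ↦ d/dt m(R⁻¹(0, t))` of the gap distribution. -/
def gapDensity (H : TorusPair → Set Plane) (m : Measure TorusPair) (t : ℝ) : ℝ :=
  deriv (fun u : ℝ => (m {ω | returnTime H ω ∈ Ioo 0 u}).toReal) t

/-- The tail `∫_t^∞` of the density of the gap distribution. -/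
def gapTail (H : TorusPair → Set Plane) (m : Measure TorusPair) (t : ℝ) : ℝ :=
  ∫ x in Ioi t, gapDensity H m x

/-- The probability measure proportional to a finite non-zero measure. -/
def toProbability (μ : Measure TorusPair) : Measure TorusPair := (μ univ)⁻¹ • μ

/-- The matrix `p_{a,b}`. -/
def pMatrix (a b : ℝ) : Matrix (Fin 2) (Fin 2) ℝ := !![a, b; 0, a⁻¹]

/-- The range of the coordinates `(a, b, s, α)`: `0 < a ≤ 1`, `1 - a < b ≤ 1`,
`0 ≤ s < (ab)⁻¹`, `0 < α ≤ 1`. -/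
def omegaCoords : Set (ℝ × ℝ × ℝ × ℝ) :=
  {p | 0 < p.1 ∧ p.1 ≤ 1 ∧ 1 - p.1 < p.2.1 ∧ p.2.1 ≤ 1 ∧
    0 ≤ p.2.2.1 ∧ p.2.2.1 < (p.1 * p.2.1)⁻¹ ∧ 0 < p.2.2.2 ∧ p.2.2.2 ≤ 1}

/-- The measure `α ds db da dα` in the coordinates `(a, b, s, α)`. Near the transversal
`v = (±α, 0)ᵀ` the space of pairs has the coordinates `(g, v) = h_u (h_s p_{a,b}, (±α, 0)ᵀ)`. There
the second component is `(±α, ∓uα)ᵀ`, so that `dv = α dα du`, and Haar measure, which is `dv` times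
the Haar measure `ds db da` of the space of lattices, becomes `(α ds db da dα) du`. So this is the
measure that Haar measure induces on the transversal, invariant under the return map. -/
def fluxMeasure : Measure (ℝ × ℝ × ℝ × ℝ) :=
  (volume.restrict omegaCoords).withDensity (fun p => ENNReal.ofReal p.2.2.2)

/-- The probability measure `m_Ω` that Haar measure on the space of affine lattices induces on its
transversal, the affine lattices `h_s p_{a,b} ℤ² + (α, 0)ᵀ`. -/
def mOmega : Measure TorusPair :=
  toProbability (fluxMeasure.map
    (fun p => ⟨horoMatrix p.2.2.1 * pMatrix p.1 p.2.1, ![p.2.2.2, 0]⟩))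

/-- The torsion probability measure `m_q`, which the `SL₂(ℝ)`-invariant measure on the affine
lattices of denominator `q` (those with `v` of exact order `q` in `ℝ² / gℤ²`) induces on the
transversal. An affine lattice of denominator `q` in the transversal is uniquely
`p_{a,b} ℤ² + (ka/q, 0)ᵀ` with `1 ≤ k ≤ q` prime to `q`, `0 < a`, `ka/q ≤ 1`, `1 - a < b ≤ 1`,
and the induced measure is `db da` for each `k`. -/
def mTorsion (q : ℕ) : Measure TorusPair :=
  toProbability (∑ k ∈ (Finset.Icc 1 q).filter (fun k => Nat.Coprime k q),
    ((volume.restrict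
      {p : ℝ × ℝ | 0 < p.1 ∧ (k : ℝ) * p.1 / (q : ℝ) ≤ 1 ∧ 1 - p.1 < p.2 ∧ p.2 ≤ 1}).map
      (fun p => (⟨pMatrix p.1 p.2, ![(k : ℝ) * p.1 / (q : ℝ), 0]⟩ : TorusPair))))

/-- The part of the induced measure on doubled slit tori with a short affine vector:
`g = h_s p_{a,b}`, and the second marked point is `(σα, 0)ᵀ` modulo `gℤ²`, where `σ = ±1` (the
oriented saddle connections go from the first marked point to the second, or back). The index `e`
runs over the four slits between the marked points. -/
def slitAffinePart (σ : ℝ) (e : Fin 2 × Fin 2) : Measure TorusPair :=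
  fluxMeasure.map (fun p =>
    ⟨horoMatrix p.2.2.1 * pMatrix p.1 p.2.1,
      ![σ * p.2.2.2, 0] + (horoMatrix p.2.2.1 * pMatrix p.1 p.2.1).mulVec
        ![((e.1 : ℕ) : ℝ), ((e.2 : ℕ) : ℝ)]⟩)

/-- The part of the induced measure on doubled slit tori with a short lattice vector:
`g = p_{a,b}` with `0 < a ≤ 1`, `1 - a < b ≤ 1`, and the slit `p_{a,b} (x, y)ᵀ` is distributed
according to Lebesgue measure on `ℝ² / 2gℤ²` (four copies of the torus, one for each slit). -/
def slitLatticePart : Measure TorusPair :=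
  (volume.restrict {p : ℝ × ℝ × ℝ × ℝ | 0 < p.1 ∧ p.1 ≤ 1 ∧ 1 - p.1 < p.2.1 ∧ p.2.1 ≤ 1 ∧
    0 ≤ p.2.2.1 ∧ p.2.2.1 < 2 ∧ 0 ≤ p.2.2.2 ∧ p.2.2.2 < 2}).map
    (fun p => ⟨pMatrix p.1 p.2.1, (pMatrix p.1 p.2.1).mulVec ![p.2.2.1, p.2.2.2]⟩)

/-- The probability measure `m_𝒲` that the `SL₂(ℝ)`-invariant measure on the space of doubled slit
tori (four copies of Haar measure on the space of affine lattices) induces on the transversal. -/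
def mSlit : Measure TorusPair :=
  toProbability (slitLatticePart + ∑ e : Fin 2 × Fin 2, (slitAffinePart 1 e + slitAffinePart (-1) e))

/-- `gapDensity H m` is the density of the limiting gap distribution of every element of the
transversal in `E` that is generic for `m`: it is integrable, and for such an element the proportion
of the gaps in any interval `I` converges to the integral of the density over `I`. -/
def GapDistributionHasDensity (H : TorusPair → Set Plane) (E : Set TorusPair)
    (m : Measure TorusPair) : Prop :=
  Integrable (gapDensity H m) ∧
    ∀ ω ∈ E ∩ transversal H, IsGeneric H m ω → ∀ I : Set ℝ, I.OrdConnected →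
      Tendsto (gapProportion H ω I) atTop (𝓝 (∫ x in I, gapDensity H m x))

end

noncomputable section

open scoped ENNReal

/-! ### The gap density as a Radon-Nikodym derivative -/

theorem returnTime_nonneg (H : TorusPair → Set Plane) (ω : TorusPair) : 0 ≤ returnTime H ω :=
  Real.sInf_nonneg fun _ hu => hu.1.le

theorem deriv_measure_Ioo_ae_eq (ν : Measure ℝ) [IsFiniteMeasure ν] (hac : ν ≪ volume)
    (h0 : ν (Iic 0) = 0) :
    (deriv fun u : ℝ => (ν (Ioo 0 u)).toReal) =ᵐ[volume]
      fun x => (ν.rnDeriv volume x).toReal := by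
  set ρ : ℝ → ℝ := fun x => (ν.rnDeriv volume x).toReal
  have hρ : Integrable ρ := Measure.integrable_toReal_rnDeriv
  have hF : (fun u : ℝ => (ν (Ioo 0 u)).toReal) = fun u => ∫ x in (0:ℝ)..u, ρ x := by
    funext u
    rcases le_total 0 u with hu | hu
    · rw [intervalIntegral.integral_of_le hu, integral_Ioc_eq_integral_Ioo,
        Measure.setIntegral_toReal_rnDeriv hac]
      rfl
    · rw [Ioo_eq_empty (not_lt.2 hu), intervalIntegral.integral_of_ge hu,
        Measure.setIntegral_toReal_rnDeriv hac]
      have : ν (Ioc u 0) = 0 := measure_mono_null (fun x hx => hx.2) h0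
      simp [Measure.real, this]
  rw [hF]
  filter_upwards [_root_.LocallyIntegrable.ae_hasDerivAt_integral hρ.locallyIntegrable] with x hx
  exact (hx 0).deriv

theorem gapDensity_ae_eq {H : TorusPair → Set Plane} {m : Measure TorusPair} [IsFiniteMeasure m]
    (hR : AEMeasurable (returnTime H) m) (hac : m.map (returnTime H) ≪ volume) :
    gapDensity H m =ᵐ[volume] fun x => ((m.map (returnTime H)).rnDeriv volume x).toReal := by
  set ν := m.map (returnTime H)
  have : IsFiniteMeasure ν := by infer_instance
  have h0 : ν (Iic 0) = 0 := by
    have h1 : ν (Iio 0) = 0 := by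
      rw [Measure.map_apply_of_aemeasurable hR measurableSet_Iio]
      convert measure_empty (μ := m)
      ext ω
      simp [returnTime_nonneg]
    have h2 : ν {0} = 0 := hac (by simp)
    rw [← Iio_union_right]
    exact measure_union_null h1 h2
  refine Filter.EventuallyEq.trans (Eq.eventuallyEq ?_) (deriv_measure_Ioo_ae_eq ν hac h0)
  funext t
  unfold gapDensity
  congr 1
  funext u
  rw [Measure.map_apply_of_aemeasurable hR measurableSet_Ioo]
  rfl

theorem integrable_gapDensity {H : TorusPair → Set Plane} {m : Measure TorusPair}
    [IsFiniteMeasure m] (hR : AEMeasurable (returnTime H) m)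
    (hac : m.map (returnTime H) ≪ volume) : Integrable (gapDensity H m) :=
  Measure.integrable_toReal_rnDeriv.congr (gapDensity_ae_eq hR hac).symm

theorem setIntegral_gapDensity {H : TorusPair → Set Plane} {m : Measure TorusPair}
    [IsFiniteMeasure m] (hR : AEMeasurable (returnTime H) m)
    (hac : m.map (returnTime H) ≪ volume) {I : Set ℝ} (hI : MeasurableSet I) :
    ∫ x in I, gapDensity H m x = (m {ω | returnTime H ω ∈ I}).toReal := by
  rw [setIntegral_congr_ae hI ((gapDensity_ae_eq hR hac).mono fun x hx _ => hx),
    Measure.setIntegral_toReal_rnDeriv hac, Measure.real,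
    Measure.map_apply_of_aemeasurable hR hI]
  rfl

/-! ### Slopes and return times along an orbit -/

theorem horoMatrix_mul (s u : ℝ) : horoMatrix s * horoMatrix u = horoMatrix (s + u) := by
  ext i j
  fin_cases i <;> fin_cases j <;> simp [horoMatrix, Matrix.mul_apply, Fin.sum_univ_two]
  ring

theorem horocycle_horocycle (s u : ℝ) (ω : TorusPair) :
    horocycle s (horocycle u ω) = horocycle (s + u) ω := by
  simp only [horocycle, ← Matrix.mul_assoc, Matrix.mulVec_mulVec, horoMatrix_mul]

theorem horocycle_zero (ω : TorusPair) : horocycle 0 ω = ω := by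
  have : horoMatrix 0 = 1 := by
    ext i j
    fin_cases i <;> fin_cases j <;> simp [horoMatrix]
  simp [horocycle, this]

theorem horoMatrix_mulVec (u : ℝ) (w : Plane) :
    (horoMatrix u).mulVec w = ![w 0, w 1 - u * w 0] := by
  ext i
  fin_cases i <;> simp [horoMatrix, Matrix.mulVec, dotProduct, Fin.sum_univ_two]
  ring

/-- A family of sets of vectors that is equivariant under the horocycle flow. -/
def HorocycleEquivariant (H : TorusPair → Set Plane) : Prop :=
  ∀ u ω w, w ∈ H ω → (horoMatrix u).mulVec w ∈ H (horocycle u ω)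

theorem HorocycleEquivariant.mem_iff {H : TorusPair → Set Plane} (hH : HorocycleEquivariant H)
    (u : ℝ) (ω : TorusPair) (x y : ℝ) :
    ![x, y] ∈ H (horocycle u ω) ↔ ![x, y + u * x] ∈ H ω := by
  constructor
  · intro h
    have := hH (-u) _ _ h
    rw [horocycle_horocycle, neg_add_cancel, horocycle_zero, horoMatrix_mulVec] at this
    simpa using this
  · intro h
    have := hH u _ _ h
    rw [horoMatrix_mulVec] at this
    simpa using this

theorem plane_eta (w : Plane) : w = ![w 0, w 1] := by
  ext i
  fin_cases i <;> rfl

theorem mem_stripSlopes {H : TorusPair → Set Plane} {ω : TorusPair} {σ : ℝ} :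
    σ ∈ stripSlopes H ω ↔ 0 < σ ∧ ∃ x, 0 < x ∧ x ≤ 1 ∧ ![x, σ * x] ∈ H ω := by
  constructor
  · rintro ⟨w, hw, h0, h1, h2, rfl⟩
    refine ⟨by positivity, w 0, h0, h1, ?_⟩
    rw [div_mul_cancel₀ _ h0.ne', ← plane_eta]
    exact hw
  · rintro ⟨hσ, x, h0, h1, hx⟩
    refine ⟨_, hx, by simpa using h0, by simpa using h1, by simp; positivity, ?_⟩
    simp [h0.ne']

theorem HorocycleEquivariant.return_set {H : TorusPair → Set Plane}
    (hH : HorocycleEquivariant H) (ω : TorusPair) :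
    {u : ℝ | 0 < u ∧ horocycle u ω ∈ transversal H} = stripSlopes H ω := by
  ext u
  rw [mem_stripSlopes]
  simp only [mem_ofPred_eq, transversal, hH.mem_iff, zero_add]

theorem HorocycleEquivariant.returnTime_eq {H : TorusPair → Set Plane}
    (hH : HorocycleEquivariant H) (ω : TorusPair) :
    returnTime H ω = sInf (stripSlopes H ω) := by
  rw [returnTime, hH.return_set]

theorem HorocycleEquivariant.mem_stripSlopes_horocycle {H : TorusPair → Set Plane}
    (hH : HorocycleEquivariant H) {u : ℝ} (hu : 0 ≤ u) (ω : TorusPair) (σ : ℝ) :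
    σ ∈ stripSlopes H (horocycle u ω) ↔ 0 < σ ∧ σ + u ∈ stripSlopes H ω := by
  simp only [mem_stripSlopes, hH.mem_iff, add_mul]
  constructor
  · rintro ⟨h, h'⟩
    exact ⟨h, by positivity, h'⟩
  · rintro ⟨h, -, h'⟩
    exact ⟨h, h'⟩

theorem HorocycleEquivariant.returnTime_horocycle {H : TorusPair → Set Plane}
    (hH : HorocycleEquivariant H) {u : ℝ} (hu : 0 ≤ u) {ω : TorusPair}
    (hω : ∃ σ ∈ stripSlopes H ω, u < σ) :
    returnTime H (horocycle u ω) = sInf {σ | σ ∈ stripSlopes H ω ∧ u < σ} - u := by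
  rw [hH.returnTime_eq]
  have h1 : stripSlopes H (horocycle u ω) =
      (OrderIso.addRight (-u)) '' {σ | σ ∈ stripSlopes H ω ∧ u < σ} := by
    ext σ
    rw [hH.mem_stripSlopes_horocycle hu]
    simp only [OrderIso.addRight_apply, mem_image, mem_ofPred_eq]
    constructor
    · rintro ⟨h, h'⟩
      exact ⟨_, ⟨h', by linarith⟩, by ring⟩
    · rintro ⟨τ, ⟨h, h'⟩, rfl⟩
      exact ⟨by linarith, by simpa using h⟩
  rw [h1, ← OrderIso.map_csInf']
  · simp [sub_eq_add_neg]
  · obtain ⟨σ, h, h'⟩ := hω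
    exact ⟨σ, h, h'⟩
  · exact ⟨u, fun σ hσ => hσ.2.le⟩

theorem HorocycleEquivariant.iterate_returnMap {H : TorusPair → Set Plane}
    (hH : HorocycleEquivariant H) {ω : TorusPair}
    (hω : ∀ u, ∃ σ ∈ stripSlopes H ω, u < σ) (n : ℕ) :
    0 ≤ slopeSeq H ω n ∧ (returnMap H)^[n] ω = horocycle (slopeSeq H ω n) ω ∧
      returnTime H ((returnMap H)^[n] ω) = slopeSeq H ω (n + 1) - slopeSeq H ω n := by
  have key : ∀ k, 0 ≤ slopeSeq H ω k → (returnMap H)^[k] ω = horocycle (slopeSeq H ω k) ω →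
      returnTime H ((returnMap H)^[k] ω) = slopeSeq H ω (k + 1) - slopeSeq H ω k := by
    intro k hk hk'
    rw [hk', hH.returnTime_horocycle hk (hω _)]
    rfl
  induction n with
  | zero =>
    have h0 : (returnMap H)^[0] ω = horocycle (slopeSeq H ω 0) ω := by
      simp [slopeSeq, horocycle_zero]
    exact ⟨le_rfl, h0, key 0 le_rfl h0⟩
  | succ k ih =>
    obtain ⟨h1, h2, h3⟩ := ih
    have h4 : 0 ≤ slopeSeq H ω (k + 1) := by
      have := returnTime_nonneg H ((returnMap H)^[k] ω)
      linarith
    have h5 : (returnMap H)^[k + 1] ω = horocycle (slopeSeq H ω (k + 1)) ω := by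
      rw [Function.iterate_succ_apply']
      change horocycle (returnTime H _) _ = _
      rw [h3, h2, horocycle_horocycle, sub_add_cancel]
    exact ⟨h4, h5, key _ h4 h5⟩

theorem HorocycleEquivariant.gapProportion_eq {H : TorusPair → Set Plane}
    (hH : HorocycleEquivariant H) {ω : TorusPair}
    (hω : ∀ u, ∃ σ ∈ stripSlopes H ω, u < σ) (I : Set ℝ) (N : ℕ) :
    gapProportion H ω I N = (∑ i ∈ Finset.range N,
        ({ω' | returnTime H ω' ∈ I} : Set TorusPair).indicator (fun _ => (1 : ℝ))
          ((returnMap H)^[i] ω)) / (N : ℝ) := by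
  classical
  unfold gapProportion
  congr 1
  rw [Finset.card_filter]
  push_cast
  refine Finset.sum_congr rfl fun i _ => ?_
  rw [indicator_apply]
  simp only [mem_ofPred_eq, (hH.iterate_returnMap hω i).2.2]

theorem HorocycleEquivariant.gapDistributionHasDensity {H : TorusPair → Set Plane}
    (hH : HorocycleEquivariant H) {E : Set TorusPair} {m : Measure TorusPair} [IsFiniteMeasure m]
    (hE : ∀ ω ∈ E ∩ transversal H, ∀ u, ∃ σ ∈ stripSlopes H ω, u < σ)
    (hR : AEMeasurable (returnTime H) m) (hac : m.map (returnTime H) ≪ volume) :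
    GapDistributionHasDensity H E m := by
  refine ⟨integrable_gapDensity hR hac, fun ω hω hgen I hI => ?_⟩
  rw [setIntegral_gapDensity hR hac hI.measurableSet]
  refine (hgen I hI).congr fun N => ?_
  rw [hH.gapProportion_eq (hE ω hω)]

/-! ### Sets of vectors `g(m, n) + c v` -/

/-- The first coordinate of `g(m, n) + c v`. -/
def gridX (ω : TorusPair) (c : ℝ) (m n : ℤ) : ℝ := ω.g 0 0 * m + ω.g 0 1 * n + c * ω.v 0

/-- The second coordinate of `g(m, n) + c v`. -/
def gridY (ω : TorusPair) (c : ℝ) (m n : ℤ) : ℝ := ω.g 1 0 * m + ω.g 1 1 * n + c * ω.v 1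

/-- The vectors `g(m, n) + c v` with integers `m`, `n` and `c ∈ C`. -/
def gridVectors (C : Set ℝ) (ω : TorusPair) : Set Plane :=
  {w | ∃ c ∈ C, ∃ m n : ℤ, w = ![gridX ω c m n, gridY ω c m n]}

theorem mulVec_pair (g : Matrix (Fin 2) (Fin 2) ℝ) (x y : ℝ) :
    g.mulVec ![x, y] = ![g 0 0 * x + g 0 1 * y, g 1 0 * x + g 1 1 * y] := by
  ext i
  fin_cases i <;> simp [Matrix.mulVec, dotProduct, Fin.sum_univ_two]

theorem affineLattice_eq_gridVectors : affineLattice = gridVectors {1} := by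
  funext ω
  ext w
  simp only [affineLattice, lattice, gridVectors, mem_ofPred_eq, mem_singleton_iff,
    exists_eq_left, mulVec_pair]
  constructor
  · rintro ⟨_, ⟨m, n, rfl⟩, rfl⟩
    refine ⟨m, n, ?_⟩
    ext i
    fin_cases i <;> simp [gridX, gridY]
  · rintro ⟨m, n, rfl⟩
    refine ⟨_, ⟨m, n, rfl⟩, ?_⟩
    ext i
    fin_cases i <;> simp [gridX, gridY]

theorem gridX_horocycle (u : ℝ) (ω : TorusPair) (c : ℝ) (m n : ℤ) :
    gridX (horocycle u ω) c m n = gridX ω c m n := by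
  simp [gridX, horocycle, horoMatrix, Matrix.vecMul, Fin.sum_univ_two, dotProduct]

theorem gridY_horocycle (u : ℝ) (ω : TorusPair) (c : ℝ) (m n : ℤ) :
    gridY (horocycle u ω) c m n = gridY ω c m n - u * gridX ω c m n := by
  simp [gridX, gridY, horocycle, horoMatrix, Matrix.vecMul, Fin.sum_univ_two, dotProduct]
  ring

theorem horocycleEquivariant_gridVectors (C : Set ℝ) : HorocycleEquivariant (gridVectors C) := by
  rintro u ω _ ⟨c, hc, m, n, rfl⟩
  refine ⟨c, hc, m, n, ?_⟩
  rw [horoMatrix_mulVec, gridX_horocycle, gridY_horocycle]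
  simp

theorem mem_stripSlopes_gridVectors {C : Set ℝ} {ω : TorusPair} {σ : ℝ} :
    σ ∈ stripSlopes (gridVectors C) ω ↔ ∃ c ∈ C, ∃ m n : ℤ, 0 < gridX ω c m n ∧
      gridX ω c m n ≤ 1 ∧ 0 < gridY ω c m n ∧ σ = gridY ω c m n / gridX ω c m n := by
  constructor
  · rintro ⟨_, ⟨c, hc, m, n, rfl⟩, h⟩
    exact ⟨c, hc, m, n, by simpa using h⟩
  · rintro ⟨c, hc, m, n, h⟩
    exact ⟨_, ⟨c, hc, m, n, rfl⟩, by simpa using h⟩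

theorem finite_grid_box {ω : TorusPair} (hω : ω.g.det = 1) {C : Set ℝ} (hC : C.Finite) (B : ℝ) :
    {p : ℝ × ℤ × ℤ | p.1 ∈ C ∧ |gridX ω p.1 p.2.1 p.2.2| ≤ B ∧
      |gridY ω p.1 p.2.1 p.2.2| ≤ B}.Finite := by
  rw [Matrix.det_fin_two] at hω
  obtain ⟨D, hD⟩ : ∃ D, ∀ c ∈ C, |c| ≤ D := by
    obtain ⟨D, hD⟩ := (hC.image abs).bddAbove
    exact ⟨D, fun c hc => hD ⟨c, hc, rfl⟩⟩
  obtain ⟨K, hK⟩ : ∃ K : ℤ, ∀ i j, |ω.g i j| * (B + D * (|ω.v 0| + |ω.v 1|)) ≤ K / 2 := by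
    obtain ⟨K, hK⟩ := ((finite_range fun p : Fin 2 × Fin 2 =>
      |ω.g p.1 p.2| * (B + D * (|ω.v 0| + |ω.v 1|))).bddAbove)
    refine ⟨⌈2 * K⌉, fun i j => ?_⟩
    have h1 := hK ⟨(i, j), rfl⟩
    have h2 := Int.le_ceil (2 * K)
    simp only at h1
    linarith
  refine (hC.prod ((finite_Icc (-K) K).prod (finite_Icc (-K) K))).subset ?_
  rintro ⟨c, m, n⟩ ⟨hc, hX, hY⟩
  simp only at hc hX hY
  have hcD := hD c hc
  have bound : ∀ (z v : ℝ), |z| ≤ B → |v| ≤ |ω.v 0| + |ω.v 1| →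
      |z - c * v| ≤ B + D * (|ω.v 0| + |ω.v 1|) := by
    intro z v hz hv
    calc |z - c * v| ≤ |z| + |c * v| := abs_sub _ _
      _ ≤ B + D * (|ω.v 0| + |ω.v 1|) := by
        rw [abs_mul]
        have := mul_le_mul hcD hv (abs_nonneg _) ((abs_nonneg _).trans hcD)
        linarith
  have b0 := bound _ _ hX (le_add_of_nonneg_right (abs_nonneg (ω.v 1)))
  have b1 := bound _ _ hY (le_add_of_nonneg_left (abs_nonneg (ω.v 0)))
  have comb : ∀ (k : ℤ) (a b : ℝ) (i j i' j' : Fin 2), |a| ≤ B + D * (|ω.v 0| + |ω.v 1|) →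
      |b| ≤ B + D * (|ω.v 0| + |ω.v 1|) → (k : ℝ) = ω.g i j * a - ω.g i' j' * b →
      k ∈ Icc (-K) K := by
    intro k a b i j i' j' ha hb hk
    have h1 : |(k : ℝ)| ≤ K := by
      rw [hk]
      calc |ω.g i j * a - ω.g i' j' * b| ≤ |ω.g i j * a| + |ω.g i' j' * b| := abs_sub _ _
        _ ≤ K / 2 + K / 2 := by
          rw [abs_mul, abs_mul]
          exact add_le_add ((mul_le_mul_of_nonneg_left ha (abs_nonneg _)).trans (hK _ _))
            ((mul_le_mul_of_nonneg_left hb (abs_nonneg _)).trans (hK _ _))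
        _ = K := by ring
    rw [abs_le] at h1
    exact ⟨by exact_mod_cast h1.1, by exact_mod_cast h1.2⟩
  refine ⟨hc, comb m _ _ 1 1 0 1 b0 b1 ?_, comb n _ _ 0 0 1 0 b1 b0 ?_⟩
  · simp only [gridX, gridY]
    linear_combination (-(m : ℝ)) * hω
  · simp only [gridX, gridY]
    linear_combination (-(n : ℝ)) * hω

theorem finite_stripSlopes_le {ω : TorusPair} (hω : ω.g.det = 1) {C : Set ℝ} (hC : C.Finite)
    (t : ℝ) : {σ | σ ∈ stripSlopes (gridVectors C) ω ∧ σ ≤ t}.Finite := by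
  refine ((finite_grid_box hω hC (max 1 t)).image
    (fun p => gridY ω p.1 p.2.1 p.2.2 / gridX ω p.1 p.2.1 p.2.2)).subset ?_
  rintro σ ⟨h, ht⟩
  obtain ⟨c, hc, m, n, h0, h1, h2, rfl⟩ := mem_stripSlopes_gridVectors.1 h
  refine ⟨(c, m, n), ⟨hc, ?_, ?_⟩, rfl⟩
  · simp only
    rw [abs_of_pos h0]
    exact h1.trans (le_max_left _ _)
  · simp only
    rw [abs_of_pos h2]
    rw [div_le_iff₀ h0] at ht
    have h3 : 0 < t := pos_of_mul_pos_left (h2.trans_le ht) h0.le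
    exact (ht.trans (mul_le_of_le_one_right h3.le h1)).trans (le_max_right _ _)

theorem returnTime_mem_stripSlopes {ω : TorusPair} (hω : ω.g.det = 1) {C : Set ℝ}
    (hC : C.Finite) (hne : (stripSlopes (gridVectors C) ω).Nonempty) :
    returnTime (gridVectors C) ω ∈ stripSlopes (gridVectors C) ω := by
  rw [(horocycleEquivariant_gridVectors C).returnTime_eq]
  obtain ⟨σ, hσ⟩ := hne
  obtain ⟨τ, hτ, hmin⟩ := exists_min_image _ id (finite_stripSlopes_le hω hC σ) ⟨σ, hσ, le_rfl⟩
  have : IsLeast (stripSlopes (gridVectors C) ω) τ := by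
    refine ⟨hτ.1, fun ρ hρ => ?_⟩
    rcases le_total ρ σ with h | h
    · exact hmin ρ ⟨hρ, h⟩
    · exact hτ.2.trans h
  rw [this.csInf_eq]
  exact hτ.1

/-- All vectors `g(m, n) + c v` in the vertical strip have slope greater than `t`. -/
def SlopesExceed (C : Set ℝ) (t : ℝ) (ω : TorusPair) : Prop :=
  ∀ c ∈ C, ∀ m n : ℤ, 0 < gridX ω c m n → gridX ω c m n ≤ 1 → 0 < gridY ω c m n →
    t * gridX ω c m n < gridY ω c m n

theorem lt_returnTime_iff {ω : TorusPair} (hω : ω.g.det = 1) {C : Set ℝ}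
    (hC : C.Finite) (hne : (stripSlopes (gridVectors C) ω).Nonempty) (t : ℝ) :
    t < returnTime (gridVectors C) ω ↔ SlopesExceed C t ω := by
  constructor
  · intro h c hc m n h0 h1 h2
    rw [← lt_div_iff₀ h0]
    refine h.trans_le ?_
    rw [(horocycleEquivariant_gridVectors C).returnTime_eq]
    refine csInf_le ⟨0, fun σ hσ => (mem_stripSlopes.1 hσ).1.le⟩ ?_
    exact mem_stripSlopes_gridVectors.2 ⟨c, hc, m, n, h0, h1, h2, rfl⟩
  · intro h
    obtain ⟨c, hc, m, n, h0, h1, h2, h3⟩ :=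
      mem_stripSlopes_gridVectors.1 (returnTime_mem_stripSlopes hω hC hne)
    rw [h3, lt_div_iff₀ h0]
    exact h c hc m n h0 h1 h2

/-! ### Unboundedness of the slopes -/

theorem exists_lattice_vector_near_vertical {g : Matrix (Fin 2) (Fin 2) ℝ} (hg : g.det = 1) :
    ∃ c₀ : ℝ, 0 < c₀ ∧ ∀ ε > 0, ∃ m n : ℤ,
      |g 0 0 * m + g 0 1 * n| < ε ∧ c₀ ≤ g 1 0 * m + g 1 1 * n := by
  rw [Matrix.det_fin_two] at hg
  suffices h : ∃ c₀ : ℝ, 0 < c₀ ∧ ∀ ε > 0, ∃ m n : ℤ,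
      |g 0 0 * m + g 0 1 * n| < ε ∧ c₀ ≤ |g 1 0 * m + g 1 1 * n| by
    obtain ⟨c₀, h0, h⟩ := h
    refine ⟨c₀, h0, fun ε hε => ?_⟩
    obtain ⟨m, n, h1, h2⟩ := h ε hε
    rcases le_abs.1 h2 with h3 | h3
    · exact ⟨m, n, h1, h3⟩
    · refine ⟨-m, -n, ?_, ?_⟩
      · rw [← abs_neg]
        push_cast
        convert h1 using 2
        ring
      · push_cast
        linarith
  by_cases h00 : g 0 0 = 0
  · have h10 : g 1 0 ≠ 0 := by
      intro h
      simp [h00, h] at hg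
    exact ⟨|g 1 0|, abs_pos.2 h10, fun ε hε => ⟨1, 0, by simpa [h00] using hε, by simp⟩⟩
  have hp : 0 < |g 0 0| := abs_pos.2 h00
  refine ⟨1 / (2 * |g 0 0|), by positivity, fun ε hε => ?_⟩
  set δ := min ε (1 / (2 * (|g 1 0| + 1))) with hδ
  have hδ0 : 0 < δ := by
    rw [hδ]
    positivity
  obtain ⟨N, hN⟩ := exists_nat_gt (|g 0 0| / δ)
  have hN0 : 0 < N := by
    have : (0:ℝ) < N := lt_trans (by positivity) hN
    exact_mod_cast this
  obtain ⟨j, k, hk, -, hjk⟩ := Real.exists_int_int_abs_mul_sub_le (g 0 1 / g 0 0) hN0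
  have hx : g 0 0 * ((-j : ℤ) : ℝ) + g 0 1 * k = g 0 0 * (k * (g 0 1 / g 0 0) - j) := by
    push_cast
    field_simp
    ring
  have hy : g 1 0 * ((-j : ℤ) : ℝ) + g 1 1 * k =
      (k + g 1 0 * (g 0 0 * ((-j : ℤ) : ℝ) + g 0 1 * k)) / g 0 0 := by
    rw [eq_div_iff h00]
    linear_combination (k : ℝ) * hg
  have hX : |g 0 0 * ((-j : ℤ) : ℝ) + g 0 1 * k| < δ := by
    rw [hx, abs_mul]
    calc |g 0 0| * |k * (g 0 1 / g 0 0) - j| ≤ |g 0 0| * (1 / (N + 1)) := by gcongr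
      _ < δ := by
        rw [mul_one_div, div_lt_iff₀ (by positivity)]
        rw [div_lt_iff₀ hδ0] at hN
        nlinarith
  refine ⟨-j, k, hX.trans_le (min_le_left _ _), ?_⟩
  rw [hy, abs_div, ← div_div]
  gcongr
  have hk1 : (1 : ℝ) ≤ k := by exact_mod_cast hk
  set X := g 0 0 * ((-j : ℤ) : ℝ) + g 0 1 * k
  have h1 : |g 1 0 * X| ≤ 1 / 2 := by
    rw [abs_mul]
    have h2 : |X| ≤ 1 / (2 * (|g 1 0| + 1)) := hX.le.trans (min_le_right _ _)
    calc |g 1 0| * |X| ≤ (|g 1 0| + 1) * (1 / (2 * (|g 1 0| + 1))) := by gcongr; linarith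
      _ = 1 / 2 := by field_simp
  have := (abs_le.1 h1).1
  exact le_trans (by linarith) (le_abs_self _)

theorem exists_lattice_vector_recurrent {g : Matrix (Fin 2) (Fin 2) ℝ} (hg : g.det = 1)
    {α : ℝ} (h0 : 0 < α) (h1 : α ≤ 1) (T : ℝ) :
    ∃ m n : ℤ, -α < g 0 0 * m + g 0 1 * n ∧ g 0 0 * m + g 0 1 * n ≤ 1 - α ∧
      T < g 1 0 * m + g 1 1 * n := by
  obtain ⟨c₀, hc, H⟩ := exists_lattice_vector_near_vertical hg
  obtain ⟨p, q, hpq⟩ : ∃ p q : ℤ, g 0 0 * p + g 0 1 * q ≤ -2 := by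
    rw [Matrix.det_fin_two] at hg
    have aux : ∀ x : ℝ, x ≠ 0 → ∃ p : ℤ, x * p ≤ -2 := by
      intro x hx
      rcases lt_or_gt_of_ne hx with h | h
      · refine ⟨⌈-2 / x⌉, ?_⟩
        have := Int.le_ceil (-2 / x)
        rwa [div_le_iff_of_neg h, mul_comm] at this
      · refine ⟨⌊-2 / x⌋, ?_⟩
        have := Int.floor_le (-2 / x)
        rwa [le_div_iff₀ h, mul_comm] at this
    by_cases h00 : g 0 0 = 0
    · obtain ⟨q, hq⟩ := aux (g 0 1) (by rintro h; simp [h00, h] at hg)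
      exact ⟨0, q, by simpa using hq⟩
    · obtain ⟨q, hq⟩ := aux (g 0 0) h00
      exact ⟨q, 0, by simpa using hq⟩
  set d := g 1 0 * p + g 1 1 * q with hd
  set c := g 0 0 * p + g 0 1 * q with hc'
  obtain ⟨K, hK⟩ := exists_nat_gt (T / c₀)
  rw [div_lt_iff₀ hc] at hK
  obtain ⟨m, n, hx, hy⟩ := H (min (α / (K + 1)) (c₀ / (|T| + |d| + 1))) (by positivity)
  set x := g 0 0 * m + g 0 1 * n with hxd
  set y := g 1 0 * m + g 1 1 * n with hyd
  have hx1 := hx.trans_le (min_le_left _ _)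
  have hx2 := hx.trans_le (min_le_right _ _)
  rcases le_or_gt x 0 with hneg | hpos
  · refine ⟨K * m, K * n, ?_, ?_, ?_⟩
    · rw [lt_div_iff₀ (by positivity), abs_of_nonpos hneg] at hx1
      push_cast
      nlinarith
    · push_cast
      have : (K : ℝ) * x ≤ 0 := mul_nonpos_of_nonneg_of_nonpos (by positivity) hneg
      nlinarith
    · push_cast
      have : (K : ℝ) * c₀ ≤ K * y := by gcongr
      nlinarith
  · set j : ℤ := ⌊(-α - c) / x⌋ + 1 with hj
    have hj1 : (-α - c) / x < j := by
      rw [hj]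
      push_cast
      exact Int.lt_floor_add_one _
    have hj2 : (j : ℝ) - 1 ≤ (-α - c) / x := by
      rw [hj]
      push_cast
      simpa using Int.floor_le ((-α - c) / x)
    have hj3 := hj1
    rw [div_lt_iff₀ hpos] at hj1
    rw [le_div_iff₀ hpos] at hj2
    rw [abs_of_pos hpos, lt_div_iff₀ (by positivity)] at hx2
    have hxα : x ≤ α := by
      rw [abs_of_pos hpos, lt_div_iff₀ (by positivity)] at hx1
      have : (0:ℝ) ≤ K := Nat.cast_nonneg K
      nlinarith
    refine ⟨p + j * m, q + j * n, ?_, ?_, ?_⟩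
    · push_cast
      nlinarith
    · push_cast
      nlinarith
    · push_cast
      have h3 : 1 / x ≤ (-α - c) / x := by gcongr; linarith
      have h4 : (1 / x) * c₀ ≤ j * y := by
        apply mul_le_mul (by linarith) hy hc.le
        exact le_trans (by positivity) (h3.trans hj3.le)
      have h5 : |T| + |d| + 1 < 1 / x * c₀ := by
        rw [one_div_mul_eq_div, lt_div_iff₀ hpos]
        linarith
      have := le_abs_self T
      have := neg_abs_le d
      nlinarith

theorem stripSlopes_unbounded {ω : TorusPair} (hω : ω.g.det = 1) {C : Set ℝ}
    (hT : ω ∈ transversal (gridVectors C)) (u : ℝ) :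
    ∃ σ ∈ stripSlopes (gridVectors C) ω, u < σ := by
  obtain ⟨α, h0, h1, c, hc, p, q, hpq⟩ := hT
  have hX : α = gridX ω c p q := by simpa using congrFun hpq 0
  have hY : 0 = gridY ω c p q := by simpa using congrFun hpq 1
  obtain ⟨m, n, h2, h3, h4⟩ := exists_lattice_vector_recurrent hω h0 h1 (max u 0)
  have hX' : gridX ω c (p + m) (q + n) = α + (ω.g 0 0 * m + ω.g 0 1 * n) := by
    rw [hX]
    simp only [gridX]
    push_cast
    ring
  have hY' : gridY ω c (p + m) (q + n) = ω.g 1 0 * m + ω.g 1 1 * n := by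
    rw [← zero_add (ω.g 1 0 * m + ω.g 1 1 * n), hY]
    simp only [gridY]
    push_cast
    ring
  have h5 := (le_max_left u 0).trans_lt h4
  have h6 := (le_max_right u 0).trans_lt h4
  have h7 : 0 < gridX ω c (p + m) (q + n) := by linarith
  have h8 : gridX ω c (p + m) (q + n) ≤ 1 := by linarith
  refine ⟨_, mem_stripSlopes_gridVectors.2 ⟨c, hc, p + m, q + n, h7, h8, by rwa [hY'], rfl⟩, ?_⟩
  rw [lt_div_iff₀ h7, hY']
  nlinarith

/-! ### Measurability -/

theorem measurable_torusPair_iff {X : Type*} [MeasurableSpace X] {f : X → TorusPair} :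
    Measurable f ↔ (∀ i j, Measurable fun x => (f x).g i j) ∧ ∀ i, Measurable fun x => (f x).v i := by
  rw [measurable_comap_iff]
  constructor
  · intro h
    refine ⟨fun i j => ?_, fun i => ?_⟩
    · exact (measurable_pi_apply j).comp ((measurable_pi_apply i).comp (measurable_fst.comp h))
    · exact (measurable_pi_apply i).comp (measurable_snd.comp h)
  · rintro ⟨h1, h2⟩
    exact (measurable_pi_lambda _ fun i => measurable_pi_lambda _ fun j => h1 i j).prodMk
      (measurable_pi_lambda _ h2)

@[fun_prop]
theorem measurable_torusPair_g (i j : Fin 2) : Measurable fun ω : TorusPair => ω.g i j :=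
  (measurable_torusPair_iff.1 measurable_id).1 i j

@[fun_prop]
theorem measurable_torusPair_v (i : Fin 2) : Measurable fun ω : TorusPair => ω.v i :=
  (measurable_torusPair_iff.1 measurable_id).2 i

@[fun_prop]
theorem measurable_gridX (c : ℝ) (m n : ℤ) : Measurable fun ω => gridX ω c m n := by
  unfold gridX
  fun_prop

@[fun_prop]
theorem measurable_gridY (c : ℝ) (m n : ℤ) : Measurable fun ω => gridY ω c m n := by
  unfold gridY
  fun_prop

theorem measurableSet_exists_slope {C : Set ℝ} (hC : C.Countable) {A : Set ℝ}
    (hA : MeasurableSet A) :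
    MeasurableSet {ω | ∃ σ ∈ stripSlopes (gridVectors C) ω, σ ∈ A} := by
  have : {ω | ∃ σ ∈ stripSlopes (gridVectors C) ω, σ ∈ A} = ⋃ c ∈ C, ⋃ m : ℤ, ⋃ n : ℤ,
      {ω | 0 < gridX ω c m n ∧ gridX ω c m n ≤ 1 ∧ 0 < gridY ω c m n ∧
        gridY ω c m n / gridX ω c m n ∈ A} := by
    ext ω
    simp only [mem_ofPred_eq, mem_stripSlopes_gridVectors, mem_iUnion, exists_prop]
    constructor
    · rintro ⟨_, ⟨c, hc, m, n, h0, h1, h2, rfl⟩, h⟩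
      exact ⟨c, hc, m, n, h0, h1, h2, h⟩
    · rintro ⟨c, hc, m, n, h0, h1, h2, h⟩
      exact ⟨_, ⟨c, hc, m, n, h0, h1, h2, rfl⟩, h⟩
  rw [this]
  refine MeasurableSet.biUnion hC fun c _ => MeasurableSet.iUnion fun m => MeasurableSet.iUnion
    fun n => ?_
  refine MeasurableSet.inter (measurableSet_lt measurable_const (measurable_gridX c m n)) ?_
  refine MeasurableSet.inter (measurableSet_le (measurable_gridX c m n) measurable_const) ?_
  refine MeasurableSet.inter (measurableSet_lt measurable_const (measurable_gridY c m n)) ?_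
  exact (Measurable.div (measurable_gridY c m n) (measurable_gridX c m n)) hA

theorem measurable_returnTime {C : Set ℝ} (hC : C.Countable) :
    Measurable (returnTime (gridVectors C)) := by
  refine measurable_of_Iio fun u => ?_
  have : returnTime (gridVectors C) ⁻¹' Iio u =
      {ω | ∃ σ ∈ stripSlopes (gridVectors C) ω, σ ∈ Iio u} ∪
        ({ω | ∃ σ ∈ stripSlopes (gridVectors C) ω, σ ∈ univ}ᶜ ∩ {_ω | 0 < u}) := by
    ext ω
    simp only [mem_preimage, mem_Iio, (horocycleEquivariant_gridVectors C).returnTime_eq,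
      mem_union, mem_ofPred_eq, mem_inter_iff, mem_compl_iff, mem_univ, and_true]
    by_cases hne : (stripSlopes (gridVectors C) ω).Nonempty
    · have hn : ∃ σ, σ ∈ stripSlopes (gridVectors C) ω := hne
      rw [csInf_lt_iff ⟨0, fun σ hσ => (mem_stripSlopes.1 hσ).1.le⟩ hne]
      simp [hn]
    · rw [not_nonempty_iff_eq_empty] at hne
      simp [hne]
  rw [this]
  exact (measurableSet_exists_slope hC measurableSet_Iio).union
    ((measurableSet_exists_slope hC MeasurableSet.univ).compl.inter (MeasurableSet.const _))

theorem ae_returnTime_notMem {X : Type*} [MeasurableSpace X] {κ : Measure X}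
    {f : X → TorusPair} {C : Set ℝ} (hC : C.Finite) (hdet : ∀ᵐ p ∂κ, (f p).g.det = 1)
    (hT : ∀ᵐ p ∂κ, f p ∈ transversal (gridVectors C)) {A : Set ℝ}
    (hnull : ∀ c ∈ C, ∀ k l : ℤ, ∀ᵐ p ∂κ, 0 < gridX (f p) c k l → 0 < gridY (f p) c k l →
      gridY (f p) c k l / gridX (f p) c k l ∉ A) :
    ∀ᵐ p ∂κ, returnTime (gridVectors C) (f p) ∉ A := by
  have hall : ∀ᵐ p ∂κ, ∀ c ∈ C, ∀ k l : ℤ, 0 < gridX (f p) c k l → 0 < gridY (f p) c k l →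
      gridY (f p) c k l / gridX (f p) c k l ∉ A := by
    rw [ae_ball_iff hC.countable]
    intro c hc
    rw [ae_all_iff]
    intro k
    rw [ae_all_iff]
    intro l
    exact hnull c hc k l
  filter_upwards [hdet, hT, hall] with p h1 h2 h3 h4
  obtain ⟨σ, hσ, -⟩ := stripSlopes_unbounded h1 h2 0
  obtain ⟨c, hc, k, l, h5, h6, h7, h8⟩ :=
    mem_stripSlopes_gridVectors.1 (returnTime_mem_stripSlopes h1 hC ⟨σ, hσ⟩)
  exact h3 c hc k l h5 h7 (h8 ▸ h4)

/-! ### Saddle connections of doubled slit tori -/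

theorem mem_lattice_iff {g : Matrix (Fin 2) (Fin 2) ℝ} {w : Plane} :
    w ∈ lattice g ↔ ∃ m n : ℤ, w = ![g 0 0 * m + g 0 1 * n, g 1 0 * m + g 1 1 * n] := by
  simp only [lattice, mem_ofPred_eq, mulVec_pair]

theorem lattice_sub_mem {g : Matrix (Fin 2) (Fin 2) ℝ} {w z : Plane} (hw : w ∈ lattice g)
    (hz : z ∈ lattice g) : w - z ∈ lattice g := by
  obtain ⟨m, n, rfl⟩ := hw
  obtain ⟨k, l, rfl⟩ := hz
  refine ⟨m - k, n - l, ?_⟩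
  rw [← Matrix.mulVec_sub]
  congr 1
  ext i
  fin_cases i <;> simp

theorem mem_gridVectors_iff {C : Set ℝ} {ω : TorusPair} {w : Plane} :
    w ∈ gridVectors C ω ↔ ∃ c ∈ C, w - c • ω.v ∈ lattice ω.g := by
  simp only [mem_lattice_iff, gridVectors, mem_ofPred_eq, sub_eq_iff_eq_add]
  refine exists_congr fun c => and_congr_right fun _ => exists_congr fun m => exists_congr fun n => ?_
  refine Eq.congr_right ?_
  ext i
  fin_cases i <;> simp [gridX, gridY]

theorem markedPoints_eq_gridVectors (ω : TorusPair) : markedPoints ω = gridVectors {0, 1} ω := by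
  ext w
  rw [mem_gridVectors_iff]
  simp only [markedPoints, affineLattice, mem_union, mem_ofPred_eq, mem_insert_iff,
    mem_singleton_iff, exists_eq_or_imp, exists_eq_left, zero_smul, sub_zero, one_smul]
  refine or_congr_right ⟨?_, fun h => ⟨_, h, by simp⟩⟩
  rintro ⟨z, hz, rfl⟩
  simpa using hz

theorem zero_mem_lattice (g : Matrix (Fin 2) (Fin 2) ℝ) : (0 : Plane) ∈ lattice g :=
  ⟨0, 0, by
    have : (![((0 : ℤ) : ℝ), ((0 : ℤ) : ℝ)] : Plane) = 0 := by
      ext i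
      fin_cases i <;> simp
    rw [this, Matrix.mulVec_zero]⟩

theorem sub_mem_gridVectors_of_markedPoints {ω : TorusPair} {p r : Plane}
    (hp : p ∈ markedPoints ω) (hr : r ∈ markedPoints ω) :
    r - p ∈ gridVectors {0, 1, -1} ω := by
  rw [markedPoints_eq_gridVectors, mem_gridVectors_iff] at hp hr
  obtain ⟨c, hc, hp⟩ := hp
  obtain ⟨d, hd, hr⟩ := hr
  rw [mem_gridVectors_iff]
  refine ⟨d - c, ?_, ?_⟩
  · rcases hc with rfl | rfl <;> rcases hd with rfl | rfl <;> simp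
  · convert lattice_sub_mem hr hp using 1
    module

theorem exists_markedPoints_sub_eq {ω : TorusPair} {w : Plane}
    (hw : w ∈ gridVectors {0, 1, -1} ω) :
    ∃ p ∈ markedPoints ω, p + w ∈ markedPoints ω := by
  simp only [markedPoints_eq_gridVectors, mem_gridVectors_iff] at *
  simp only [mem_insert_iff, mem_singleton_iff, exists_eq_or_imp, exists_eq_left] at *
  have h0 := zero_mem_lattice ω.g
  rcases hw with h | h | h
  · exact ⟨0, by simp [h0], by simpa using Or.inl h⟩
  · exact ⟨0, by simp [h0], by simpa using Or.inr h⟩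
  · refine ⟨ω.v, by simp [h0], Or.inl ?_⟩
    convert h using 1
    module

theorem exists_smul_mem_saddleHolonomies {ω : TorusPair} (hω : ω.g.det = 1) {w : Plane}
    (hw : w ∈ gridVectors {0, 1, -1} ω) (h0 : w ≠ 0) :
    ∃ r : ℝ, 0 < r ∧ r ≤ 1 ∧ r • w ∈ saddleHolonomies ω := by
  obtain ⟨p, hp, hpw⟩ := exists_markedPoints_sub_eq hw
  obtain ⟨i, hi⟩ : ∃ i, w i ≠ 0 := by
    by_contra! h
    exact h0 (funext h)
  set S : Set ℝ := {r | 0 < r ∧ r ≤ 1 ∧ p + r • w ∈ markedPoints ω} with hS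
  have hfin : S.Finite := by
    set B := |p 0| + |p 1| + (|w 0| + |w 1|)
    refine ((finite_grid_box hω (toFinite ({0, 1} : Set ℝ)) B).image (fun q =>
      ((![gridX ω q.1 q.2.1 q.2.2, gridY ω q.1 q.2.1 q.2.2] : Plane) i - p i) / w i)).subset ?_
    rintro r ⟨hr0, hr1, hr⟩
    rw [markedPoints_eq_gridVectors] at hr
    obtain ⟨c, hc, m, n, heq⟩ := hr
    have bound : ∀ k, |(p + r • w) k| ≤ |p k| + |w k| := by
      intro k
      calc |(p + r • w) k| ≤ |p k| + |r * w k| := abs_add_le _ _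
        _ ≤ |p k| + |w k| := by
          rw [abs_mul, abs_of_pos hr0]
          have := mul_le_of_le_one_left (abs_nonneg (w k)) hr1
          linarith
    have b0 := bound 0
    have b1 := bound 1
    rw [heq] at b0 b1
    have := abs_nonneg (p 0)
    have := abs_nonneg (p 1)
    have := abs_nonneg (w 0)
    have := abs_nonneg (w 1)
    refine ⟨(c, m, n), ⟨hc, ?_, ?_⟩, ?_⟩
    · simp only [Matrix.cons_val_zero, B] at b0 ⊢
      linarith
    · simp only [Matrix.cons_val_one, B] at b1 ⊢
      simp only [Matrix.cons_val_fin_one] at b1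
      linarith
    · simp only
      rw [← heq]
      simp [hi]
  obtain ⟨r, ⟨hr0, hr1, hr⟩, hmin⟩ := exists_min_image S id hfin ⟨1, by simp, le_rfl, by simpa⟩
  refine ⟨r, hr0, hr1, p, hp, _, hr, ?_, ?_, ?_⟩
  · intro h
    have : r • w = 0 := by simpa using h.symm
    simp [hr0.ne', h0] at this
  · rw [openSegment_eq_image', Set.disjoint_left]
    rintro _ ⟨θ, ⟨hθ0, hθ1⟩, rfl⟩ hq
    simp only [add_sub_cancel_left, smul_smul] at hq
    have h2 : θ * r < r := mul_lt_of_lt_one_left hr0 hθ1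
    have := hmin (θ * r) ⟨by positivity, by linarith, hq⟩
    simp only [id] at this
    linarith
  · simp

theorem saddleHolonomies_subset (ω : TorusPair) :
    saddleHolonomies ω ⊆ gridVectors {0, 1, -1} ω := by
  rintro _ ⟨p, hp, r, hr, -, -, rfl⟩
  exact sub_mem_gridVectors_of_markedPoints hp hr

theorem transversal_saddleHolonomies_iff {ω : TorusPair} (hω : ω.g.det = 1) :
    ω ∈ transversal saddleHolonomies ↔ ω ∈ transversal (gridVectors {0, 1, -1}) := by
  constructor
  · rintro ⟨α, h0, h1, h⟩
    exact ⟨α, h0, h1, saddleHolonomies_subset ω h⟩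
  · rintro ⟨α, h0, h1, h⟩
    obtain ⟨r, hr0, hr1, hr⟩ := exists_smul_mem_saddleHolonomies hω h
      (fun h' => h0.ne' (by simpa using congrFun h' 0))
    refine ⟨r * α, by positivity, mul_le_one₀ hr1 h0.le h1, ?_⟩
    simpa using hr

theorem stripSlopes_saddleHolonomies {ω : TorusPair} (hω : ω.g.det = 1) :
    stripSlopes saddleHolonomies ω = stripSlopes (gridVectors {0, 1, -1}) ω := by
  ext σ
  constructor
  · rintro ⟨w, hw, h⟩
    exact ⟨w, saddleHolonomies_subset ω hw, h⟩
  · rintro ⟨w, hw, h0, h1, h2, rfl⟩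
    obtain ⟨r, hr0, hr1, hr⟩ := exists_smul_mem_saddleHolonomies hω hw
      (fun h' => h0.ne' (by simpa using congrFun h' 0))
    refine ⟨_, hr, by simp; positivity, ?_, by simp; positivity, ?_⟩
    · simpa using mul_le_one₀ hr1 h0.le h1
    · simp only [Pi.smul_apply, smul_eq_mul]
      rw [mul_div_mul_left _ _ hr0.ne']

theorem horocycleEquivariant_saddleHolonomies : HorocycleEquivariant saddleHolonomies := by
  have hM : ∀ u ω, markedPoints (horocycle u ω) = (horoMatrix u).mulVec '' markedPoints ω := by
    have h1 : ∀ u ω, (horoMatrix u).mulVec '' markedPoints ω ⊆ markedPoints (horocycle u ω) := by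
      rintro u ω _ ⟨w, hw, rfl⟩
      rw [markedPoints_eq_gridVectors] at *
      exact horocycleEquivariant_gridVectors _ u ω w hw
    refine fun u ω => Subset.antisymm (fun w hw => ?_) (h1 u ω)
    have h2 := h1 (-u) _ ⟨w, hw, rfl⟩
    rw [horocycle_horocycle, neg_add_cancel, horocycle_zero] at h2
    refine ⟨_, h2, ?_⟩
    rw [horoMatrix_mulVec, horoMatrix_mulVec]
    ext i
    fin_cases i <;> simp
  rintro u ω _ ⟨p, hp, r, hr, hne, hdis, rfl⟩
  have hinj : Function.Injective (horoMatrix u).mulVec := by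
    intro x y hxy
    simp only [horoMatrix_mulVec] at hxy
    have h0 : x 0 = y 0 := by simpa using congrFun hxy 0
    have h1 : x 1 - u * x 0 = y 1 - u * y 0 := by simpa using congrFun hxy 1
    ext i
    fin_cases i
    · exact h0
    · simp only [Fin.mk_one]
      rw [h0] at h1
      linarith
  refine ⟨_, by rw [hM]; exact mem_image_of_mem _ hp, _, by rw [hM]; exact mem_image_of_mem _ hr,
    hinj.ne hne, ?_, ?_⟩
  · have := image_openSegment ℝ (Matrix.mulVecLin (horoMatrix u)).toAffineMap p r
    simp only [LinearMap.coe_toAffineMap, Matrix.mulVecLin_apply] at this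
    rw [hM, ← this]
    exact (disjoint_image_iff hinj).2 hdis
  · rw [Matrix.mulVec_sub]

theorem returnTime_saddleHolonomies {ω : TorusPair} (hω : ω.g.det = 1) :
    returnTime saddleHolonomies ω = returnTime (gridVectors {0, 1, -1}) ω := by
  rw [horocycleEquivariant_saddleHolonomies.returnTime_eq, stripSlopes_saddleHolonomies hω,
    (horocycleEquivariant_gridVectors _).returnTime_eq]

/-! ### Integration in four coordinates -/

theorem map_affine_volume (c : ℝ) {k : ℝ} (hk : k ≠ 0) :
    Measure.map (fun x : ℝ => c + k * x) volume = ENNReal.ofReal |k⁻¹| • volume := by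
  have : (fun x : ℝ => c + k * x) = (fun x => c + x) ∘ fun x => k * x := rfl
  rw [this, ← Measure.map_map (by fun_prop) (by fun_prop), Real.map_volume_mul_left hk,
    Measure.map_smul, map_add_left_eq_self]

theorem lintegral_comp_affine (c : ℝ) {k : ℝ} (hk : k ≠ 0) {f : ℝ → ℝ≥0∞} (hf : Measurable f) :
    ∫⁻ x, f (c + k * x) = ENNReal.ofReal |k⁻¹| * ∫⁻ x, f x := by
  rw [← lintegral_map (μ := volume) (g := fun x : ℝ => c + k * x) hf (by fun_prop),
    map_affine_volume c hk, lintegral_smul_measure, smul_eq_mul]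

theorem lintegral_four {F : ℝ × ℝ × ℝ × ℝ → ℝ≥0∞} (hF : Measurable F) :
    ∫⁻ q, F q = ∫⁻ a, ∫⁻ b, ∫⁻ s, ∫⁻ r, F (a, b, s, r) := by
  rw [Measure.volume_eq_prod, lintegral_prod _ hF.aemeasurable]
  refine lintegral_congr fun a => ?_
  rw [Measure.volume_eq_prod, lintegral_prod _ (by fun_prop)]
  refine lintegral_congr fun b => ?_
  rw [Measure.volume_eq_prod, lintegral_prod _ (by fun_prop)]

theorem lintegral_four_comp_affine (c : ℝ × ℝ × ℝ × ℝ) {k : ℝ × ℝ × ℝ × ℝ} (h1 : k.1 ≠ 0)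
    (h2 : k.2.1 ≠ 0) (h3 : k.2.2.1 ≠ 0) (h4 : k.2.2.2 ≠ 0) {F : ℝ × ℝ × ℝ × ℝ → ℝ≥0∞}
    (hF : Measurable F) :
    ∫⁻ q, F (c + k * q) = ENNReal.ofReal |(k.1 * k.2.1 * k.2.2.1 * k.2.2.2)⁻¹| * ∫⁻ q, F q := by
  rw [lintegral_four hF, lintegral_four (by fun_prop)]
  obtain ⟨c1, c2, c3, c4⟩ := c
  obtain ⟨k1, k2, k3, k4⟩ := k
  simp only at h1 h2 h3 h4
  change ∫⁻ a, ∫⁻ b, ∫⁻ s, ∫⁻ r, F (c1 + k1 * a, c2 + k2 * b, c3 + k3 * s, c4 + k4 * r) = _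
  have m1 : Measurable fun a => ∫⁻ b, ∫⁻ s, ∫⁻ r, F (a, b, s, r) :=
    Measurable.lintegral_prod_right' (f := fun z : ℝ × ℝ => ∫⁻ s, ∫⁻ r, F (z.1, z.2, s, r))
      (Measurable.lintegral_prod_right' (f := fun z : (ℝ × ℝ) × ℝ => ∫⁻ r, F (z.1.1, z.1.2, z.2, r))
        (Measurable.lintegral_prod_right'
          (f := fun z : ((ℝ × ℝ) × ℝ) × ℝ => F (z.1.1.1, z.1.1.2, z.1.2, z.2)) (by fun_prop)))
  have m2 : ∀ a, Measurable fun b => ∫⁻ s, ∫⁻ r, F (a, b, s, r) := fun a =>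
    (Measurable.lintegral_prod_right' (f := fun z : ℝ × ℝ => ∫⁻ r, F (a, z.1, z.2, r))
        (Measurable.lintegral_prod_right'
          (f := fun z : (ℝ × ℝ) × ℝ => F (a, z.1.1, z.1.2, z.2)) (by fun_prop)))
  have m3 : ∀ a b, Measurable fun s => ∫⁻ r, F (a, b, s, r) := fun a b =>
    (Measurable.lintegral_prod_right' (f := fun z : ℝ × ℝ => F (a, b, z.1, z.2)) (by fun_prop))
  have e3 : ∀ a b, ∫⁻ s, ∫⁻ r, F (a, b, c3 + k3 * s, c4 + k4 * r) =
      ENNReal.ofReal |k3⁻¹| * ENNReal.ofReal |k4⁻¹| * ∫⁻ s, ∫⁻ r, F (a, b, s, r) := by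
    intro a b
    have : ∀ s, ∫⁻ r, F (a, b, c3 + k3 * s, c4 + k4 * r) =
        ENNReal.ofReal |k4⁻¹| * ∫⁻ r, F (a, b, c3 + k3 * s, r) := fun s =>
      lintegral_comp_affine c4 h4 (f := fun r => F (a, b, c3 + k3 * s, r)) (by fun_prop)
    simp only [this]
    have h := lintegral_comp_affine c3 h3 (m3 a b)
    beta_reduce at h
    rw [lintegral_const_mul' _ _ ENNReal.ofReal_ne_top, h]
    ring
  have e2 : ∀ a, ∫⁻ b, ∫⁻ s, ∫⁻ r, F (a, c2 + k2 * b, c3 + k3 * s, c4 + k4 * r) =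
      ENNReal.ofReal |k2⁻¹| * (ENNReal.ofReal |k3⁻¹| * ENNReal.ofReal |k4⁻¹|) *
        ∫⁻ b, ∫⁻ s, ∫⁻ r, F (a, b, s, r) := by
    intro a
    simp only [e3]
    have h := lintegral_comp_affine c2 h2 (m2 a)
    beta_reduce at h
    rw [lintegral_const_mul' _ _ (ENNReal.mul_ne_top ENNReal.ofReal_ne_top ENNReal.ofReal_ne_top), h]
    ring
  simp only [e2]
  have h := lintegral_comp_affine c1 h1 m1
  beta_reduce at h
  rw [lintegral_const_mul' _ _ (ENNReal.mul_ne_top ENNReal.ofReal_ne_top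
    (ENNReal.mul_ne_top ENNReal.ofReal_ne_top ENNReal.ofReal_ne_top)), h]
  simp only [mul_inv, abs_mul]
  rw [ENNReal.ofReal_mul (by positivity), ENNReal.ofReal_mul (by positivity),
    ENNReal.ofReal_mul (by positivity)]
  ring

theorem tendsto_sq_mul_lintegral {F : ℝ → ℝ × ℝ × ℝ × ℝ → ℝ≥0∞} {G : ℝ × ℝ × ℝ × ℝ → ℝ≥0∞}
    {K : Set (ℝ × ℝ × ℝ × ℝ)} (c : ℝ × ℝ × ℝ × ℝ) (k : ℝ → ℝ × ℝ × ℝ × ℝ)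
    (hF : ∀ t, Measurable (F t))
    (hk : ∀ t > 0, |(k t).1 * (k t).2.1 * (k t).2.2.1 * (k t).2.2.2| = (t ^ 2)⁻¹)
    (hKm : MeasurableSet K) (hK : volume K ≠ ∞)
    (hbound : ∀ᶠ t in atTop, ∀ q, F t (c + k t * q) ≤ K.indicator 1 q)
    (hlim : ∀ᵐ q, Tendsto (fun t => F t (c + k t * q)) atTop (𝓝 (G q))) :
    Tendsto (fun t : ℝ => ENNReal.ofReal (t ^ 2) * ∫⁻ q, F t q) atTop (𝓝 (∫⁻ q, G q)) := by
  have h1 : Tendsto (fun t : ℝ => ∫⁻ q, F t (c + k t * q)) atTop (𝓝 (∫⁻ q, G q)) := by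
    refine tendsto_lintegral_filter_of_dominated_convergence (K.indicator 1)
      (Eventually.of_forall fun t => (hF t).comp (by fun_prop))
      (hbound.mono fun t ht => Eventually.of_forall ht) ?_ hlim
    rw [lintegral_indicator_one hKm]
    exact hK
  refine h1.congr' ?_
  filter_upwards [eventually_gt_atTop 0] with t ht
  have h2 := hk t ht
  have h3 : (k t).1 * (k t).2.1 * (k t).2.2.1 * (k t).2.2.2 ≠ 0 := by
    rw [← abs_ne_zero, h2]
    positivity
  simp only [mul_ne_zero_iff] at h3
  rw [lintegral_four_comp_affine c h3.1.1.1 h3.1.1.2 h3.1.2 h3.2 (hF t), abs_inv, h2, inv_inv]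

theorem volume_four {S : Set (ℝ × ℝ × ℝ × ℝ)} (hS : MeasurableSet S) :
    volume S = ∫⁻ a, ∫⁻ b, volume {q : ℝ × ℝ | (a, b, q) ∈ S} := by
  rw [Measure.volume_eq_prod, Measure.prod_apply hS]
  refine lintegral_congr fun a => ?_
  rw [Measure.volume_eq_prod, Measure.prod_apply (measurable_prodMk_left hS)]
  rfl

/-! ### Estimates for the flux measure -/

/-- The range `0 < a ≤ 1`, `1 - a < b ≤ 1` of the coordinates of the lattices `p_{a,b} ℤ²`. -/
def fareyTriangle : Set (ℝ × ℝ) := {p | 0 < p.1 ∧ p.1 ≤ 1 ∧ 1 - p.1 < p.2 ∧ p.2 ≤ 1}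

theorem lintegral_inv_mul_le (ε : ℝ) (hε : 0 < ε) :
    ∫⁻ a, ∫⁻ b, (fareyTriangle ∩ {p : ℝ × ℝ | p.1 * p.2 < ε}).indicator
      (fun p => ENNReal.ofReal (p.1 * p.2)⁻¹) (a, b) ≤ ENNReal.ofReal (8 * ε) := by
  set U : Set (ℝ × ℝ) := {p | 0 < p.1 ∧ p.1 < 2 * ε ∧ 1 - p.1 < p.2 ∧ p.2 ≤ 1} with hU
  have hUm : MeasurableSet U := by
    measurability
  set k : ℝ × ℝ → ℝ≥0∞ := U.indicator fun p => ENNReal.ofReal (2 / p.1) with hk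
  have hkm : Measurable k := Measurable.indicator (by fun_prop) hUm
  have hk4 : ∫⁻ a, ∫⁻ b, k (a, b) ≤ ENNReal.ofReal (4 * ε) := by
    calc ∫⁻ a, ∫⁻ b, k (a, b) ≤ ∫⁻ a, (Ioo 0 (2 * ε)).indicator (fun _ => 2) a := by
          refine lintegral_mono fun a => ?_
          by_cases ha : a ∈ Ioo 0 (2 * ε)
          · rw [indicator_of_mem ha]
            calc ∫⁻ b, k (a, b) ≤ ∫⁻ b, (Ioc (1 - a) 1).indicator
                  (fun _ => ENNReal.ofReal (2 / a)) b := by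
                  refine lintegral_mono fun b => ?_
                  by_cases hb : b ∈ Ioc (1 - a) 1
                  · rw [indicator_of_mem hb, hk]
                    exact indicator_le_self' (by simp) _
                  · rw [indicator_of_notMem hb, hk, indicator_of_notMem]
                    exact fun h => hb h.2.2
              _ = ENNReal.ofReal (2 / a) * ENNReal.ofReal a := by
                  rw [lintegral_indicator_const measurableSet_Ioc, Real.volume_Ioc]
                  simp
              _ = 2 := by
                  rw [← ENNReal.ofReal_mul (by have := ha.1; positivity),
                    div_mul_cancel₀ _ ha.1.ne']
                  simp
              _ ≤ _ := le_rfl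
          · rw [indicator_of_notMem ha]
            have : ∀ b, k (a, b) = 0 := fun b => by
              rw [hk, indicator_of_notMem]
              exact fun h => ha ⟨h.1, h.2.1⟩
            simp [this]
      _ = ENNReal.ofReal (4 * ε) := by
          rw [lintegral_indicator_const measurableSet_Ioo, Real.volume_Ioo,
            show (2 : ℝ≥0∞) = ENNReal.ofReal 2 by simp, ← ENNReal.ofReal_mul (by norm_num)]
          congr 1
          ring
  have hswap : ∫⁻ a, ∫⁻ b, k (b, a) ≤ ENNReal.ofReal (4 * ε) := by
    rw [lintegral_lintegral_swap (by fun_prop)]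
    exact hk4
  calc _ ≤ ∫⁻ a, ∫⁻ b, (k (a, b) + k (b, a)) := by
        refine lintegral_mono fun a => lintegral_mono fun b => ?_
        by_cases h : (a, b) ∈ fareyTriangle ∩ {p : ℝ × ℝ | p.1 * p.2 < ε}
        · rw [indicator_of_mem h]
          obtain ⟨⟨h1, h2, h3, h4⟩, h5⟩ := h
          simp only [mem_ofPred_eq] at h1 h2 h3 h4 h5
          have hb : 0 < b := by linarith
          rcases le_total a b with hab | hab
          · have hb2 : 1 / 2 ≤ b := by linarith
            refine le_trans ?_ le_self_add
            rw [hk, indicator_of_mem]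
            · refine ENNReal.ofReal_le_ofReal ?_
              simp only
              rw [inv_le_comm₀ (by positivity) (by positivity), inv_div]
              nlinarith
            · exact ⟨h1, by simp only; nlinarith, h3, h4⟩
          · have ha2 : 1 / 2 ≤ a := by linarith
            refine le_trans ?_ le_add_self
            rw [hk, indicator_of_mem]
            · refine ENNReal.ofReal_le_ofReal ?_
              simp only
              rw [inv_le_comm₀ (by positivity) (by positivity), inv_div]
              nlinarith
            · exact ⟨hb, by simp only; nlinarith, by simp only; linarith, h2⟩
        · rw [indicator_of_notMem h]
          exact zero_le
    _ = (∫⁻ a, ∫⁻ b, k (a, b)) + ∫⁻ a, ∫⁻ b, k (b, a) := by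
        have : ∀ a, ∫⁻ b, (k (a, b) + k (b, a)) = (∫⁻ b, k (a, b)) + ∫⁻ b, k (b, a) :=
          fun a => lintegral_add_left (by fun_prop) _
        simp only [this]
        exact lintegral_add_left hkm.lintegral_prod_right' _
    _ ≤ ENNReal.ofReal (4 * ε) + ENNReal.ofReal (4 * ε) := add_le_add hk4 hswap
    _ = ENNReal.ofReal (8 * ε) := by
        rw [← ENNReal.ofReal_add (by positivity) (by positivity)]
        congr 1
        ring

theorem measurableSet_omegaCoords : MeasurableSet omegaCoords := by
  unfold omegaCoords
  measurability

theorem fluxMeasure_apply {A : Set (ℝ × ℝ × ℝ × ℝ)} (hA : MeasurableSet A) :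
    fluxMeasure A = ∫⁻ p, (omegaCoords ∩ A).indicator (fun p => ENNReal.ofReal p.2.2.2) p := by
  rw [fluxMeasure, withDensity_apply _ hA, Measure.restrict_restrict hA, inter_comm,
    lintegral_indicator (measurableSet_omegaCoords.inter hA)]

/-- The flux of a set of points with `ab < ε` and with `α ≤ w` in an interval of length `δ` that
depends on `a` and `b`. -/
theorem fluxMeasure_le {A : Set (ℝ × ℝ × ℝ × ℝ)} {ε δ w : ℝ} (hε : 0 < ε) (hδ : 0 ≤ δ)
    (hw : 0 ≤ w) {l : ℝ × ℝ → ℝ} (hl : Measurable l)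
    (h : ∀ a b s α, (a, b, s, α) ∈ omegaCoords → (a, b, s, α) ∈ A →
      a * b < ε ∧ l (a, b) ≤ α ∧ α ≤ l (a, b) + δ ∧ α ≤ w) :
    fluxMeasure A ≤ ENNReal.ofReal (8 * ε * δ * w) := by
  set B : Set (ℝ × ℝ × ℝ × ℝ) := {p | p.1 * p.2.1 < ε ∧ l (p.1, p.2.1) ≤ p.2.2.2 ∧
    p.2.2.2 ≤ l (p.1, p.2.1) + δ ∧ p.2.2.2 ≤ w} with hB
  have hBm : MeasurableSet B := by
    measurability
  have hS := measurableSet_omegaCoords.inter hBm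
  have hAB : fluxMeasure A ≤ fluxMeasure B := by
    have hc : fluxMeasure omegaCoordsᶜ = 0 := by
      rw [fluxMeasure_apply measurableSet_omegaCoords.compl]
      simp
    calc fluxMeasure A ≤ fluxMeasure (B ∪ omegaCoordsᶜ) := by
          refine measure_mono fun p hp => ?_
          by_cases hpo : p ∈ omegaCoords
          · exact Or.inl (h _ _ _ _ hpo hp)
          · exact Or.inr hpo
      _ ≤ fluxMeasure B + fluxMeasure omegaCoordsᶜ := measure_union_le _ _
      _ = fluxMeasure B := by rw [hc, add_zero]
  refine hAB.trans ?_
  rw [fluxMeasure_apply hBm]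
  calc ∫⁻ p, (omegaCoords ∩ B).indicator (fun p => ENNReal.ofReal p.2.2.2) p
      ≤ ∫⁻ p, (omegaCoords ∩ B).indicator (fun _ => ENNReal.ofReal w) p := by
        refine lintegral_mono fun p => ?_
        by_cases hp : p ∈ omegaCoords ∩ B
        · rw [indicator_of_mem hp, indicator_of_mem hp]
          exact ENNReal.ofReal_le_ofReal hp.2.2.2.2
        · rw [indicator_of_notMem hp, indicator_of_notMem hp]
    _ = ENNReal.ofReal w * volume (omegaCoords ∩ B) := lintegral_indicator_const hS _
    _ ≤ ENNReal.ofReal w * (ENNReal.ofReal δ * ENNReal.ofReal (8 * ε)) := by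
        gcongr
        rw [volume_four hS]
        calc _ ≤ ∫⁻ a, ∫⁻ b, ENNReal.ofReal δ * (fareyTriangle ∩ {p : ℝ × ℝ | p.1 * p.2 < ε}).indicator
              (fun p => ENNReal.ofReal (p.1 * p.2)⁻¹) (a, b) := by
              refine lintegral_mono fun a => lintegral_mono fun b => ?_
              by_cases hab : (a, b) ∈ fareyTriangle ∩ {p : ℝ × ℝ | p.1 * p.2 < ε}
              · rw [indicator_of_mem hab]
                calc volume {q : ℝ × ℝ | (a, b, q) ∈ omegaCoords ∩ B}
                    ≤ volume (Icc 0 (a * b)⁻¹ ×ˢ Icc (l (a, b)) (l (a, b) + δ)) := by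
                      refine measure_mono ?_
                      rintro ⟨s, α⟩ ⟨h1, h2⟩
                      exact ⟨⟨h1.2.2.2.2.1, h1.2.2.2.2.2.1.le⟩, ⟨h2.2.1, h2.2.2.1⟩⟩
                  _ = _ := by
                      rw [Measure.volume_eq_prod, Measure.prod_prod, Real.volume_Icc,
                        Real.volume_Icc, mul_comm]
                      simp
              · rw [indicator_of_notMem hab]
                have : {q : ℝ × ℝ | (a, b, q) ∈ omegaCoords ∩ B} = ∅ := by
                  refine eq_empty_iff_forall_notMem.2 ?_
                  rintro ⟨s, α⟩ ⟨h1, h2⟩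
                  exact hab ⟨⟨h1.1, h1.2.1, h1.2.2.1, h1.2.2.2.1⟩, h2.1⟩
                rw [this]
                simp
          _ = ENNReal.ofReal δ * ∫⁻ a, ∫⁻ b, (fareyTriangle ∩ {p : ℝ × ℝ | p.1 * p.2 < ε}).indicator
              (fun p => ENNReal.ofReal (p.1 * p.2)⁻¹) (a, b) := by
              simp only [lintegral_const_mul' _ _ ENNReal.ofReal_ne_top]
          _ ≤ _ := by
              gcongr
              exact lintegral_inv_mul_le ε hε
    _ = ENNReal.ofReal (8 * ε * δ * w) := by
        rw [← ENNReal.ofReal_mul hδ, ← ENNReal.ofReal_mul hw]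
        congr 1
        ring

theorem fluxMeasure_compl_omegaCoords : fluxMeasure omegaCoordsᶜ = 0 := by
  rw [fluxMeasure_apply measurableSet_omegaCoords.compl]
  simp

theorem ae_fluxMeasure_mem : ∀ᵐ p ∂fluxMeasure, p ∈ omegaCoords := by
  rw [ae_iff]
  exact fluxMeasure_compl_omegaCoords

theorem fluxMeasure_absolutelyContinuous : fluxMeasure ≪ volume :=
  (withDensity_absolutelyContinuous _ _).trans Measure.restrict_le_self.absolutelyContinuous

theorem fluxMeasure_univ_lt_top : fluxMeasure univ < ∞ := by
  refine (fluxMeasure_le (ε := 2) (δ := 1) (w := 1) (l := fun _ => 0) (by norm_num) zero_le_one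
    zero_le_one measurable_const ?_).trans_lt ENNReal.ofReal_lt_top
  rintro a b s α ⟨h1, h2, h3, h4, h5, h6, h7, h8⟩ -
  simp only at *
  exact ⟨by nlinarith, h7.le, by linarith, h8⟩

theorem fluxMeasure_pos_of_open {A : Set (ℝ × ℝ × ℝ × ℝ)} (hA : IsOpen A) (hne : A.Nonempty)
    (hsub : A ⊆ omegaCoords) : 0 < fluxMeasure A := by
  rw [fluxMeasure, withDensity_apply _ hA.measurableSet, lintegral_pos_iff_support (by fun_prop)]
  refine lt_of_lt_of_le (hA.measure_pos volume hne) ?_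
  rw [Measure.restrict_restrict hA.measurableSet, inter_eq_left.2 hsub]
  rw [Measure.restrict_apply' hA.measurableSet]
  refine measure_mono fun p hp => ⟨?_, hp⟩
  have := (hsub hp).2.2.2.2.2.2.1
  simpa using this

/-! ### The three families of surfaces -/

/-- The pair `(h_s p_{a,b}, (α, 0))` with coordinates `(a, b, s, α)`. -/
def fluxPair (p : ℝ × ℝ × ℝ × ℝ) : TorusPair :=
  ⟨horoMatrix p.2.2.1 * pMatrix p.1 p.2.1, ![p.2.2.2, 0]⟩

/-- The pair `(p_{a,b}, p_{a,b} (x, y))` with coordinates `(a, b, x, y)`. -/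
def slitPair (p : ℝ × ℝ × ℝ × ℝ) : TorusPair :=
  ⟨pMatrix p.1 p.2.1, (pMatrix p.1 p.2.1).mulVec ![p.2.2.1, p.2.2.2]⟩

/-- The pair `(p_{a,b}, (ka/q, 0))`. -/
def torsionPair (k q : ℕ) (p : ℝ × ℝ) : TorusPair :=
  ⟨pMatrix p.1 p.2, ![(k : ℝ) * p.1 / (q : ℝ), 0]⟩

/-- The range of the coordinates `(a, b, x, y)` of doubled slit tori with a short lattice vector. -/
def slitBox : Set (ℝ × ℝ × ℝ × ℝ) :=
  {p | 0 < p.1 ∧ p.1 ≤ 1 ∧ 1 - p.1 < p.2.1 ∧ p.2.1 ≤ 1 ∧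
    0 ≤ p.2.2.1 ∧ p.2.2.1 < 2 ∧ 0 ≤ p.2.2.2 ∧ p.2.2.2 < 2}

/-- The range of the coordinates `(a, b)` of affine lattices with `v = (ka/q, 0)`. -/
def torsionRegion (k q : ℕ) : Set (ℝ × ℝ) :=
  {p | 0 < p.1 ∧ (k : ℝ) * p.1 / (q : ℝ) ≤ 1 ∧ 1 - p.1 < p.2 ∧ p.2 ≤ 1}

theorem horoMatrix_mul_pMatrix (s a b : ℝ) :
    horoMatrix s * pMatrix a b = !![a, b; -s * a, a⁻¹ - s * b] := by
  ext i j
  fin_cases i <;> fin_cases j <;>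
    simp [horoMatrix, pMatrix, Matrix.mul_apply, Fin.sum_univ_two]
  ring

theorem gridX_fluxPair (p : ℝ × ℝ × ℝ × ℝ) (c : ℝ) (m n : ℤ) :
    gridX (fluxPair p) c m n = p.1 * m + p.2.1 * n + c * p.2.2.2 := by
  simp [gridX, fluxPair, horoMatrix_mul_pMatrix]

theorem gridY_fluxPair (p : ℝ × ℝ × ℝ × ℝ) (c : ℝ) (m n : ℤ) :
    gridY (fluxPair p) c m n = n / p.1 - p.2.2.1 * (p.1 * m + p.2.1 * n) := by
  simp [gridY, fluxPair, horoMatrix_mul_pMatrix]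
  ring

theorem gridX_slitPair (p : ℝ × ℝ × ℝ × ℝ) (c : ℝ) (m n : ℤ) :
    gridX (slitPair p) c m n =
      p.1 * (m + c * p.2.2.1) + p.2.1 * (n + c * p.2.2.2) := by
  simp [gridX, slitPair, pMatrix]
  ring

theorem gridY_slitPair (p : ℝ × ℝ × ℝ × ℝ) (c : ℝ) (m n : ℤ) :
    gridY (slitPair p) c m n = (n + c * p.2.2.2) / p.1 := by
  simp [gridY, slitPair, pMatrix]
  ring

theorem gridX_torsionPair (k q : ℕ) (p : ℝ × ℝ) (c : ℝ) (m n : ℤ) :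
    gridX (torsionPair k q p) c m n = p.1 * m + p.2 * n + c * (k * p.1 / q) := by
  simp [gridX, torsionPair, pMatrix]

theorem gridY_torsionPair (k q : ℕ) (p : ℝ × ℝ) (c : ℝ) (m n : ℤ) :
    gridY (torsionPair k q p) c m n = n / p.1 := by
  simp [gridY, torsionPair, pMatrix]
  ring

theorem det_pMatrix {a : ℝ} (b : ℝ) (ha : a ≠ 0) : (pMatrix a b).det = 1 := by
  simp [pMatrix, Matrix.det_fin_two, ha]

theorem det_horoMatrix_mul_pMatrix (s : ℝ) {a : ℝ} (b : ℝ) (ha : a ≠ 0) :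
    (horoMatrix s * pMatrix a b).det = 1 := by
  rw [Matrix.det_mul, det_pMatrix b ha]
  simp [horoMatrix, Matrix.det_fin_two]

theorem measurable_fluxPair : Measurable fluxPair := by
  rw [measurable_torusPair_iff]
  refine ⟨fun i j => ?_, fun i => ?_⟩
  · fin_cases i <;> fin_cases j <;> simp [fluxPair, horoMatrix_mul_pMatrix] <;> fun_prop
  · fin_cases i <;> simp [fluxPair]; fun_prop

theorem measurable_slitPair : Measurable slitPair := by
  rw [measurable_torusPair_iff]
  refine ⟨fun i j => ?_, fun i => ?_⟩
  · fin_cases i <;> fin_cases j <;> simp [slitPair, pMatrix] <;> fun_prop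
  · fin_cases i <;> simp [slitPair, pMatrix, Matrix.vecHead, Matrix.vecTail] <;> fun_prop

theorem measurable_torsionPair (k q : ℕ) : Measurable (torsionPair k q) := by
  rw [measurable_torusPair_iff]
  refine ⟨fun i j => ?_, fun i => ?_⟩
  · fin_cases i <;> fin_cases j <;> simp [torsionPair, pMatrix] <;> fun_prop
  · fin_cases i <;> simp [torsionPair]; fun_prop

theorem fluxPair_mem_transversal {C : Set ℝ} (hC : 1 ∈ C) {p : ℝ × ℝ × ℝ × ℝ}
    (hp : p ∈ omegaCoords) : fluxPair p ∈ transversal (gridVectors C) :=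
  ⟨p.2.2.2, hp.2.2.2.2.2.2.1, hp.2.2.2.2.2.2.2, 1, hC, 0, 0, by
    rw [gridX_fluxPair, gridY_fluxPair]
    simp⟩

theorem slitPair_mem_transversal {C : Set ℝ} (hC : 0 ∈ C) {p : ℝ × ℝ × ℝ × ℝ}
    (hp : p ∈ slitBox) : slitPair p ∈ transversal (gridVectors C) :=
  ⟨p.1, hp.1, hp.2.1, 0, hC, 1, 0, by
    rw [gridX_slitPair, gridY_slitPair]
    simp⟩

theorem torsionPair_mem_transversal {k q : ℕ} (hk : 0 < k) (hq : 0 < q) {p : ℝ × ℝ}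
    (hp : p ∈ torsionRegion k q) : torsionPair k q p ∈ transversal (gridVectors {1}) :=
  ⟨k * p.1 / q, by have := hp.1; positivity, hp.2.1, 1, rfl, 0, 0, by
    rw [gridX_torsionPair, gridY_torsionPair]
    simp⟩

theorem det_fluxPair {p : ℝ × ℝ × ℝ × ℝ} (hp : p ∈ omegaCoords) : (fluxPair p).g.det = 1 :=
  det_horoMatrix_mul_pMatrix _ _ hp.1.ne'

theorem det_slitPair {p : ℝ × ℝ × ℝ × ℝ} (hp : p ∈ slitBox) : (slitPair p).g.det = 1 :=
  det_pMatrix _ hp.1.ne'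

theorem det_torsionPair {k q : ℕ} {p : ℝ × ℝ} (hp : p ∈ torsionRegion k q) :
    (torsionPair k q p).g.det = 1 :=
  det_pMatrix _ hp.1.ne'

theorem stripSlopes_nonempty {ω : TorusPair} (hω : ω.g.det = 1) {C : Set ℝ}
    (hT : ω ∈ transversal (gridVectors C)) : (stripSlopes (gridVectors C) ω).Nonempty :=
  let ⟨σ, hσ, _⟩ := stripSlopes_unbounded hω hT 0
  ⟨σ, hσ⟩

theorem lt_returnTime_fluxPair {C : Set ℝ} (hC : C.Finite) (h1 : 1 ∈ C) {p : ℝ × ℝ × ℝ × ℝ}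
    (hp : p ∈ omegaCoords) (t : ℝ) :
    t < returnTime (gridVectors C) (fluxPair p) ↔ SlopesExceed C t (fluxPair p) :=
  lt_returnTime_iff (det_fluxPair hp) hC
    (stripSlopes_nonempty (det_fluxPair hp) (fluxPair_mem_transversal h1 hp)) t

theorem lt_returnTime_slitPair {C : Set ℝ} (hC : C.Finite) (h1 : 0 ∈ C) {p : ℝ × ℝ × ℝ × ℝ}
    (hp : p ∈ slitBox) (t : ℝ) :
    t < returnTime (gridVectors C) (slitPair p) ↔ SlopesExceed C t (slitPair p) :=
  lt_returnTime_iff (det_slitPair hp) hC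
    (stripSlopes_nonempty (det_slitPair hp) (slitPair_mem_transversal h1 hp)) t

theorem lt_returnTime_torsionPair {k q : ℕ} (hk : 0 < k) (hq : 0 < q) {p : ℝ × ℝ}
    (hp : p ∈ torsionRegion k q) (t : ℝ) :
    t < returnTime (gridVectors {1}) (torsionPair k q p) ↔
      SlopesExceed {1} t (torsionPair k q p) :=
  lt_returnTime_iff (det_torsionPair hp) (finite_singleton _)
    (stripSlopes_nonempty (det_torsionPair hp) (torsionPair_mem_transversal hk hq hp)) t

theorem measurableSet_slitBox : MeasurableSet slitBox := by
  unfold slitBox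
  measurability

theorem measurableSet_torsionRegion (k q : ℕ) : MeasurableSet (torsionRegion k q) := by
  unfold torsionRegion
  measurability

/-! ### Absolute continuity of the return times -/

theorem volume_slope_preimage_eq_zero {A : Set ℝ} (hA : volume A = 0) (y d e : ℝ) (he : e ≠ 0) :
    volume {x : ℝ | 0 < d + e * x ∧ 0 < y ∧ y / (d + e * x) ∈ A} = 0 := by
  refine measure_mono_null (t := (fun z => (y / z - d) / e) '' (A ∩ {0}ᶜ)) ?_ ?_
  · rintro x ⟨h0, hy, h⟩
    refine ⟨_, ⟨h, ?_⟩, ?_⟩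
    · simp [hy.ne', h0.ne']
    · simp only
      field_simp
      ring
  · have hd : DifferentiableOn ℝ (fun z : ℝ => (y / z - d) / e) (A ∩ {0}ᶜ) := by
      intro z hz
      exact ((((differentiableAt_const y).fun_div differentiableAt_id hz.2).sub_const
        d).div_const e).differentiableWithinAt
    exact addHaar_image_eq_zero_of_differentiableOn_of_addHaar_eq_zero volume hd
      (measure_mono_null inter_subset_left hA)

theorem volume_shear_preimage_eq_zero {A : Set ℝ} (hA : volume A = 0) (y x : ℝ) :
    volume {s : ℝ | 0 < x ∧ (y - s * x) / x ∈ A} = 0 := by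
  refine measure_mono_null (t := (fun z => y / x - z) '' A) ?_ ?_
  · rintro s ⟨h0, h⟩
    refine ⟨_, h, ?_⟩
    simp only
    field_simp
    ring
  · exact addHaar_image_eq_zero_of_differentiableOn_of_addHaar_eq_zero volume (by fun_prop) hA

theorem volume_four_eq_zero_of_last {S : Set (ℝ × ℝ × ℝ × ℝ)} (hS : MeasurableSet S)
    (h : ∀ a b s, volume {r | (a, b, s, r) ∈ S} = 0) : volume S = 0 := by
  rw [volume_four hS]
  have : ∀ a b, volume {q : ℝ × ℝ | (a, b, q) ∈ S} = 0 := by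
    intro a b
    have hm : MeasurableSet {q : ℝ × ℝ | (a, b, q) ∈ S} :=
      measurable_prodMk_left (measurable_prodMk_left hS)
    rw [Measure.volume_eq_prod, Measure.measure_prod_null hm]
    exact Eventually.of_forall fun s => h a b s
  simp only [this, lintegral_zero]

theorem volume_four_eq_zero_of_third {S : Set (ℝ × ℝ × ℝ × ℝ)} (hS : MeasurableSet S)
    (h : ∀ a b r, volume {s | (a, b, s, r) ∈ S} = 0) : volume S = 0 := by
  rw [volume_four hS]
  have : ∀ a b, volume {q : ℝ × ℝ | (a, b, q) ∈ S} = 0 := by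
    intro a b
    have hm : MeasurableSet {q : ℝ × ℝ | (a, b, q) ∈ S} :=
      measurable_prodMk_left (measurable_prodMk_left hS)
    rw [Measure.volume_eq_prod, Measure.prod_apply_symm hm]
    simp only [preimage_ofPred_eq, h, lintegral_zero]
  simp only [this, lintegral_zero]

theorem volume_four_eq_zero_of_second {S : Set (ℝ × ℝ × ℝ × ℝ)} (hS : MeasurableSet S)
    (h : ∀ a q, volume {b | (a, b, q) ∈ S} = 0) : volume S = 0 := by
  rw [Measure.volume_eq_prod, Measure.measure_prod_null hS]
  refine Eventually.of_forall fun a => ?_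
  simp only
  rw [Measure.volume_eq_prod, Measure.prod_apply_symm (measurable_prodMk_left hS)]
  simp only [preimage_preimage]
  exact (lintegral_congr fun q => h a q).trans (by simp)

theorem measurableSet_slope_mem {X : Type*} [MeasurableSpace X] {f : X → TorusPair}
    (hf : Measurable f) {A : Set ℝ} (hA : MeasurableSet A) (c : ℝ) (m n : ℤ) :
    MeasurableSet {p | 0 < gridX (f p) c m n ∧ 0 < gridY (f p) c m n ∧
      gridY (f p) c m n / gridX (f p) c m n ∈ A} := by
  have hX := (measurable_gridX c m n).comp hf
  have hY := (measurable_gridY c m n).comp hf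
  exact (measurableSet_lt measurable_const hX).inter ((measurableSet_lt measurable_const hY).inter
    ((hY.div hX) hA))

theorem ae_notMem_of_slopes_null {X : Type*} [MeasurableSpace X] {μ : Measure X} {S : Set X}
    (hS : MeasurableSet S) {f : X → TorusPair} {A : Set ℝ} {c : ℝ} {m n : ℤ}
    (h : μ (S ∩ {p | 0 < gridX (f p) c m n ∧ 0 < gridY (f p) c m n ∧
      gridY (f p) c m n / gridX (f p) c m n ∈ A}) = 0) :
    ∀ᵐ p ∂μ.restrict S, 0 < gridX (f p) c m n → 0 < gridY (f p) c m n →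
      gridY (f p) c m n / gridX (f p) c m n ∉ A := by
  rw [ae_restrict_iff' hS, ae_iff]
  refine measure_mono_null (fun p hp => ?_) h
  simp only [mem_ofPred_eq, Classical.not_imp, not_not] at hp
  exact ⟨hp.1, hp.2⟩

theorem ae_returnTime_fluxPair_notMem {C : Set ℝ} (hC : C.Finite) (h1 : 1 ∈ C) {A : Set ℝ}
    (hA : MeasurableSet A) (h0 : volume A = 0) :
    ∀ᵐ p ∂fluxMeasure, returnTime (gridVectors C) (fluxPair p) ∉ A := by
  refine ae_returnTime_notMem hC (ae_fluxMeasure_mem.mono fun p => det_fluxPair)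
    (ae_fluxMeasure_mem.mono fun p => fluxPair_mem_transversal h1) fun c hc m n => ?_
  refine (withDensity_absolutelyContinuous (volume.restrict omegaCoords) _).ae_le ?_
  refine ae_notMem_of_slopes_null measurableSet_omegaCoords (measure_mono_null inter_subset_right ?_)
  have hm := measurableSet_slope_mem measurable_fluxPair hA c m n
  rcases eq_or_ne c 0 with rfl | hc
  · refine volume_four_eq_zero_of_third hm fun a b r => ?_
    refine measure_mono_null ?_
      (volume_shear_preimage_eq_zero h0 (n / a) (a * m + b * n))
    rintro s ⟨h2, h3, h4⟩
    rw [gridX_fluxPair] at h2 h4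
    rw [gridY_fluxPair] at h4
    simp only [zero_mul, add_zero] at h2 h4
    exact ⟨h2, h4⟩
  · refine volume_four_eq_zero_of_last hm fun a b s => ?_
    refine measure_mono_null ?_ (volume_slope_preimage_eq_zero h0
      (n / a - s * (a * m + b * n)) (a * m + b * n) c hc)
    rintro r ⟨h2, h3, h4⟩
    rw [gridX_fluxPair] at h2 h4
    rw [gridY_fluxPair] at h3 h4
    exact ⟨h2, h3, h4⟩

theorem ae_returnTime_slitPair_notMem {C : Set ℝ} (hC : C.Finite) (h1 : 0 ∈ C) {A : Set ℝ}
    (hA : MeasurableSet A) (h0 : volume A = 0) :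
    ∀ᵐ p ∂volume.restrict slitBox, returnTime (gridVectors C) (slitPair p) ∉ A := by
  refine ae_returnTime_notMem hC
    ((ae_restrict_mem measurableSet_slitBox).mono fun p => det_slitPair)
    ((ae_restrict_mem measurableSet_slitBox).mono fun p => slitPair_mem_transversal h1)
    fun c hc m n => ae_notMem_of_slopes_null measurableSet_slitBox ?_
  have hm := measurableSet_slope_mem measurable_slitPair hA c m n
  refine volume_four_eq_zero_of_second (measurableSet_slitBox.inter hm) ?_
  rintro a ⟨x, y⟩
  by_cases he : (n : ℝ) + c * y = 0
  · convert measure_empty (μ := volume (α := ℝ))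
    refine eq_empty_iff_forall_notMem.2 ?_
    rintro b ⟨-, -, h3, -⟩
    rw [gridY_slitPair] at h3
    simp [he] at h3
  refine measure_mono_null ?_ (volume_slope_preimage_eq_zero h0
    ((n + c * y) / a) (a * (m + c * x)) (n + c * y) he)
  rintro b ⟨-, h2, h3, h4⟩
  rw [gridX_slitPair] at h2 h4
  rw [gridY_slitPair] at h3 h4
  simp only [mul_comm b] at h2 h4
  exact ⟨h2, h3, h4⟩

theorem ae_returnTime_torsionPair_notMem {k q : ℕ} (hk : 0 < k) (hq : 0 < q) {A : Set ℝ}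
    (hA : MeasurableSet A) (h0 : volume A = 0) :
    ∀ᵐ p ∂volume.restrict (torsionRegion k q),
      returnTime (gridVectors {1}) (torsionPair k q p) ∉ A := by
  refine ae_returnTime_notMem (finite_singleton _)
    ((ae_restrict_mem (measurableSet_torsionRegion k q)).mono fun p => det_torsionPair)
    ((ae_restrict_mem (measurableSet_torsionRegion k q)).mono fun p =>
      torsionPair_mem_transversal hk hq)
    fun c hc m n => ae_notMem_of_slopes_null (measurableSet_torsionRegion k q) ?_
  have hm := measurableSet_slope_mem (measurable_torsionPair k q) hA c m n
  rw [Measure.volume_eq_prod, Measure.measure_prod_null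
    ((measurableSet_torsionRegion k q).inter hm)]
  refine Eventually.of_forall fun a => ?_
  by_cases he : (n : ℝ) = 0
  · refine (congrArg volume ?_).trans (measure_empty (μ := volume (α := ℝ)))
    refine eq_empty_iff_forall_notMem.2 ?_
    rintro b ⟨-, -, h3, -⟩
    rw [gridY_torsionPair] at h3
    simp [he] at h3
  refine measure_mono_null ?_ (volume_slope_preimage_eq_zero h0
    (n / a) (a * m + c * (k * a / q)) n he)
  rintro b ⟨-, h2, h3, h4⟩
  rw [gridX_torsionPair] at h2 h4
  rw [gridY_torsionPair] at h3 h4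
  have e : a * m + b * n + c * (k * a / q) = a * m + c * (k * a / q) + n * b := by ring
  simp only [e] at h2 h4
  exact ⟨h2, h3, h4⟩

/-! ### The normalized measures -/

instance isFiniteMeasure_toProbability (μ : Measure TorusPair) :
    IsFiniteMeasure (toProbability μ) := by
  refine ⟨lt_of_le_of_lt ?_ ENNReal.one_lt_top⟩
  rw [toProbability, Measure.smul_apply, smul_eq_mul]
  exact ENNReal.inv_mul_le_one _

theorem toReal_toProbability (μ : Measure TorusPair) (S : Set TorusPair) :
    (toProbability μ S).toReal = (μ univ).toReal⁻¹ * (μ S).toReal := by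
  rw [toProbability, Measure.smul_apply, smul_eq_mul, ENNReal.toReal_mul, ENNReal.toReal_inv]

theorem map_toProbability_absolutelyContinuous {μ : Measure TorusPair} {R : TorusPair → ℝ}
    (hR : Measurable R) (h : ∀ A, MeasurableSet A → volume A = 0 → μ (R ⁻¹' A) = 0) :
    (toProbability μ).map R ≪ volume := by
  refine Measure.AbsolutelyContinuous.mk fun A hA h0 => ?_
  rw [Measure.map_apply hR hA, toProbability, Measure.smul_apply, h A hA h0, smul_zero]

theorem gridVectors_hasDensity {C : Set ℝ} (hC : C.Finite) {μ : Measure TorusPair}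
    (h : ∀ A, MeasurableSet A → volume A = 0 → μ (returnTime (gridVectors C) ⁻¹' A) = 0) :
    GapDistributionHasDensity (gridVectors C) affineLatticeSpace (toProbability μ) :=
  (horocycleEquivariant_gridVectors C).gapDistributionHasDensity
    (fun _ hω => stripSlopes_unbounded hω.1 hω.2) (measurable_returnTime hC.countable).aemeasurable
    (map_toProbability_absolutelyContinuous (measurable_returnTime hC.countable) h)

theorem gridVectors_setIntegral {C : Set ℝ} (hC : C.Finite) {μ : Measure TorusPair}
    (h : ∀ A, MeasurableSet A → volume A = 0 → μ (returnTime (gridVectors C) ⁻¹' A) = 0)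
    {I : Set ℝ} (hI : MeasurableSet I) :
    ∫ x in I, gapDensity (gridVectors C) (toProbability μ) x =
      (μ univ).toReal⁻¹ * (μ (returnTime (gridVectors C) ⁻¹' I)).toReal := by
  rw [setIntegral_gapDensity (measurable_returnTime hC.countable).aemeasurable
    (map_toProbability_absolutelyContinuous (measurable_returnTime hC.countable) h) hI,
    toReal_toProbability]
  rfl

theorem map_pair_apply {X : Type*} [MeasurableSpace X] (κ : Measure X) {f : X → TorusPair}
    (hf : Measurable f) {C : Set ℝ} (hC : C.Finite) {I : Set ℝ} (hI : MeasurableSet I) :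
    κ.map f (returnTime (gridVectors C) ⁻¹' I) =
      κ {p | returnTime (gridVectors C) (f p) ∈ I} :=
  Measure.map_apply hf (measurable_returnTime hC.countable hI)

theorem map_fluxPair_null {C : Set ℝ} (hC : C.Finite) (h1 : 1 ∈ C) (A : Set ℝ)
    (hA : MeasurableSet A) (h0 : volume A = 0) :
    fluxMeasure.map fluxPair (returnTime (gridVectors C) ⁻¹' A) = 0 := by
  rw [map_pair_apply _ measurable_fluxPair hC hA]
  simpa [ae_iff] using ae_returnTime_fluxPair_notMem hC h1 hA h0

theorem mOmega_hasDensity :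
    GapDistributionHasDensity affineLattice affineLatticeSpace mOmega := by
  rw [affineLattice_eq_gridVectors]
  exact gridVectors_hasDensity (finite_singleton _) (map_fluxPair_null (finite_singleton _) rfl)

theorem setIntegral_mOmega {I : Set ℝ} (hI : MeasurableSet I) :
    ∫ x in I, gapDensity affineLattice mOmega x = (fluxMeasure univ).toReal⁻¹ *
      (fluxMeasure {p | returnTime (gridVectors {1}) (fluxPair p) ∈ I}).toReal := by
  rw [affineLattice_eq_gridVectors]
  refine (gridVectors_setIntegral (finite_singleton _)
    (map_fluxPair_null (finite_singleton _) rfl) hI).trans ?_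
  rw [map_pair_apply _ measurable_fluxPair (finite_singleton _) hI,
    Measure.map_apply measurable_fluxPair MeasurableSet.univ, preimage_univ]

/-- The index set of the torsion measure. -/
def torsionIndices (q : ℕ) : Finset ℕ := (Finset.Icc 1 q).filter (fun k => Nat.Coprime k q)

/-- The torsion measure before normalization. -/
def torsionMeasure (q : ℕ) : Measure TorusPair :=
  ∑ k ∈ torsionIndices q, (volume.restrict (torsionRegion k q)).map (torsionPair k q)

theorem torsionMeasure_apply (q : ℕ) {I : Set ℝ} (hI : MeasurableSet I) :
    torsionMeasure q (returnTime (gridVectors {1}) ⁻¹' I) = ∑ k ∈ torsionIndices q,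
      volume.restrict (torsionRegion k q)
        {p | returnTime (gridVectors {1}) (torsionPair k q p) ∈ I} := by
  rw [torsionMeasure, Measure.finsetSum_apply]
  exact Finset.sum_congr rfl fun k _ =>
    map_pair_apply _ (measurable_torsionPair k q) (finite_singleton _) hI

theorem torsionMeasure_null {q : ℕ} (A : Set ℝ) (hA : MeasurableSet A)
    (h0 : volume A = 0) : torsionMeasure q (returnTime (gridVectors {1}) ⁻¹' A) = 0 := by
  rw [torsionMeasure_apply q hA]
  refine Finset.sum_eq_zero fun k hk => ?_
  have hk1 := Finset.mem_Icc.1 (Finset.mem_filter.1 hk).1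
  simpa [ae_iff] using
    ae_returnTime_torsionPair_notMem hk1.1 (by omega : 0 < q) hA h0

theorem mTorsion_hasDensity (q : ℕ) :
    GapDistributionHasDensity affineLattice affineLatticeSpace (mTorsion q) := by
  rw [affineLattice_eq_gridVectors]
  exact gridVectors_hasDensity (finite_singleton _) (torsionMeasure_null (q := q))

theorem setIntegral_mTorsion (q : ℕ) {I : Set ℝ} (hI : MeasurableSet I) :
    ∫ x in I, gapDensity affineLattice (mTorsion q) x = (torsionMeasure q univ).toReal⁻¹ *
      (∑ k ∈ torsionIndices q, volume.restrict (torsionRegion k q)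
        {p | returnTime (gridVectors {1}) (torsionPair k q p) ∈ I}).toReal := by
  rw [affineLattice_eq_gridVectors]
  refine (gridVectors_setIntegral (finite_singleton _) (torsionMeasure_null (q := q)) hI).trans ?_
  rw [torsionMeasure_apply q hI]

/-! ### Doubled slit tori -/

/-- The vectors of the affine part of the measure on doubled slit tori. -/
def slitFluxPair (σ : ℝ) (e : Fin 2 × Fin 2) (p : ℝ × ℝ × ℝ × ℝ) : TorusPair :=
  ⟨horoMatrix p.2.2.1 * pMatrix p.1 p.2.1,
    ![σ * p.2.2.2, 0] + (horoMatrix p.2.2.1 * pMatrix p.1 p.2.1).mulVec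
      ![((e.1 : ℕ) : ℝ), ((e.2 : ℕ) : ℝ)]⟩

theorem measurable_slitFluxPair (σ : ℝ) (e : Fin 2 × Fin 2) : Measurable (slitFluxPair σ e) := by
  rw [measurable_torusPair_iff]
  refine ⟨fun i j => ?_, fun i => ?_⟩
  · fin_cases i <;> fin_cases j <;> simp [slitFluxPair, horoMatrix_mul_pMatrix] <;> fun_prop
  · simp only [slitFluxPair, mulVec_pair, horoMatrix_mul_pMatrix]
    fin_cases i <;> simp <;> fun_prop

theorem lattice_neg_mem {g : Matrix (Fin 2) (Fin 2) ℝ} {w : Plane} (hw : w ∈ lattice g) :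
    -w ∈ lattice g := by
  simpa using lattice_sub_mem (zero_mem_lattice g) hw

theorem lattice_add_mem {g : Matrix (Fin 2) (Fin 2) ℝ} {w z : Plane} (hw : w ∈ lattice g)
    (hz : z ∈ lattice g) : w + z ∈ lattice g := by
  simpa using lattice_sub_mem hw (lattice_neg_mem hz)

theorem gridVectors_slit_congr (g : Matrix (Fin 2) (Fin 2) ℝ) (v : Plane) {z : Plane}
    (hz : z ∈ lattice g) {σ : ℝ} (hσ : σ = 1 ∨ σ = -1) :
    gridVectors {0, 1, -1} ⟨g, σ • v + z⟩ = gridVectors {0, 1, -1} ⟨g, v⟩ := by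
  have hzn := lattice_neg_mem hz
  have h0 := zero_mem_lattice g
  have hcz : ∀ c ∈ ({0, 1, -1} : Set ℝ), c • z ∈ lattice g := by
    rintro c (rfl | rfl | rfl) <;> simpa
  have hc' : ∀ c ∈ ({0, 1, -1} : Set ℝ), c * σ ∈ ({0, 1, -1} : Set ℝ) := by
    rintro c (rfl | rfl | rfl) <;> rcases hσ with rfl | rfl <;> simp
  have hσ2 : σ * σ = 1 := by rcases hσ with rfl | rfl <;> simp
  ext w
  simp only [mem_gridVectors_iff]
  constructor
  · rintro ⟨c, hc, h⟩
    refine ⟨c * σ, hc' c hc, ?_⟩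
    convert lattice_add_mem h (hcz c hc) using 1
    module
  · rintro ⟨c, hc, h⟩
    refine ⟨c * σ, hc' c hc, ?_⟩
    convert lattice_sub_mem h (hcz _ (hc' c hc)) using 1
    rw [smul_add, smul_smul, mul_assoc, hσ2]
    module

theorem returnTime_slitFluxPair {σ : ℝ} (hσ : σ = 1 ∨ σ = -1) (e : Fin 2 × Fin 2)
    (p : ℝ × ℝ × ℝ × ℝ) : returnTime (gridVectors {0, 1, -1}) (slitFluxPair σ e p) =
      returnTime (gridVectors {0, 1, -1}) (fluxPair p) := by
  have h : gridVectors {0, 1, -1} (slitFluxPair σ e p) =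
      gridVectors {0, 1, -1} (fluxPair p) := by
    have h1 := gridVectors_slit_congr (horoMatrix p.2.2.1 * pMatrix p.1 p.2.1) ![p.2.2.2, 0]
      ⟨((e.1 : ℕ) : ℤ), ((e.2 : ℕ) : ℤ), rfl⟩ hσ
    rw [fluxPair, ← h1, slitFluxPair]
    simp
  rw [(horocycleEquivariant_gridVectors _).returnTime_eq,
    (horocycleEquivariant_gridVectors _).returnTime_eq]
  simp only [stripSlopes, h]

/-- The measure on doubled slit tori before normalization. -/
def slitMeasure : Measure TorusPair :=
  slitLatticePart + ∑ e : Fin 2 × Fin 2, (slitAffinePart 1 e + slitAffinePart (-1) e)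

theorem slitAffinePart_apply {σ : ℝ} (hσ : σ = 1 ∨ σ = -1) (e : Fin 2 × Fin 2) {I : Set ℝ}
    (hI : MeasurableSet I) :
    slitAffinePart σ e (returnTime (gridVectors {0, 1, -1}) ⁻¹' I) =
      fluxMeasure {p | returnTime (gridVectors {0, 1, -1}) (fluxPair p) ∈ I} := by
  refine (map_pair_apply _ (measurable_slitFluxPair σ e) (toFinite _) hI).trans ?_
  simp only [returnTime_slitFluxPair hσ]

theorem slitMeasure_apply {I : Set ℝ} (hI : MeasurableSet I) :
    slitMeasure (returnTime (gridVectors {0, 1, -1}) ⁻¹' I) =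
      volume.restrict slitBox {p | returnTime (gridVectors {0, 1, -1}) (slitPair p) ∈ I} +
      8 * fluxMeasure {p | returnTime (gridVectors {0, 1, -1}) (fluxPair p) ∈ I} := by
  have h : slitLatticePart (returnTime (gridVectors {0, 1, -1}) ⁻¹' I) =
      volume.restrict slitBox {p | returnTime (gridVectors {0, 1, -1}) (slitPair p) ∈ I} :=
    map_pair_apply _ measurable_slitPair (toFinite _) hI
  rw [slitMeasure, Measure.add_apply, h, Measure.finsetSum_apply]
  simp only [Measure.add_apply, slitAffinePart_apply (Or.inl rfl) _ hI,
    slitAffinePart_apply (Or.inr rfl) _ hI, Finset.sum_const, Finset.card_univ, Fintype.card_prod,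
    Fintype.card_fin]
  rw [← two_mul, nsmul_eq_mul, ← mul_assoc]
  norm_num

theorem slitMeasure_null (A : Set ℝ) (hA : MeasurableSet A) (h0 : volume A = 0) :
    slitMeasure (returnTime (gridVectors {0, 1, -1}) ⁻¹' A) = 0 := by
  have h1 := ae_returnTime_slitPair_notMem (toFinite {0, 1, -1}) (by simp) hA h0
  have h2 := ae_returnTime_fluxPair_notMem (toFinite {0, 1, -1}) (by simp) hA h0
  simp only [ae_iff, not_not] at h1 h2
  rw [slitMeasure_apply hA, h1, h2, mul_zero, add_zero]

theorem ae_mSlit_det : ∀ᵐ ω ∂mSlit, ω.g.det = 1 := by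
  have hm : MeasurableSet {ω : TorusPair | ω.g.det = 1} := by
    simp only [Matrix.det_fin_two]
    exact measurableSet_eq_fun (by fun_prop) (by fun_prop)
  have h1 : slitLatticePart {ω : TorusPair | ω.g.det = 1}ᶜ = 0 := by
    refine (Measure.map_apply measurable_slitPair hm.compl).trans ?_
    exact ((ae_restrict_mem measurableSet_slitBox).mono fun p hp => det_slitPair hp :
      ∀ᵐ p ∂volume.restrict slitBox, (slitPair p).g.det = 1)
  have h2 : ∀ σ e, slitAffinePart σ e {ω : TorusPair | ω.g.det = 1}ᶜ = 0 := by
    intro σ e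
    refine (Measure.map_apply (measurable_slitFluxPair σ e) hm.compl).trans ?_
    exact (ae_fluxMeasure_mem.mono fun p hp => det_fluxPair hp :
      ∀ᵐ p ∂fluxMeasure, (slitFluxPair σ e p).g.det = 1)
  have h3 : slitMeasure {ω : TorusPair | ω.g.det = 1}ᶜ = 0 := by
    rw [slitMeasure, Measure.add_apply, h1, Measure.finsetSum_apply]
    simp [h2]
  rw [ae_iff]
  change ((slitMeasure univ)⁻¹ • slitMeasure) {ω : TorusPair | ω.g.det = 1}ᶜ = 0
  rw [Measure.smul_apply, h3, smul_zero]

theorem ae_mSlit_returnTime :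
    returnTime saddleHolonomies =ᵐ[mSlit] returnTime (gridVectors {0, 1, -1}) :=
  ae_mSlit_det.mono fun _ => returnTime_saddleHolonomies

instance : IsFiniteMeasure mSlit := isFiniteMeasure_toProbability slitMeasure

theorem aemeasurable_returnTime_mSlit : AEMeasurable (returnTime saddleHolonomies) mSlit :=
  ⟨_, measurable_returnTime (toFinite {0, 1, -1}).countable, ae_mSlit_returnTime⟩

theorem map_returnTime_mSlit_absolutelyContinuous :
    mSlit.map (returnTime saddleHolonomies) ≪ volume := by
  rw [Measure.map_congr ae_mSlit_returnTime]
  exact map_toProbability_absolutelyContinuous (μ := slitMeasure)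
    (measurable_returnTime (toFinite _).countable) slitMeasure_null

theorem mSlit_hasDensity : GapDistributionHasDensity saddleHolonomies slitTorusSpace mSlit := by
  refine horocycleEquivariant_saddleHolonomies.gapDistributionHasDensity ?_
    aemeasurable_returnTime_mSlit map_returnTime_mSlit_absolutelyContinuous
  rintro ω ⟨⟨hω, -⟩, hT⟩
  rw [stripSlopes_saddleHolonomies hω]
  exact stripSlopes_unbounded hω ((transversal_saddleHolonomies_iff hω).1 hT)

theorem setIntegral_mSlit {I : Set ℝ} (hI : MeasurableSet I) :
    ∫ x in I, gapDensity saddleHolonomies mSlit x = (slitMeasure univ).toReal⁻¹ *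
      (volume.restrict slitBox {p | returnTime (gridVectors {0, 1, -1}) (slitPair p) ∈ I} +
      8 * fluxMeasure {p | returnTime (gridVectors {0, 1, -1}) (fluxPair p) ∈ I}).toReal := by
  rw [setIntegral_gapDensity aemeasurable_returnTime_mSlit
    map_returnTime_mSlit_absolutelyContinuous hI, ← slitMeasure_apply hI]
  refine Eq.trans ?_ (toReal_toProbability slitMeasure _)
  congr 1
  refine measure_congr ?_
  filter_upwards [ae_mSlit_returnTime] with ω hω
  exact congrArg (· ∈ I) hω

/-! ### Total masses -/

theorem fluxMeasure_univ_pos : 0 < fluxMeasure univ := by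
  have hopen : IsOpen {p : ℝ × ℝ × ℝ × ℝ | 1 / 2 < p.1 ∧ p.1 < 1 ∧ 1 / 2 < p.2.1 ∧ p.2.1 < 1 ∧
      0 < p.2.2.1 ∧ p.2.2.1 < 1 ∧ 0 < p.2.2.2 ∧ p.2.2.2 < 1} := by
    simp only [ofPred_and]
    repeat' apply IsOpen.inter
    all_goals exact isOpen_lt (by fun_prop) (by fun_prop)
  refine (fluxMeasure_pos_of_open hopen ⟨(3 / 4, 3 / 4, 1 / 2, 1 / 2), by norm_num⟩ ?_).trans_le
    (measure_mono (subset_univ _))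
  rintro ⟨a, b, s, α⟩ ⟨h1, h2, h3, h4, h5, h6, h7, h8⟩
  simp only at *
  refine ⟨by simp only; linarith, h2.le, by simp only; linarith, h4.le, h5.le, ?_, h7, h8.le⟩
  simp only
  refine h6.trans_le ?_
  rw [one_le_inv₀ (by positivity)]
  nlinarith

theorem volume_slitBox_lt_top : volume slitBox < ∞ := by
  refine (measure_mono (t := Icc (0, 0, 0, 0) (2, 2, 2, 2)) ?_).trans_lt
    isCompact_Icc.measure_lt_top
  rintro ⟨a, b, x, y⟩ ⟨h1, h2, h3, h4, h5, h6, h7, h8⟩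
  simp only at *
  exact ⟨⟨h1.le, by simp only; linarith, h5, h7⟩, by simp only; linarith, by simp only; linarith,
    h6.le, h8.le⟩

theorem slitMeasure_univ : slitMeasure univ = volume slitBox + 8 * fluxMeasure univ := by
  have h := slitMeasure_apply MeasurableSet.univ
  simpa using h

theorem slitMeasure_univ_toReal_pos : 0 < (slitMeasure univ).toReal := by
  rw [slitMeasure_univ]
  refine ENNReal.toReal_pos ?_ ?_
  · have := fluxMeasure_univ_pos.ne'
    simp [this]
  · exact ENNReal.add_ne_top.2 ⟨volume_slitBox_lt_top.ne,
      ENNReal.mul_ne_top (by simp) fluxMeasure_univ_lt_top.ne⟩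

theorem fluxMeasure_univ_toReal_pos : 0 < (fluxMeasure univ).toReal :=
  ENNReal.toReal_pos fluxMeasure_univ_pos.ne' fluxMeasure_univ_lt_top.ne

theorem volume_torsionRegion_lt_top {k q : ℕ} (hk : 0 < k) (hq : 0 < q) :
    volume (torsionRegion k q) < ∞ := by
  refine (measure_mono (t := Icc (0, -(q : ℝ)) ((q : ℝ), 1)) ?_).trans_lt
    isCompact_Icc.measure_lt_top
  rintro ⟨a, b⟩ ⟨h1, h2, h3, h4⟩
  simp only at *
  have hk1 : (1 : ℝ) ≤ k := by exact_mod_cast hk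
  have hq1 : (1 : ℝ) ≤ q := by exact_mod_cast hq
  rw [div_le_one (by positivity)] at h2
  have h5 : a ≤ q := by nlinarith
  exact ⟨⟨h1.le, by simp only; linarith⟩, h5, h4⟩

theorem volume_torsionRegion_pos {k q : ℕ} (hq : 0 < q) (hkq : k ≤ q) :
    0 < volume (torsionRegion k q) := by
  have hopen : IsOpen {p : ℝ × ℝ | 0 < p.1 ∧ p.1 < 1 ∧ 1 - p.1 < p.2 ∧ p.2 < 1} := by
    simp only [ofPred_and]
    repeat' apply IsOpen.inter
    all_goals exact isOpen_lt (by fun_prop) (by fun_prop)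
  refine (hopen.measure_pos volume ⟨(1 / 2, 3 / 4), by norm_num⟩).trans_le (measure_mono ?_)
  rintro ⟨a, b⟩ ⟨h1, h2, h3, h4⟩
  simp only at *
  refine ⟨h1, ?_, h3, h4.le⟩
  have hkq' : (k : ℝ) ≤ q := by exact_mod_cast hkq
  simp only
  rw [div_le_one (by positivity)]
  have : (0 : ℝ) ≤ k := Nat.cast_nonneg k
  nlinarith

theorem torsionMeasure_univ_toReal_pos {q : ℕ} (hq : 0 < q) :
    0 < (torsionMeasure q univ).toReal := by
  have h : torsionMeasure q univ = ∑ k ∈ torsionIndices q, volume (torsionRegion k q) := by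
    simpa using torsionMeasure_apply q MeasurableSet.univ
  rw [h]
  refine ENNReal.toReal_pos ?_ ?_
  · refine (Finset.sum_pos_iff.2 ⟨1, ?_, volume_torsionRegion_pos hq hq⟩).ne'
    simp [torsionIndices]
    omega
  · refine ENNReal.sum_ne_top.2 fun k hk => ?_
    have hk1 := Finset.mem_Icc.1 (Finset.mem_filter.1 hk).1
    exact (volume_torsionRegion_lt_top hk1.1 hq).ne

/-! ### Return times of affine lattices -/

theorem SlopesExceed.mono {C D : Set ℝ} (h : C ⊆ D) {t : ℝ} {ω : TorusPair}
    (hD : SlopesExceed D t ω) : SlopesExceed C t ω :=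
  fun c hc => hD c (h hc)

theorem SlopesExceed.flux_vector {C : Set ℝ} {t a b s α : ℝ}
    (h : SlopesExceed C t (fluxPair (a, b, s, α))) {c : ℝ} (hc : c ∈ C) (m n : ℤ)
    (h0 : 0 < a * m + b * n + c * α) (h1 : a * m + b * n + c * α ≤ 1)
    (h2 : 0 < n / a - s * (a * m + b * n)) :
    t * (a * m + b * n + c * α) < n / a - s * (a * m + b * n) := by
  have := h c hc m n
  rw [gridX_fluxPair, gridY_fluxPair] at this
  exact this h0 h1 h2

theorem slopesExceed_one_cases {a b s α t : ℝ} (hp : (a, b, s, α) ∈ omegaCoords) (ht : 0 < t)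
    (hs : 0 < s) (h : SlopesExceed {1} t (fluxPair (a, b, s, α))) :
    a * b < 6 / t ∨ (a - b ≤ α ∧ α ≤ a - b + 16 / t) ∨ (a ≤ α ∧ α ≤ a + 2 / t) := by
  obtain ⟨ha, ha1, hab, hb1, -, hs1, hα, hα1⟩ := hp
  simp only at ha ha1 hab hb1 hs1 hα hα1
  have hb : 0 < b := by linarith
  have hab0 : 0 < a * b := by positivity
  rw [← one_div, lt_div_iff₀ hab0] at hs1
  have hsb : s * b < 1 / a := by
    rw [lt_div_iff₀ ha]
    linarith
  have hsa : s * a < 1 / b := by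
    rw [lt_div_iff₀ hb]
    linarith
  have h1a : 1 / a ≤ 1 / (a * b) := by
    gcongr
    nlinarith
  have h1b : 1 / b ≤ 1 / (a * b) := by
    gcongr
    nlinarith
  have key : ∀ K : ℝ, t * (1 / 2) < K * (1 / (a * b)) → a * b < 2 * K / t := by
    intro K hK
    rw [mul_one_div K, lt_div_iff₀ hab0] at hK
    rw [lt_div_iff₀ ht]
    linarith
  by_cases h1 : α + b ≤ 1
  · left
    have hn1 : 1 ≤ ⌊(1 - α) / b⌋ := by
      rw [Int.le_floor, Int.cast_one, le_div_iff₀ hb]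
      linarith
    have hn2 := Int.floor_le ((1 - α) / b)
    have hn3 := Int.lt_floor_add_one ((1 - α) / b)
    generalize ⌊(1 - α) / b⌋ = n at hn1 hn2 hn3
    have hn1' : (1 : ℝ) ≤ n := by exact_mod_cast hn1
    rw [le_div_iff₀ hb] at hn2
    rw [div_lt_iff₀ hb] at hn3
    have hnb : n ≤ 1 / b := by
      rw [le_div_iff₀ hb]
      linarith
    have hpos : 0 < n / a - s * (a * (0 : ℤ) + b * n) := by
      have : (n : ℝ) * (s * b) < n * (1 / a) := by gcongr
      simp only [Int.cast_zero]
      have e : (n : ℝ) / a = n * (1 / a) := by ring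
      rw [e]
      linarith
    have h2 := h.flux_vector rfl 0 n (by push_cast; nlinarith) (by push_cast; linarith) hpos
    have hx : (1 : ℝ) / 2 ≤ a * (0 : ℤ) + b * n + 1 * α := by
      push_cast
      nlinarith
    have hy : n / a - s * (a * (0 : ℤ) + b * n) ≤ 1 / (a * b) := by
      have e1 : (n : ℝ) / a ≤ 1 / b / a := by gcongr
      have e2 : 1 / b / a = 1 / (a * b) := by field_simp
      have e3 : 0 ≤ s * (a * (0 : ℤ) + b * n) := by
        push_cast
        have : (0 : ℝ) ≤ n := by linarith
        positivity
      rw [e2] at e1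
      exact (sub_le_self _ e3).trans e1
    have h3 : t * (1 / 2) ≤ t * (a * (0 : ℤ) + b * n + 1 * α) := by gcongr
    refine (key 1 (by linarith)).trans ?_
    gcongr
    norm_num
  · by_cases h2 : b ≤ 1 / 2 ∨ α ≤ a
    · have hn1 : 1 ≤ ⌊(1 - α + a) / b⌋ := by
        rw [Int.le_floor, Int.cast_one, le_div_iff₀ hb]
        rcases h2 with h2 | h2 <;> linarith
      have hn2 := Int.floor_le ((1 - α + a) / b)
      have hn3 := Int.lt_floor_add_one ((1 - α + a) / b)
      have gen : ∀ n : ℤ, 1 ≤ n → b * n ≤ 1 - α + a → 0 < b * n - a + α →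
          t * (b * n - a + α) < n / a + 1 / b := by
        intro n hn hle hgt
        have hn' : (1 : ℝ) ≤ n := by exact_mod_cast hn
        have e1 : (n : ℝ) / a = n * (1 / a) := by ring
        have e2 : (n : ℝ) * (s * b) < n * (1 / a) := by gcongr
        have e3 : 0 < s * a := by positivity
        have := h.flux_vector rfl (-1) n (by push_cast; linarith) (by push_cast; linarith)
          (by push_cast; rw [e1]; nlinarith)
        push_cast at this
        have e4 : 0 < s * b * n := by positivity
        nlinarith
      rcases le_or_gt b (1 / 2) with hb2 | hb2
      · left
        generalize ⌊(1 - α + a) / b⌋ = n at hn1 hn2 hn3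
        rw [le_div_iff₀ hb] at hn2
        rw [div_lt_iff₀ hb] at hn3
        have h3 := gen n hn1 (by linarith) (by linarith)
        have hn4 : (n : ℝ) ≤ 2 / b := by
          rw [le_div_iff₀ hb]
          linarith
        have e1 : (n : ℝ) / a ≤ 2 / b / a := by gcongr
        have e2 : 2 / b / a = 2 * (1 / (a * b)) := by field_simp
        have e3 : t * (1 / 2) ≤ t * (b * n - a + α) := by
          gcongr
          linarith
        refine (key 3 (by linarith)).trans_le ?_
        norm_num
      · have hαa : α ≤ a := by
          rcases h2 with h2 | h2
          · linarith
          · exact h2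
        have h3 := gen 1 le_rfl (by push_cast; linarith) (by push_cast; linarith)
        push_cast at h3
        rcases lt_or_ge a (1 / 2) with ha2 | ha2
        · left
          have e3 : t * (1 / 2) ≤ t * (b * 1 - a + α) := by
            gcongr
            linarith
          refine (key 2 (by linarith)).trans_le ?_
          gcongr
          norm_num
        · right
          left
          refine ⟨by linarith, ?_⟩
          have e1 : 1 / a ≤ 2 := by
            rw [div_le_iff₀ ha]
            linarith
          have e2 : 1 / b ≤ 2 := by
            rw [div_le_iff₀ hb]
            linarith
          have e3 : b * 1 - a + α ≤ 16 / t := by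
            rw [le_div_iff₀ ht]
            linarith
          linarith
    · push Not at h2
      right
      right
      refine ⟨h2.2.le, ?_⟩
      have h3 := h.flux_vector rfl (-1) 0 (by push_cast; linarith) (by push_cast; linarith)
        (by push_cast; have : 0 < s * a := by positivity
            simp only [zero_div]; linarith)
      push_cast at h3
      simp only [zero_div] at h3
      have e2 : 1 / b ≤ 2 := by
        rw [div_le_iff₀ hb]
        linarith
      have e3 : α - a ≤ 2 / t := by
        rw [le_div_iff₀ ht]
        linarith
      linarith

theorem fluxMeasure_zero_shear : fluxMeasure {p | p.2.2.1 = 0} = 0 := by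
  refine fluxMeasure_absolutelyContinuous ?_
  refine volume_four_eq_zero_of_third (measurableSet_eq_fun (by fun_prop) (by fun_prop))
    fun a b r => ?_
  simp

theorem fluxMeasure_returnTime_le {t : ℝ} (ht : 0 < t) :
    fluxMeasure {p | t < returnTime (gridVectors {1}) (fluxPair p)} ≤
      ENNReal.ofReal (336 / t) := by
  set A1 : Set (ℝ × ℝ × ℝ × ℝ) := {p | p.1 * p.2.1 < 6 / t} with hA1
  set A2 : Set (ℝ × ℝ × ℝ × ℝ) :=
    {p | p.1 - p.2.1 ≤ p.2.2.2 ∧ p.2.2.2 ≤ p.1 - p.2.1 + 16 / t} with hA2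
  set A3 : Set (ℝ × ℝ × ℝ × ℝ) := {p | p.1 ≤ p.2.2.2 ∧ p.2.2.2 ≤ p.1 + 2 / t} with hA3
  have hcover : {p | t < returnTime (gridVectors {1}) (fluxPair p)} ⊆
      A1 ∪ A2 ∪ A3 ∪ ({p | p.2.2.1 = 0} ∪ omegaCoordsᶜ) := by
    rintro ⟨a, b, s, α⟩ hp
    by_cases hpo : (a, b, s, α) ∈ omegaCoords
    · rcases eq_or_lt_of_le hpo.2.2.2.2.1 with hs | hs
      · exact Or.inr (Or.inl hs.symm)
      · rcases slopesExceed_one_cases hpo ht hs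
          ((lt_returnTime_fluxPair (finite_singleton _) rfl hpo t).1 hp) with h | h | h
        · exact Or.inl (Or.inl (Or.inl h))
        · exact Or.inl (Or.inl (Or.inr h))
        · exact Or.inl (Or.inr h)
    · exact Or.inr (Or.inr hpo)
  have hbound : ∀ a b s α, (a, b, s, α) ∈ omegaCoords → a * b < 2 := by
    rintro a b s α ⟨h1, h2, h3, h4, -⟩
    simp only at *
    nlinarith
  have h1 : fluxMeasure A1 ≤ ENNReal.ofReal (8 * (6 / t) * 1 * 1) := by
    refine fluxMeasure_le (by positivity) zero_le_one zero_le_one (l := fun _ => 0)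
      measurable_const ?_
    rintro a b s α hp h
    have := hp.2.2.2.2.2.2
    exact ⟨h, this.1.le, by simpa using this.2, this.2⟩
  have h2 : fluxMeasure A2 ≤ ENNReal.ofReal (8 * 2 * (16 / t) * 1) := by
    refine fluxMeasure_le (by positivity) (by positivity) zero_le_one (l := fun p => p.1 - p.2)
      (by fun_prop) ?_
    rintro a b s α hp h
    exact ⟨hbound _ _ _ _ hp, h.1, h.2, hp.2.2.2.2.2.2.2⟩
  have h3 : fluxMeasure A3 ≤ ENNReal.ofReal (8 * 2 * (2 / t) * 1) := by
    refine fluxMeasure_le (by positivity) (by positivity) zero_le_one (l := fun p => p.1)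
      (by fun_prop) ?_
    rintro a b s α hp h
    exact ⟨hbound _ _ _ _ hp, h.1, h.2, hp.2.2.2.2.2.2.2⟩
  have h4 : fluxMeasure ({p | p.2.2.1 = 0} ∪ omegaCoordsᶜ) = 0 :=
    measure_union_null fluxMeasure_zero_shear fluxMeasure_compl_omegaCoords
  calc _ ≤ fluxMeasure (A1 ∪ A2 ∪ A3 ∪ ({p | p.2.2.1 = 0} ∪ omegaCoordsᶜ)) := measure_mono hcover
    _ ≤ fluxMeasure A1 + fluxMeasure A2 + fluxMeasure A3 +
        fluxMeasure ({p | p.2.2.1 = 0} ∪ omegaCoordsᶜ) :=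
      (measure_union_le _ _).trans (by
        gcongr
        exact (measure_union_le _ _).trans (by gcongr; exact measure_union_le _ _))
    _ ≤ ENNReal.ofReal (8 * (6 / t) * 1 * 1) + ENNReal.ofReal (8 * 2 * (16 / t) * 1) +
        ENNReal.ofReal (8 * 2 * (2 / t) * 1) := by
      rw [h4, add_zero]
      gcongr
    _ = ENNReal.ofReal (336 / t) := by
      rw [← ENNReal.ofReal_add (by positivity) (by positivity),
        ← ENNReal.ofReal_add (by positivity) (by positivity)]
      congr 1
      ring

theorem fluxMeasure_returnTime_mono (t : ℝ) {C D : Set ℝ} (hC : C.Finite) (hD : D.Finite)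
    (h1 : 1 ∈ C) (h : C ⊆ D) :
    fluxMeasure {p | t < returnTime (gridVectors D) (fluxPair p)} ≤
      fluxMeasure {p | t < returnTime (gridVectors C) (fluxPair p)} := by
  refine measure_mono_ae ?_
  filter_upwards [ae_fluxMeasure_mem] with p hp hpt
  exact (lt_returnTime_fluxPair hC h1 hp t).2
    (((lt_returnTime_fluxPair hD (h h1) hp t).1 hpt).mono h)

theorem fluxMeasure_returnTime_pos {C : Set ℝ} (hC : C.Finite) (h1 : 1 ∈ C) {ε : ℝ}
    (hε : 0 < ε) :
    0 < fluxMeasure {p | returnTime (gridVectors C) (fluxPair p) ∈ Ioo 0 ε} := by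
  set U : Set (ℝ × ℝ × ℝ × ℝ) := {p | 1 / 4 < p.1 ∧ p.1 < 1 / 2 ∧ 3 / 4 < p.2.1 ∧ p.2.1 < 1 ∧
      0 < p.2.2.1 ∧ p.2.2.1 < min 1 (ε / 2) ∧ 3 / 4 < p.2.2.2 ∧ p.2.2.2 < 1} with hU
  have hopen : IsOpen U := by
    simp only [hU, ofPred_and]
    repeat' apply IsOpen.inter
    all_goals exact isOpen_lt (by fun_prop) (by fun_prop)
  have hsub : U ⊆ omegaCoords := by
    rintro ⟨a, b, s, α⟩ ⟨h2, h3, h4, h5, h6, h7, h8, h9⟩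
    simp only [lt_min_iff] at *
    refine ⟨by simp only; linarith, by simp only; linarith, by simp only; linarith, h5.le, h6.le,
      ?_, by simp only; linarith, h9.le⟩
    simp only
    refine h7.1.trans_le ?_
    rw [one_le_inv₀ (by positivity)]
    nlinarith
  have hne : U.Nonempty := by
    refine ⟨(3 / 8, 7 / 8, min 1 (ε / 2) / 2, 7 / 8), ?_⟩
    have : 0 < min 1 (ε / 2) := by positivity
    refine ⟨by norm_num, by norm_num, by norm_num, by norm_num, ?_, ?_, by norm_num, by norm_num⟩
    · simp only; linarith
    · simp only; linarith
  refine (fluxMeasure_pos_of_open hopen hne hsub).trans_le (measure_mono ?_)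
  rintro ⟨a, b, s, α⟩ hp
  have hpo := hsub hp
  have hmem := returnTime_mem_stripSlopes (det_fluxPair hpo) hC
    (stripSlopes_nonempty (det_fluxPair hpo) (fluxPair_mem_transversal h1 hpo))
  refine ⟨(mem_stripSlopes.1 hmem).1, ?_⟩
  obtain ⟨h2, h3, h4, h5, h6, h7, h8, h9⟩ := hp
  simp only [lt_min_iff] at h2 h3 h4 h5 h6 h7 h8 h9
  by_contra! hle
  have hlt : s * a / (α - a) < returnTime (gridVectors C) (fluxPair (a, b, s, α)) := by
    refine lt_of_lt_of_le ?_ hle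
    rw [div_lt_iff₀ (by linarith)]
    nlinarith [h7.2]
  have h10 := ((lt_returnTime_fluxPair hC h1 hpo _).1 hlt).flux_vector h1 (-1) 0
    (by push_cast; linarith) (by push_cast; linarith)
    (by push_cast; have : 0 < s * a := by nlinarith
        simp only [zero_div]; linarith)
  push_cast at h10
  simp only [zero_div] at h10
  have h11 : 0 < α - a := by linarith
  have e : s * a / (α - a) * (a * -1 + b * 0 + 1 * α) = s * a := by
    field_simp
    ring
  rw [e] at h10
  linarith

/-! ### Return times of torsion affine lattices -/

theorem SlopesExceed.torsion_vector {t a b : ℝ} {k q : ℕ}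
    (h : SlopesExceed {1} t (torsionPair k q (a, b))) (ha : 0 < a) (m n : ℤ) (hn : 0 < n)
    (h0 : 0 < a * m + b * n + k * a / q) (h1 : a * m + b * n + k * a / q ≤ 1) :
    t * (a * m + b * n + k * a / q) < n / a := by
  have hn' : (0 : ℝ) < n := by exact_mod_cast hn
  have := h 1 rfl m n
  rw [gridX_torsionPair, gridY_torsionPair, one_mul] at this
  exact this h0 h1 (by positivity)

theorem slopesExceed_torsion_cases {t a b : ℝ} {k q : ℕ} (hk : 0 < k) (hkq : k ≤ q)
    (hp : (a, b) ∈ torsionRegion k q) (ht : 16 * (q : ℝ) ^ 2 ≤ t)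
    (h : SlopesExceed {1} t (torsionPair k q (a, b))) :
    a < 2 / t ∨ ∃ n ∈ Finset.Icc (1 : ℤ) (2 * q), ∃ j ∈ Finset.Icc (-(4 * q) : ℤ) (4 * q),
      1 - 16 * (q : ℝ) ^ 3 / t ≤ k * a / q ∧ j * a / n ≤ b ∧
        b ≤ j * a / n + 16 * (q : ℝ) ^ 3 / t := by
  obtain ⟨ha, hα1, hab, hb1⟩ := hp
  simp only at ha hα1 hab hb1
  have hq1 : (1 : ℝ) ≤ q := by exact_mod_cast (by omega : 1 ≤ q)
  have hq0 : (0 : ℝ) < q := by linarith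
  have hk1 : (1 : ℝ) ≤ k := by exact_mod_cast hk
  have ht0 : 0 < t := by nlinarith
  have hαa : a / q ≤ k * a / q := by
    gcongr
    nlinarith
  have haq : a ≤ q := by
    have := hαa.trans hα1
    rwa [div_le_one hq0] at this
  rw [or_iff_not_imp_left, not_lt]
  intro ha2
  have ha_half : 1 / 2 ≤ a := by
    by_contra! hlt
    have hn2 := Int.floor_le ((1 - b - k * a / q) / a)
    have hn3 := Int.lt_floor_add_one ((1 - b - k * a / q) / a)
    generalize ⌊(1 - b - k * a / q) / a⌋ = m at hn2 hn3
    rw [le_div_iff₀ ha] at hn2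
    rw [div_lt_iff₀ ha] at hn3
    have h1 := h.torsion_vector ha m 1 one_pos (by push_cast; linarith) (by push_cast; linarith)
    push_cast at h1
    have h2 : t * (1 / 2) ≤ t * (a * m + b * 1 + k * a / q) := by
      gcongr
      linarith
    have h3 : t * (1 / 2) < 1 / a := by linarith
    rw [lt_div_iff₀ ha] at h3
    rw [div_le_iff₀ ht0] at ha2
    linarith
  have hN : 0 < 2 * q := by omega
  obtain ⟨j, n, hn, hnN, hjn⟩ := Real.exists_int_int_abs_mul_sub_le (b / a) hN
  push_cast at hnN hjn
  have hn' : (1 : ℝ) ≤ n := by exact_mod_cast hn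
  have hnN' : (n : ℝ) ≤ 2 * q := by exact_mod_cast hnN
  obtain ⟨d, hd⟩ : ∃ d, d = n * b - j * a := ⟨_, rfl⟩
  have hda : n * (b / a) - j = d / a := by
    rw [hd]
    field_simp
  rw [hda, abs_div, abs_of_pos ha, div_le_iff₀ ha] at hjn
  have hd2 : |d| ≤ a / (2 * q) := by
    refine hjn.trans ?_
    rw [one_div_mul_eq_div]
    gcongr
    linarith
  have hdle := (abs_le.1 hd2).2
  have hdge := (abs_le.1 hd2).1
  have e2q : a / q = a / (2 * q) + a / (2 * q) := by
    field_simp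
    ring
  -- a point in row `n'` with abscissa at least `a / (2q)` contradicts the hypothesis
  have contra : ∀ m n' : ℤ, 0 < n' → a / (2 * q) ≤ a * m + b * n' + k * a / q →
      a * m + b * n' + k * a / q ≤ 1 → t * a ^ 2 < 2 * q * n' := by
    intro m n' hn0 h1 h2
    have h3 := h.torsion_vector ha m n' hn0 (lt_of_lt_of_le (by positivity) h1) h2
    have h4 : t * (a / (2 * q)) < n' / a := lt_of_le_of_lt (by gcongr) h3
    rw [lt_div_iff₀ ha] at h4
    have h5 : t * (a / (2 * q)) * a = t * a ^ 2 / (2 * q) := by ring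
    rw [h5, div_lt_iff₀ (by positivity)] at h4
    linarith
  have ha4 : 1 / 4 ≤ a ^ 2 := by nlinarith
  have noflat : ¬ (a / (2 * q) ≤ a * ((-j : ℤ) : ℝ) + b * n + k * a / q ∧
      a * ((-j : ℤ) : ℝ) + b * n + k * a / q ≤ 1) := by
    rintro ⟨h1, h2⟩
    have h3 := contra (-j) n hn h1 h2
    have h4 : 2 * q * (n : ℝ) ≤ 2 * q * (2 * q) := by gcongr
    have h5 : t * (1 / 4) ≤ t * a ^ 2 := by gcongr
    linarith
  have ex : a * ((-j : ℤ) : ℝ) + b * n + k * a / q = d + k * a / q := by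
    rw [hd]
    push_cast
    ring
  rw [ex] at noflat
  have hd0 : 0 < d := by
    by_contra! hd0
    exact noflat ⟨by linarith, by linarith⟩
  have hdt : d < a * (16 * q ^ 2) / t := by
    by_contra! hlt
    have hi1 := Int.floor_le (a / d)
    have hi2 := Int.lt_floor_add_one (a / d)
    have hi0 : 0 < ⌊a / d⌋ := by
      rw [Int.floor_pos, le_div_iff₀ hd0, one_mul]
      refine hdle.trans (div_le_self ha.le (by linarith))
    generalize ⌊a / d⌋ = i at hi0 hi1 hi2
    have hi0' : (0 : ℝ) < i := by exact_mod_cast hi0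
    have hid := hi1
    rw [le_div_iff₀ hd0] at hi1
    rw [div_lt_iff₀ hd0] at hi2
    have ex2 : a * ((-(i * j) - 1 : ℤ) : ℝ) + b * ((i * n : ℤ) : ℝ) + k * a / q =
        i * d - a + k * a / q := by
      rw [hd]
      push_cast
      ring
    have h3 := contra (-(i * j) - 1) (i * n) (by positivity) (by rw [ex2]; linarith)
      (by rw [ex2]; linarith)
    rw [div_le_iff₀ ht0] at hlt
    push_cast at h3
    have h4 : a * (16 * q ^ 2) * i ≤ a * t := by
      calc a * (16 * q ^ 2) * i ≤ d * t * i := by gcongr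
        _ = i * d * t := by ring
        _ ≤ a * t := by gcongr
    have h5 : 16 * q ^ 2 * (i : ℝ) ≤ t := le_of_mul_le_mul_left (by rwa [← mul_assoc]) ha
    have h6 : 2 * q * ((i : ℝ) * n) ≤ 2 * q * (i * (2 * q)) := by gcongr
    have h7 : t * (1 / 4) ≤ t * a ^ 2 := by gcongr
    linarith
  have hd3 : d < 16 * q ^ 3 / t := by
    refine hdt.trans_le ?_
    have h1 : a * (16 * (q : ℝ) ^ 2) ≤ q * (16 * q ^ 2) := by gcongr
    have h2 : (q : ℝ) * (16 * q ^ 2) = 16 * q ^ 3 := by ring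
    rw [h2] at h1
    gcongr
  have hgt : 1 < d + k * a / q := by
    by_contra! hle
    refine noflat ⟨?_, hle⟩
    have : 0 < a / (2 * q) := by positivity
    linarith
  have hdn : d / n ≤ d := div_le_self hd0.le hn'
  have hbn : b = j * a / n + d / n := by
    rw [hd]
    field_simp
    ring
  have hdn0 : 0 < d / n := by positivity
  refine ⟨n, Finset.mem_Icc.2 ⟨hn, by exact_mod_cast hnN⟩, j, Finset.mem_Icc.2 ⟨?_, ?_⟩, by linarith,
    by linarith, by linarith⟩
  · by_contra! hlt
    have hj : (j : ℝ) ≤ -(4 * q) := by exact_mod_cast hlt.le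
    have h1 : (j : ℝ) * a ≤ -(4 * q) * a := by gcongr
    have h2 : d ≤ a := hdle.trans (div_le_self ha.le (by linarith))
    have h3 : (n : ℝ) * (1 - a) ≤ n * b := mul_le_mul_of_nonneg_left hab.le (by linarith)
    have h4 : (n : ℝ) * a ≤ 2 * q * a := by gcongr
    have h5 : 1 * a ≤ q * a := by gcongr
    linarith
  · by_contra! hlt
    have hj : (4 * q : ℝ) ≤ j := by exact_mod_cast hlt.le
    have h1 : (4 * q : ℝ) * a ≤ j * a := by gcongr
    have h3 : (n : ℝ) * b ≤ n * 1 := by gcongr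
    have h4 : (q : ℝ) * (1 / 2) ≤ q * a := by gcongr
    linarith

theorem volume_le_of_slices {S : Set (ℝ × ℝ)} {u δ₁ δ₂ : ℝ} (hδ : 0 ≤ δ₁) {l : ℝ → ℝ}
    (hl : Measurable l)
    (h : ∀ a b, (a, b) ∈ S → u ≤ a ∧ a ≤ u + δ₁ ∧ l a ≤ b ∧ b ≤ l a + δ₂) :
    volume S ≤ ENNReal.ofReal (δ₁ * δ₂) := by
  set B : Set (ℝ × ℝ) := {p | u ≤ p.1 ∧ p.1 ≤ u + δ₁ ∧ l p.1 ≤ p.2 ∧ p.2 ≤ l p.1 + δ₂} with hB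
  have hBm : MeasurableSet B := by measurability
  have hSB : S ⊆ B := fun p hp => h p.1 p.2 hp
  refine (measure_mono hSB).trans ?_
  rw [Measure.volume_eq_prod, Measure.prod_apply hBm]
  calc _ ≤ ∫⁻ a, (Icc u (u + δ₁)).indicator (fun _ => ENNReal.ofReal δ₂) a := by
        refine lintegral_mono fun a => ?_
        by_cases ha : a ∈ Icc u (u + δ₁)
        · rw [indicator_of_mem ha]
          refine (measure_mono (t := Icc (l a) (l a + δ₂)) fun b hb => hb.2.2).trans ?_
          simp
        · rw [indicator_of_notMem ha]
          refine le_of_eq ((congrArg volume ?_).trans (measure_empty (μ := volume)))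
          exact eq_empty_iff_forall_notMem.2 fun b hb => ha ⟨hb.1, hb.2.1⟩
    _ = ENNReal.ofReal (δ₁ * δ₂) := by
        rw [lintegral_indicator_const measurableSet_Icc, Real.volume_Icc, add_sub_cancel_left,
          mul_comm, ENNReal.ofReal_mul hδ]

theorem exists_volume_torsion_le {k q : ℕ} (hk : 0 < k) (hkq : k ≤ q) :
    ∃ K : ℝ, 0 ≤ K ∧ ∀ t : ℝ, 16 * (q : ℝ) ^ 2 ≤ t → volume.restrict (torsionRegion k q)
      {p | t < returnTime (gridVectors {1}) (torsionPair k q p)} ≤ ENNReal.ofReal (K / t ^ 2) := by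
  set c : ℝ := 16 * (q : ℝ) ^ 3 with hc
  have hq1 : (1 : ℝ) ≤ q := by exact_mod_cast (by omega : 1 ≤ q)
  have hk1 : (1 : ℝ) ≤ k := by exact_mod_cast hk
  set J : Finset (ℤ × ℤ) := Finset.Icc (1 : ℤ) (2 * q) ×ˢ Finset.Icc (-(4 * q) : ℤ) (4 * q) with hJ
  refine ⟨4 + J.card * (q * c * c), by positivity, fun t ht => ?_⟩
  have ht0 : 0 < t := by nlinarith
  set S : ℤ × ℤ → Set (ℝ × ℝ) := fun z => {p | 1 - c / t ≤ k * p.1 / q ∧ k * p.1 / q ≤ 1 ∧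
    z.2 * p.1 / z.1 ≤ p.2 ∧ p.2 ≤ z.2 * p.1 / z.1 + c / t} with hS
  set S₀ : Set (ℝ × ℝ) := {p | 0 < p.1 ∧ p.1 < 2 / t ∧ 1 - p.1 < p.2 ∧ p.2 ≤ 1} with hS₀
  have hcover : {p | t < returnTime (gridVectors {1}) (torsionPair k q p)} ∩ torsionRegion k q ⊆
      S₀ ∪ ⋃ z ∈ J, S z := by
    rintro ⟨a, b⟩ ⟨h1, h2⟩
    rcases slopesExceed_torsion_cases hk hkq h2 ht
      ((lt_returnTime_torsionPair hk (by omega) h2 t).1 h1) with h | ⟨n, hn, j, hj, h3, h4, h5⟩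
    · exact Or.inl ⟨h2.1, h, h2.2.2⟩
    · refine Or.inr (mem_iUnion₂.2 ⟨(n, j), Finset.mem_product.2 ⟨hn, hj⟩, h3, h2.2.1, h4, h5⟩)
  have h0 : volume S₀ ≤ ENNReal.ofReal (4 / t ^ 2) := by
    refine (volume_le_of_slices (u := 0) (δ₁ := 2 / t) (δ₂ := 2 / t) (l := fun _ => 1 - 2 / t)
      (by positivity) measurable_const ?_).trans_eq (by congr 1; field_simp; ring)
    rintro a b ⟨h1, h2, h3, h4⟩
    simp only at h1 h2 h3 h4
    exact ⟨h1.le, by linarith, by linarith, by linarith⟩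
  have hz : ∀ z, volume (S z) ≤ ENNReal.ofReal (q * c * c / t ^ 2) := by
    intro z
    refine (volume_le_of_slices (u := q / k * (1 - c / t)) (δ₁ := q / k * (c / t)) (δ₂ := c / t)
      (l := fun a => z.2 * a / z.1) (by positivity) (by fun_prop) ?_).trans
      (ENNReal.ofReal_le_ofReal ?_)
    · rintro a b ⟨h1, h2, h3, h4⟩
      simp only at h1 h2 h3 h4
      have e : q / k * (k * a / q) = a := by field_simp
      refine ⟨?_, ?_, h3, h4⟩
      · have := mul_le_mul_of_nonneg_left h1 (by positivity : 0 ≤ (q : ℝ) / k)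
        rwa [e] at this
      · have := mul_le_mul_of_nonneg_left h2 (by positivity : 0 ≤ (q : ℝ) / k)
        rw [e] at this
        linarith
    · have e : q / k * (c / t) * (c / t) = q / k * (c * c / t ^ 2) := by
        field_simp
      have e' : q * c * c / t ^ 2 = q * (c * c / t ^ 2) := by ring
      rw [e, e']
      gcongr
      exact div_le_self (by positivity) hk1
  calc _ = volume ({p | t < returnTime (gridVectors {1}) (torsionPair k q p)} ∩
        torsionRegion k q) := Measure.restrict_apply' (measurableSet_torsionRegion k q)
    _ ≤ volume S₀ + ∑ z ∈ J, volume (S z) :=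
      (measure_mono hcover).trans ((measure_union_le _ _).trans
        (by gcongr; exact measure_biUnion_finset_le _ _))
    _ ≤ ENNReal.ofReal (4 / t ^ 2) + ∑ z ∈ J, ENNReal.ofReal (q * c * c / t ^ 2) := by
      gcongr with z
      exact hz z
    _ = ENNReal.ofReal ((4 + J.card * (q * c * c)) / t ^ 2) := by
      rw [Finset.sum_const, nsmul_eq_mul, ← ENNReal.ofReal_natCast, ← ENNReal.ofReal_mul
        (by positivity), ← ENNReal.ofReal_add (by positivity) (by positivity)]
      congr 1
      ring

theorem le_volume_torsion {q : ℕ} (hq : 0 < q) {t : ℝ} (ht : 1 ≤ t) :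
    ENNReal.ofReal (1 / 4 * (1 / t ^ 2)) ≤ volume.restrict (torsionRegion 1 q)
      {p | t < returnTime (gridVectors {1}) (torsionPair 1 q p)} := by
  have ht0 : 0 < t := by linarith
  have hq1 : (1 : ℝ) ≤ q := by exact_mod_cast hq
  rw [Measure.restrict_apply' (measurableSet_torsionRegion 1 q)]
  have h1 : volume (Ioo (1 / (2 * t)) (1 / t) ×ˢ Ioc (1 - 1 / (2 * t)) 1) =
      ENNReal.ofReal (1 / 4 * (1 / t ^ 2)) := by
    rw [Measure.volume_eq_prod, Measure.prod_prod, Real.volume_Ioo, Real.volume_Ioc,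
      ← ENNReal.ofReal_mul (by rw [sub_nonneg]; gcongr; linarith)]
    congr 1
    field_simp
    ring
  rw [← h1]
  refine measure_mono ?_
  rintro ⟨a, b⟩ ⟨⟨h2, h3⟩, h4, h5⟩
  simp only at h2 h3 h4 h5
  have ha : 0 < a := lt_trans (by positivity) h2
  have hat : a * t < 1 := by rwa [lt_div_iff₀ ht0] at h3
  have ha1 : a ≤ 1 := by nlinarith
  have hp : (a, b) ∈ torsionRegion 1 q := by
    refine ⟨ha, ?_, by simp only; linarith, h5⟩
    simp only [Nat.cast_one, one_mul]
    rw [div_le_one (by positivity)]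
    linarith
  refine ⟨(lt_returnTime_torsionPair one_pos hq hp t).2 ?_, hp⟩
  rintro c - m n h0 h1 hy
  rw [gridY_torsionPair] at hy ⊢
  simp only at hy ⊢
  rw [lt_div_iff₀ ha]
  have hn : (0 : ℝ) < n := by
    have := mul_pos hy ha
    rwa [div_mul_cancel₀ _ ha.ne'] at this
  have hn1 : (1 : ℝ) ≤ n := by exact_mod_cast (by exact_mod_cast hn : 0 < n)
  have : t * gridX (torsionPair 1 q (a, b)) c m n ≤ t * 1 := by gcongr
  nlinarith

theorem gapTail_mTorsion_isTheta {q : ℕ} (hq : 0 < q) :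
    gapTail affineLattice (mTorsion q) =Θ[atTop] (fun t : ℝ => t ^ (-2 : ℤ)) := by
  have hZ := torsionMeasure_univ_toReal_pos hq
  have htail : ∀ t, gapTail affineLattice (mTorsion q) t = (torsionMeasure q univ).toReal⁻¹ *
      (∑ k ∈ torsionIndices q, volume.restrict (torsionRegion k q)
        {p | t < returnTime (gridVectors {1}) (torsionPair k q p)}).toReal :=
    fun t => setIntegral_mTorsion q measurableSet_Ioi
  have hidx : ∀ k ∈ torsionIndices q, 0 < k ∧ k ≤ q := fun k hk =>
    Finset.mem_Icc.1 (Finset.mem_filter.1 hk).1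
  choose! K hK0 hK using fun k (hk : k ∈ torsionIndices q) =>
    exists_volume_torsion_le (hidx k hk).1 (hidx k hk).2
  have hsum : ∀ t : ℝ, 16 * (q : ℝ) ^ 2 ≤ t → ∑ k ∈ torsionIndices q,
      volume.restrict (torsionRegion k q)
        {p | t < returnTime (gridVectors {1}) (torsionPair k q p)} ≤
      ENNReal.ofReal ((∑ k ∈ torsionIndices q, K k) / t ^ 2) := by
    intro t ht
    rw [Finset.sum_div, ENNReal.ofReal_sum_of_nonneg
      (fun k hk => div_nonneg (hK0 k hk) (sq_nonneg t))]
    exact Finset.sum_le_sum fun k hk => hK k hk t ht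
  have hzpow : ∀ t : ℝ, t ^ (-2 : ℤ) = 1 / t ^ 2 := fun t => by
    rw [zpow_neg, one_div]
    norm_cast
  constructor
  · refine IsBigO.of_bound ((torsionMeasure q univ).toReal⁻¹ * ∑ k ∈ torsionIndices q, K k) ?_
    filter_upwards [eventually_ge_atTop (16 * (q : ℝ) ^ 2)] with t ht
    rw [htail, hzpow, Real.norm_of_nonneg (by positivity), Real.norm_of_nonneg (by positivity),
      mul_assoc]
    gcongr
    refine ENNReal.toReal_le_of_le_ofReal ?_ ((hsum t ht).trans_eq (by rw [mul_one_div]))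
    have := Finset.sum_nonneg hK0
    positivity
  · refine IsBigO.of_bound ((torsionMeasure q univ).toReal * 4) ?_
    filter_upwards [eventually_ge_atTop (16 * (q : ℝ) ^ 2), eventually_ge_atTop 1] with t ht ht1
    rw [htail, hzpow, Real.norm_of_nonneg (by positivity), Real.norm_of_nonneg (by positivity)]
    have h1 : 1 / 4 * (1 / t ^ 2) ≤ (∑ k ∈ torsionIndices q, volume.restrict (torsionRegion k q)
        {p | t < returnTime (gridVectors {1}) (torsionPair k q p)}).toReal := by
      rw [← ENNReal.ofReal_le_iff_le_toReal ((hsum t ht).trans_lt ENNReal.ofReal_lt_top).ne]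
      refine (le_volume_torsion hq ht1).trans ?_
      refine Finset.single_le_sum (f := fun k => volume.restrict (torsionRegion k q)
        {p | t < returnTime (gridVectors {1}) (torsionPair k q p)}) (fun _ _ => zero_le) ?_
      simp [torsionIndices]
      omega
    generalize (∑ k ∈ torsionIndices q, volume.restrict (torsionRegion k q)
        {p | t < returnTime (gridVectors {1}) (torsionPair k q p)}).toReal = x at h1
    have e : (torsionMeasure q univ).toReal * 4 * ((torsionMeasure q univ).toReal⁻¹ * x) =
        4 * x := by
      field_simp
    rw [e]
    linarith

/-! ### Return times of doubled slit tori: slits of short holonomy -/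

theorem slopesExceed_flux_of_steep {a b s α t : ℝ} (ha : 1 / 2 ≤ a) (ha1 : a ≤ 1)
    (hab : 1 - a < b) (hα0 : 0 < α) (hα1 : α ≤ 1) (hα : 1 - b < α) (hs : 0 < s) (ht : 0 < t)
    (hτ : t * b < 1 / a - s * b) (hleft : (1 / a - s * b) * (1 + b) ≤ b * (s * (1 - b)))
    (hcross : t * b < s * a) :
    SlopesExceed {0, 1, -1} t (fluxPair (a, b, s, α)) := by
  have hb : 0 < b := by linarith
  set θ := 1 / a - s * b with hθ
  have hθ0 : 0 < θ := lt_trans (by positivity) hτ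
  have hsa : 0 < s * a := by positivity
  intro c hc m n h0 h1 hy
  rw [gridX_fluxPair] at *
  rw [gridY_fluxPair] at *
  simp only at h0 h1 hy ⊢
  have ey : n / a - s * (a * m + b * n) = n * θ - s * a * m := by
    rw [hθ]
    ring
  rw [ey] at hy ⊢
  have steep : 0 < b * n → a * m + b * n + c * α ≤ b * n → m ≤ 0 →
      t * (a * m + b * n + c * α) < n * θ - s * a * m := by
    intro h2 h3 h4
    have hn : (0 : ℝ) < n := pos_of_mul_pos_right h2 hb.le
    have hm : (m : ℝ) ≤ 0 := by exact_mod_cast h4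
    have h5 : t * (a * m + b * n + c * α) ≤ t * (b * n) := by gcongr
    have h6 : n * (t * b) < n * θ := by gcongr
    have h7 : s * a * m ≤ 0 := mul_nonpos_of_nonneg_of_nonpos hsa.le hm
    linarith
  have row_nonpos : ∀ k : ℤ, b * n < b * (k + 1) → (n : ℝ) ≤ k := by
    intro k h
    have : (n : ℝ) < k + 1 := lt_of_mul_lt_mul_left h hb.le
    exact_mod_cast Int.lt_add_one_iff.1 (by exact_mod_cast this)
  rcases le_or_gt m 0 with hm | hm
  · have hm' : (m : ℝ) ≤ 0 := by exact_mod_cast hm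
    have ham : a * m ≤ 0 := mul_nonpos_of_nonneg_of_nonpos (by linarith) hm'
    rcases hc with rfl | rfl | rfl
    · exact steep (by linarith) (by linarith) hm
    · rcases eq_or_lt_of_le hm with rfl | hm1
      · have hn := row_nonpos 0 (by push_cast at *; linarith)
        push_cast at *
        have : (n : ℝ) * θ ≤ 0 := mul_nonpos_of_nonpos_of_nonneg hn hθ0.le
        linarith
      · rcases eq_or_lt_of_le (Int.le_sub_one_of_lt hm1) with rfl | hm2
        · have hn : 0 ≤ n := by
            have : (-1 : ℝ) < n := by
              refine lt_of_mul_lt_mul_left (a := b) ?_ hb.le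
              push_cast at h0
              linarith
            exact_mod_cast Int.lt_iff_add_one_le.1 (by exact_mod_cast this : (-1 : ℤ) < n)
          have hn' : (0 : ℝ) ≤ n := by exact_mod_cast hn
          have h6 : n * (t * b) ≤ n * θ := by gcongr
          push_cast
          have h7 : t * (a * (0 - 1) + b * n + 1 * α) ≤ t * (b + b * n) :=
            mul_le_mul_of_nonneg_left (by linarith) ht.le
          linarith
        · have hm3 : (m : ℝ) ≤ -2 := by exact_mod_cast (by omega : m ≤ -2)
          have : a * m ≤ a * (-2) := by gcongr
          exact steep (by linarith) (by linarith) hm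
    · exact steep (by linarith) (by linarith) hm
  · exfalso
    have hm1 : (1 : ℝ) ≤ m := by exact_mod_cast hm
    have ham : a * 1 ≤ a * m := by gcongr
    have hsam : s * a * 1 ≤ s * a * m := by gcongr
    have flat : b * n < b → False := by
      intro h2
      have hn := row_nonpos 0 (by push_cast; linarith)
      push_cast at hn
      have : (n : ℝ) * θ ≤ 0 := mul_nonpos_of_nonpos_of_nonneg hn hθ0.le
      linarith
    have hbθ : (1 + b) * θ ≤ b * (s * a) := by
      have : b * (s * (1 - b)) ≤ b * (s * a) := by
        gcongr
        linarith
      linarith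
    rcases hc with rfl | rfl | rfl
    · exact flat (by linarith)
    · exact flat (by linarith)
    · have h3 : (b * n) * θ ≤ b * (s * a * m) := by
        rcases eq_or_lt_of_le (Int.add_one_le_iff.2 hm) with rfl | hm2
        · push_cast at *
          have : (b * n) * θ ≤ (1 + b) * θ := by
            gcongr
            linarith
          linarith
        · have hm2' : (2 : ℝ) ≤ m := by exact_mod_cast hm2
          have ham2 : a * 2 ≤ a * m := by gcongr
          have hn := row_nonpos 1 (by push_cast; linarith)
          push_cast at hn
          have h4 : (b * n) * θ ≤ (1 + b) * θ := by
            gcongr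
            nlinarith
          have h5 : b * (s * a * 1) ≤ b * (s * a * m) := by gcongr
          linarith
      have h4 : b * (n * θ - s * a * m) ≤ 0 := by linarith
      have h5 := mul_pos hb hy
      linarith

theorem not_slopesExceed_flux_of_shallow {a b s α t : ℝ}
    (ha1 : a ≤ 1) (hb : 0 < b) (hab : 1 - a < b) (hα1 : α ≤ 1) (hα : 1 - b < α)
    (ht : 0 < t) (hθ : 0 < 1 / a - s * b)
    (h1 : b * (s * a) / (1 / a - s * b) + 2 * b ≤ 1)
    (h2 : 1 / a - s * b ≤ t * (b * (s * a) / (1 / a - s * b) - b)) :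
    ¬ SlopesExceed {0, 1, -1} t (fluxPair (a, b, s, α)) := by
  intro h
  set θ := 1 / a - s * b with hθd
  have hn1 := Int.floor_le (s * a / θ)
  have hn2 := Int.lt_floor_add_one (s * a / θ)
  generalize ⌊s * a / θ⌋ = k at hn1 hn2
  have hbk1 : b * (k : ℝ) ≤ b * (s * a / θ) := by gcongr
  have hbk2 : b * (s * a / θ) < b * (k + 1) := by gcongr
  rw [← mul_div_assoc] at hbk1 hbk2
  rw [le_div_iff₀ hθ] at hn1
  rw [div_lt_iff₀ hθ] at hn2
  have h3 : 0 < t * (b * (s * a) / θ - b) := hθ.trans_le h2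
  have h4 : 0 < b * (s * a) / θ - b := pos_of_mul_pos_right h3 ht.le
  have ey : ((k + 1 : ℤ) : ℝ) / a - s * (a * ((1 : ℤ) : ℝ) + b * ((k + 1 : ℤ) : ℝ)) =
      (k + 1) * θ - s * a := by
    rw [hθd]
    push_cast
    ring
  have h5 := h.flux_vector (c := -1) (by simp) 1 (k + 1) (by push_cast; linarith)
    (by push_cast; linarith) (by rw [ey]; linarith)
  rw [ey] at h5
  push_cast at h5
  have h6 : t * (b * (s * a) / θ - b) ≤ t * (a * 1 + b * (k + 1) + -1 * α) := by
    gcongr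
    linarith
  linarith

/-- The set of limiting rescaled coordinates. -/
def slitFluxLimit : Set (ℝ × ℝ × ℝ × ℝ) :=
  {q | 0 ≤ q.1 ∧ q.1 < q.2.1 ∧ 0 ≤ q.2.2.2 ∧ q.2.2.2 < q.2.1 ∧ q.2.1 * (q.2.2.1 + 1) < 1 ∧
    1 < 2 * (q.2.1 * q.2.2.1)}

/-- A set of finite volume that contains the rescaled coordinates. -/
def slitFluxBound : Set (ℝ × ℝ × ℝ × ℝ) :=
  {q | 0 ≤ q.1 ∧ q.1 < q.2.1 ∧ 0 ≤ q.2.2.2 ∧ q.2.2.2 < q.2.1 ∧ q.2.1 < 2 ∧ 0 ≤ q.2.2.1 ∧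
    q.2.1 * q.2.2.1 < 2}

theorem measurableSet_slitFluxLimit : MeasurableSet slitFluxLimit := by
  unfold slitFluxLimit
  measurability

theorem measurableSet_slitFluxBound : MeasurableSet slitFluxBound := by
  unfold slitFluxBound
  measurability

theorem volume_slitFluxBound_lt_top : volume slitFluxBound < ∞ := by
  rw [volume_four measurableSet_slitFluxBound]
  calc _ ≤ ∫⁻ a, (Icc (0 : ℝ) 2).indicator (fun _ => (4 : ℝ≥0∞)) a := by
        refine lintegral_mono fun a => ?_
        calc _ ≤ ∫⁻ b, (Icc (0 : ℝ) 2).indicator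
              (fun _ => (Icc (0 : ℝ) 2).indicator (fun _ => (2 : ℝ≥0∞)) a) b := by
              refine lintegral_mono fun b => ?_
              by_cases h : (a ∈ Icc (0 : ℝ) 2 ∧ b ∈ Icc (0 : ℝ) 2) ∧ 0 < b
              · rw [indicator_of_mem h.1.2, indicator_of_mem h.1.1]
                have hb := h.2
                calc _ ≤ volume (Icc 0 (2 / b) ×ˢ Icc 0 b) := by
                      refine measure_mono ?_
                      rintro ⟨s, r⟩ ⟨-, -, h3, h4, -, h5, h6⟩
                      simp only at h3 h4 h5 h6
                      refine ⟨⟨h5, ?_⟩, h3, h4.le⟩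
                      simp only
                      rw [le_div_iff₀ hb]
                      linarith
                  _ = 2 := by
                      rw [Measure.volume_eq_prod, Measure.prod_prod, Real.volume_Icc,
                        Real.volume_Icc, ← ENNReal.ofReal_mul (by simp; positivity)]
                      simp [hb.ne']
                  _ ≤ _ := le_rfl
              · have : {q : ℝ × ℝ | (a, b, q) ∈ slitFluxBound} = ∅ := by
                  refine eq_empty_iff_forall_notMem.2 ?_
                  rintro ⟨s, r⟩ ⟨h1, h2, h3, h4, h5, h6, h7⟩
                  simp only at h1 h2 h3 h4 h5
                  exact h ⟨⟨⟨h1, by linarith⟩, by linarith, h5.le⟩, by linarith⟩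
                rw [this]
                simp
          _ ≤ _ := by
              rw [lintegral_indicator_const measurableSet_Icc, Real.volume_Icc]
              by_cases ha : a ∈ Icc (0 : ℝ) 2
              · rw [indicator_of_mem ha, indicator_of_mem ha]
                norm_num
              · rw [indicator_of_notMem ha, indicator_of_notMem ha]
                simp
    _ < ∞ := by
        rw [lintegral_indicator_const measurableSet_Icc, Real.volume_Icc]
        exact ENNReal.mul_lt_top (by simp) (by simp)

theorem volume_slitFluxLimit_pos : 0 < volume slitFluxLimit := by
  have hopen : IsOpen {q : ℝ × ℝ × ℝ × ℝ | 0 < q.1 ∧ q.1 < q.2.1 ∧ 0 < q.2.2.2 ∧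
      q.2.2.2 < q.2.1 ∧ q.2.1 * (q.2.2.1 + 1) < 1 ∧ 1 < 2 * (q.2.1 * q.2.2.1)} := by
    simp only [ofPred_and]
    repeat' apply IsOpen.inter
    all_goals exact isOpen_lt (by fun_prop) (by fun_prop)
  refine (hopen.measure_pos volume ⟨(1 / 8, 1 / 4, 5 / 2, 1 / 8), by norm_num⟩).trans_le
    (measure_mono ?_)
  rintro q ⟨h1, h2, h3, h4, h5⟩
  exact ⟨h1.le, h2, h3.le, h4, h5⟩

theorem volume_slitFluxLimit_lt_top : volume slitFluxLimit < ∞ := by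
  refine (measure_mono ?_).trans_lt volume_slitFluxBound_lt_top
  rintro ⟨A, β, S, Y⟩ ⟨h1, h2, h3, h4, h5, h6⟩
  simp only at h1 h2 h3 h4 h5 h6
  have hβ : 0 < β := by linarith
  have hS : 0 < S := by
    have : 0 < β * S := by linarith
    exact pos_of_mul_pos_right this hβ.le
  refine ⟨h1, h2, h3, h4, ?_, hS.le, ?_⟩
  · simp only
    nlinarith
  · simp only
    nlinarith

theorem ae_rescaled_generic : ∀ᵐ q : ℝ × ℝ × ℝ × ℝ,
    q.2.2.1 ≠ 0 ∧ q.2.1 * (q.2.2.1 + 1) ≠ 1 ∧ 2 * (q.2.1 * q.2.2.1) ≠ 1 := by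
  have h1 : ∀ᵐ q : ℝ × ℝ × ℝ × ℝ, q.2.2.1 ≠ 0 := by
    rw [ae_iff]
    refine volume_four_eq_zero_of_third ?_ fun a b r => ?_
    · simp only [not_not]
      exact measurableSet_eq_fun (by fun_prop) (by fun_prop)
    · simp
  have h2 : ∀ᵐ q : ℝ × ℝ × ℝ × ℝ, q.2.1 * (q.2.2.1 + 1) ≠ 1 := by
    rw [ae_iff]
    refine volume_four_eq_zero_of_third ?_ fun a b r => ?_
    · simp only [not_not]
      exact measurableSet_eq_fun (by fun_prop) (by fun_prop)
    · refine measure_mono_null (t := {1 / b - 1}) (fun s hs => ?_) (by simp)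
      simp only [mem_ofPred_eq, not_not] at hs
      have hb : b ≠ 0 := left_ne_zero_of_mul_eq_one hs
      rw [mem_singleton_iff]
      field_simp
      linarith
  have h3 : ∀ᵐ q : ℝ × ℝ × ℝ × ℝ, 2 * (q.2.1 * q.2.2.1) ≠ 1 := by
    rw [ae_iff]
    refine volume_four_eq_zero_of_third ?_ fun a b r => ?_
    · simp only [not_not]
      exact measurableSet_eq_fun (by fun_prop) (by fun_prop)
    · refine measure_mono_null (t := {1 / (2 * b)}) (fun s hs => ?_) (by simp)
      simp only [mem_ofPred_eq, not_not] at hs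
      have hb : b ≠ 0 := by
        rintro rfl
        simp at hs
      rw [mem_singleton_iff]
      field_simp
      linarith
  filter_upwards [h1, h2, h3] with q a b c using ⟨a, b, c⟩

/-- The coordinates of the slit tori of the affine part with return time greater than `t`. -/
def slitFluxTail (t : ℝ) : Set (ℝ × ℝ × ℝ × ℝ) :=
  {p | t < returnTime (gridVectors {0, 1, -1}) (fluxPair p)}

/-- The coordinates that carry the main part of the tail. -/
def slitFluxMain : Set (ℝ × ℝ × ℝ × ℝ) := {p | 1 / 2 ≤ p.1 ∧ 1 - p.2.1 < p.2.2.2}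

theorem measurableSet_slitFluxTail (t : ℝ) : MeasurableSet (slitFluxTail t) :=
  ((measurable_returnTime (toFinite {0, 1, -1}).countable).comp measurable_fluxPair)
    measurableSet_Ioi

theorem measurableSet_slitFluxMain : MeasurableSet slitFluxMain := by
  unfold slitFluxMain
  measurability

theorem mem_slitFluxTail_iff {p : ℝ × ℝ × ℝ × ℝ} (hp : p ∈ omegaCoords) (t : ℝ) :
    p ∈ slitFluxTail t ↔ SlopesExceed {0, 1, -1} t (fluxPair p) :=
  lt_returnTime_fluxPair (toFinite _) (by simp) hp t

theorem slope_pos_of_mem_omegaCoords {a b s α : ℝ} (hp : (a, b, s, α) ∈ omegaCoords) :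
    0 < a ∧ 0 < b ∧ s * b < 1 / a ∧ s * a < 1 / b := by
  obtain ⟨ha, ha1, hab, hb1, hs0, hs1, -⟩ := hp
  simp only at ha ha1 hab hb1 hs1 hs0
  have hb : 0 < b := by linarith
  have hab0 : 0 < a * b := by positivity
  rw [← one_div, lt_div_iff₀ hab0] at hs1
  refine ⟨ha, hb, ?_, ?_⟩
  · rw [lt_div_iff₀ ha]
    linarith
  · rw [lt_div_iff₀ hb]
    linarith

theorem SlopesExceed.flux_lattice {a b s α t : ℝ} (hp : (a, b, s, α) ∈ omegaCoords)
    (h : SlopesExceed {0, 1, -1} t (fluxPair (a, b, s, α))) : t * b < 1 / a - s * b := by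
  obtain ⟨ha, hb, hsb, -⟩ := slope_pos_of_mem_omegaCoords hp
  have hb1 : b ≤ 1 := hp.2.2.2.1
  have h1 := h.flux_vector (c := 0) (by simp) 0 1 (by push_cast; linarith) (by push_cast; linarith)
    (by push_cast; linarith)
  push_cast at h1
  linarith

theorem fluxMeasure_slitFluxTail_diff_le {t : ℝ} (ht : 0 < t) :
    fluxMeasure (slitFluxTail t \ slitFluxMain) ≤ ENNReal.ofReal (128 / t ^ 3) := by
  have h0 : fluxMeasure (slitFluxTail t \ slitFluxMain) =
      fluxMeasure ((slitFluxTail t \ slitFluxMain) \ {p | p.2.2.1 = 0}) :=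
    (measure_sdiff_null fluxMeasure_zero_shear).symm
  rw [h0]
  refine (fluxMeasure_le (ε := 1 / t) (δ := 4 / t) (w := 4 / t) (l := fun _ => 0) (by positivity)
    (by positivity) (by positivity) measurable_const ?_).trans_eq (by congr 1; field_simp; norm_num)
  rintro a b s α hp ⟨⟨h1, h2⟩, hs⟩
  rw [mem_slitFluxTail_iff hp] at h1
  have h3 := h1.flux_lattice hp
  obtain ⟨ha, hb, hsb, hsa⟩ := slope_pos_of_mem_omegaCoords hp
  obtain ⟨-, ha1, hab, hb1, hs0, -, hα, hα1⟩ := hp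
  simp only [slitFluxMain, mem_ofPred_eq, not_and, not_lt] at ha1 hab hb1 hs0 hα hα1 hs h2
  have hs0 : 0 < s := lt_of_le_of_ne hs0 (Ne.symm hs)
  have hsb0 : 0 < s * b := by positivity
  have hsa0 : 0 < s * a := by positivity
  have h4 : t * b < 1 / a := by linarith
  rw [lt_div_iff₀ ha] at h4
  have hα4 : α ≤ 4 / t := by
    rw [le_div_iff₀ ht]
    rcases lt_or_ge a (1 / 2) with ha2 | ha2
    · have hb2 : 1 / 2 ≤ b := by linarith
      have hat : t * a ≤ 2 := by nlinarith
      rcases le_or_gt α a with hαa | hαa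
      · nlinarith
      · have h5 := h1.flux_vector (c := 1) (by simp) (-1) 0 (by push_cast; linarith)
          (by push_cast; linarith) (by push_cast; simp only [zero_div]; linarith)
        push_cast at h5
        simp only [zero_div] at h5
        have h6 : 1 / b ≤ 2 := by
          rw [div_le_iff₀ hb]
          linarith
        linarith
    · have h5 := h1.flux_vector (c := 1) (by simp) 0 1 (by push_cast; linarith)
        (by push_cast; linarith [h2 ha2]) (by push_cast; linarith)
      push_cast at h5
      have h6 : 1 / a ≤ 2 := by
        rw [div_le_iff₀ ha]
        linarith
      have h7 : 0 < t * b := by positivity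
      linarith
  refine ⟨?_, hα.le, by linarith, hα4⟩
  rw [lt_div_iff₀ ht]
  linarith

/-- The centre of the rescaling at the vertex `(1, 0)` of the triangle of the coordinates
`(a, b)`. -/
def slitFluxCentre : ℝ × ℝ × ℝ × ℝ := (1, 0, 0, 1)

/-- The factors of the rescaling. -/
def slitFluxScale (t : ℝ) : ℝ × ℝ × ℝ × ℝ := (-t⁻¹, t⁻¹, t, -t⁻¹)

theorem slitFlux_rescale (t A β S Y : ℝ) : slitFluxCentre + slitFluxScale t * (A, β, S, Y) =
    (1 - A / t, β / t, t * S, 1 - Y / t) := by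
  simp only [slitFluxCentre, slitFluxScale, Prod.mk_mul_mk, Prod.mk_add_mk, Prod.mk.injEq]
  refine ⟨?_, ?_, ?_, ?_⟩ <;> ring

theorem slitFlux_rescaled_mem_bound {t A β S Y : ℝ} (ht : 0 < t)
    (h : (1 - A / t, β / t, t * S, 1 - Y / t) ∈
      omegaCoords ∩ (slitFluxTail t ∩ slitFluxMain)) : (A, β, S, Y) ∈ slitFluxBound := by
  obtain ⟨hp, h1, h2, h3⟩ := h
  rw [mem_slitFluxTail_iff hp] at h1
  have h4 := h1.flux_lattice hp
  obtain ⟨ha, hb, hsb, hsa⟩ := slope_pos_of_mem_omegaCoords hp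
  obtain ⟨-, ha1, hab, hb1, hs0, -, hα, hα1⟩ := hp
  simp only at h2 h3 ha1 hab hb1 hs0 hα hα1
  have h6 : 1 / (1 - A / t) ≤ 2 := by
    rw [div_le_iff₀ ha]
    linarith
  have e1 : t * (β / t) = β := by field_simp
  have e2 : t * S * (β / t) = β * S := by field_simp
  have hS : 0 ≤ S := nonneg_of_mul_nonneg_right hs0 ht
  have hβ : 0 < β := by
    rw [← e1]
    positivity
  rw [e1, e2] at h4
  rw [e2] at hsb
  have hAt : 0 ≤ A / t := by linarith
  have hYt : 0 ≤ Y / t := by linarith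
  have hAβ : A / t < β / t := by linarith
  have hYβ : Y / t < β / t := by linarith
  have hβS : 0 ≤ β * S := by positivity
  refine ⟨?_, (div_lt_div_iff_of_pos_right ht).1 hAβ, ?_, (div_lt_div_iff_of_pos_right ht).1 hYβ,
    ?_, hS, ?_⟩
  · simpa [ht.ne'] using mul_nonneg hAt ht.le
  · simpa [ht.ne'] using mul_nonneg hYt ht.le
  · simp only
    linarith
  · simp only
    linarith

theorem slitFlux_eventually_mem_iff {A β S Y : ℝ} (hS0 : S ≠ 0) (h1 : β * (S + 1) ≠ 1)
    (h2 : 2 * (β * S) ≠ 1) :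
    ∀ᶠ t : ℝ in atTop, ((1 - A / t, β / t, t * S, 1 - Y / t) ∈
      omegaCoords ∩ (slitFluxTail t ∩ slitFluxMain) ↔ (A, β, S, Y) ∈ slitFluxLimit) := by
  by_cases hdom : 0 ≤ A ∧ A < β ∧ 0 ≤ Y ∧ Y < β ∧ 0 < S
  swap
  · filter_upwards [eventually_gt_atTop 0] with t ht
    refine iff_of_false (fun h => hdom ?_) (fun h => hdom ?_)
    · obtain ⟨h1, h2, h3, h4, -, h6, -⟩ := slitFlux_rescaled_mem_bound ht h
      exact ⟨h1, h2, h3, h4, lt_of_le_of_ne h6 (Ne.symm hS0)⟩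
    · obtain ⟨h1, h2, h3, h4, -, h6⟩ := h
      simp only at h1 h2 h3 h4 h6
      refine ⟨h1, h2, h3, h4, ?_⟩
      have hβ : 0 < β := by linarith
      have : 0 < β * S := by linarith
      exact pos_of_mul_pos_right this hβ.le
  obtain ⟨hA, hAβ, hY, hYβ, hS⟩ := hdom
  have hβ : 0 < β := by linarith
  have la : Tendsto (fun t : ℝ => 1 - A / t) atTop (𝓝 1) := by
    simpa using tendsto_const_nhds.sub (tendsto_const_nhds.div_atTop (tendsto_id (α := ℝ)))
  have lb : Tendsto (fun t : ℝ => β / t) atTop (𝓝 0) := tendsto_const_nhds.div_atTop tendsto_id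
  have lα : Tendsto (fun t : ℝ => 1 - Y / t) atTop (𝓝 1) := by
    simpa using tendsto_const_nhds.sub (tendsto_const_nhds.div_atTop (tendsto_id (α := ℝ)))
  have lθ : Tendsto (fun t : ℝ => 1 / (1 - A / t) - β * S) atTop (𝓝 (1 - β * S)) := by
    have := (tendsto_const_nhds (x := (1 : ℝ))).div la one_ne_zero
    simpa using this.sub_const (β * S)
  have e2 : ∀ t : ℝ, 0 < t → t * S * (β / t) = β * S := fun t ht => by field_simp
  have e1 : ∀ t : ℝ, 0 < t → t * (β / t) = β := fun t ht => by field_simp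
  rcases lt_or_gt_of_ne h1 with hT | hT
  swap
  · have ev : ∀ᶠ t : ℝ in atTop, 1 / (1 - A / t) - β * S < β :=
      lθ.eventually_lt_const (by linarith)
    filter_upwards [ev, eventually_gt_atTop 0] with t h3 ht
    refine iff_of_false (fun h => ?_) (fun h => ?_)
    · have h4 := ((mem_slitFluxTail_iff h.1 t).1 h.2.1).flux_lattice h.1
      rw [e1 t ht, e2 t ht] at h4
      linarith
    · have := h.2.2.2.2.1
      simp only at this
      linarith
  have hdomain : ∀ᶠ t : ℝ in atTop, 0 < t ∧ 1 / 2 ≤ 1 - A / t ∧ 1 - A / t ≤ 1 ∧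
      1 - (1 - A / t) < β / t ∧ β / t ≤ 1 ∧ t * S < (((1 - A / t) * (β / t)))⁻¹ ∧
      0 < 1 - Y / t ∧ 1 - Y / t ≤ 1 ∧ 1 - β / t < 1 - Y / t ∧ β < 1 / (1 - A / t) - β * S := by
    filter_upwards [eventually_gt_atTop 0, la.eventually_const_le (by norm_num : (1 : ℝ) / 2 < 1),
      lb.eventually_le_const (by norm_num : (0 : ℝ) < 1),
      lα.eventually_const_lt (by norm_num : (0 : ℝ) < 1),
      lθ.eventually_const_lt (by linarith : β < 1 - β * S)] with t ht h3 h4 h5 h6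
    have hAt : 0 ≤ A / t := by positivity
    have hYt : 0 ≤ Y / t := by positivity
    have hAβ' : A / t < β / t := by gcongr
    have hYβ' : Y / t < β / t := by gcongr
    have hbt : 0 < β / t := by positivity
    refine ⟨ht, h3, by linarith, by linarith, h4, ?_, h5, by linarith, by linarith, h6⟩
    rw [← one_div, ← div_div, lt_div_iff₀ hbt, e2 t ht]
    linarith
  rcases lt_or_gt_of_ne h2 with hU | hU
  · have hpos : 0 < 1 - β * S := by linarith
    have l0 : Tendsto (fun t : ℝ => β * (S * (1 - A / t))) atTop (𝓝 (β * S)) := by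
      simpa using (la.const_mul S).const_mul β
    have l1 : Tendsto (fun t : ℝ => β * (S * (1 - A / t)) / (1 / (1 - A / t) - β * S))
        atTop (𝓝 (β * S / (1 - β * S))) := l0.div lθ hpos.ne'
    have l2 : Tendsto (fun t : ℝ => β * (S * (1 - A / t)) / (1 / (1 - A / t) - β * S) + 2 * (β / t))
        atTop (𝓝 (β * S / (1 - β * S))) := by
      simpa using l1.add (lb.const_mul 2)
    have l3 : Tendsto (fun t : ℝ => β * (S * (1 - A / t)) / (1 / (1 - A / t) - β * S) - β / t)
        atTop (𝓝 (β * S / (1 - β * S))) := by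
      simpa using l1.sub lb
    have l4 := tendsto_id.atTop_mul_pos (by positivity : 0 < β * S / (1 - β * S)) l3
    filter_upwards [hdomain, l2.eventually_le_const (by rw [div_lt_one hpos]; linarith :
        β * S / (1 - β * S) < 1),
      l4.eventually_ge_atTop 2] with t hd h4 h5
    obtain ⟨ht, ha, ha1, hab, hb1, hs, hα, hα1, hαb, hθ⟩ := hd
    refine iff_of_false (fun h => ?_) (fun h => ?_)
    · have hbt : 0 < β / t := by positivity
      have e3 : β / t * (t * S * (1 - A / t)) = β * (S * (1 - A / t)) := by field_simp
      refine not_slopesExceed_flux_of_shallow (a := 1 - A / t) (b := β / t) (s := t * S)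
        ha1 hbt hab hα1 hαb ht ?_ ?_ ?_
        ((mem_slitFluxTail_iff h.1 t).1 h.2.1)
      · rw [e2 t ht]
        linarith
      · rw [e2 t ht, e3]
        exact h4
      · rw [e2 t ht, e3]
        refine le_trans ?_ h5
        have : 1 / (1 - A / t) ≤ 2 := by
          rw [div_le_iff₀ (by linarith)]
          linarith
        have : 0 < β * S := by positivity
        linarith
    · have := h.2.2.2.2.2
      simp only at this
      linarith
  · have l1 : Tendsto (fun t : ℝ => (1 / (1 - A / t) - β * S) * (1 + β / t) -
        β * S * (1 - β / t)) atTop (𝓝 (1 - β * S - β * S)) := by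
      have := (lθ.mul (lb.const_add 1)).sub ((lb.const_sub 1).const_mul (β * S))
      simpa using this
    have l2 := tendsto_id.atTop_mul_pos hS
      (by simpa using la.const_mul S : Tendsto (fun t : ℝ => S * (1 - A / t)) atTop (𝓝 S))
    filter_upwards [hdomain, l1.eventually_le_const (by linarith : 1 - β * S - β * S < 0),
      l2.eventually_gt_atTop β] with t hd h4 h5
    obtain ⟨ht, ha, ha1, hab, hb1, hs, hα, hα1, hαb, hθ⟩ := hd
    refine iff_of_true ?_ ⟨hA, hAβ, hY, hYβ, hT, hU⟩
    have hp : (1 - A / t, β / t, t * S, 1 - Y / t) ∈ omegaCoords :=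
      ⟨by simp only; linarith, ha1, hab, hb1, by simp only; positivity, hs, hα, hα1⟩
    refine ⟨hp, (mem_slitFluxTail_iff hp t).2 ?_, ha, hαb⟩
    refine slopesExceed_flux_of_steep ha ha1 hab hα hα1 hαb (by positivity) ht ?_ ?_ ?_
    · rw [e1 t ht, e2 t ht]
      exact hθ
    · have e3 : β / t * (t * S * (1 - β / t)) = β * S * (1 - β / t) := by field_simp
      rw [e2 t ht, e3]
      linarith
    · rw [e1 t ht]
      simp only [id] at h5
      linarith

theorem tendsto_fluxMeasure_main :
    Tendsto (fun t : ℝ => ENNReal.ofReal (t ^ 2) * fluxMeasure (slitFluxTail t ∩ slitFluxMain))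
      atTop (𝓝 (volume slitFluxLimit)) := by
  have hm : ∀ t, MeasurableSet (slitFluxTail t ∩ slitFluxMain) := fun t =>
    (measurableSet_slitFluxTail t).inter measurableSet_slitFluxMain
  simp only [fluxMeasure_apply (hm _)]
  rw [← lintegral_indicator_one measurableSet_slitFluxLimit]
  refine tendsto_sq_mul_lintegral (K := slitFluxBound) slitFluxCentre slitFluxScale
    (fun t => Measurable.indicator (by fun_prop) (measurableSet_omegaCoords.inter (hm t))) ?_
    measurableSet_slitFluxBound volume_slitFluxBound_lt_top.ne ?_ ?_
  · intro t ht
    have e : -t⁻¹ * t⁻¹ * t * -t⁻¹ = (t ^ 2)⁻¹ := by field_simp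
    simp only [slitFluxScale]
    rw [e, abs_of_pos (by positivity)]
  · filter_upwards [eventually_gt_atTop 0] with t ht
    rintro ⟨A, β, S, Y⟩
    rw [slitFlux_rescale]
    by_cases h : (1 - A / t, β / t, t * S, 1 - Y / t) ∈
      omegaCoords ∩ (slitFluxTail t ∩ slitFluxMain)
    · rw [indicator_of_mem h, indicator_of_mem (slitFlux_rescaled_mem_bound ht h)]
      simp only [Pi.one_apply, ENNReal.ofReal_le_one]
      exact h.1.2.2.2.2.2.2.2
    · rw [indicator_of_notMem h]
      exact zero_le
  · filter_upwards [ae_rescaled_generic] with q hq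
    obtain ⟨A, β, S, Y⟩ := q
    obtain ⟨h0, h1, h2⟩ := hq
    have hev := slitFlux_eventually_mem_iff (A := A) (Y := Y) h0 h1 h2
    have lY : Tendsto (fun t : ℝ => ENNReal.ofReal (1 - Y / t)) atTop (𝓝 1) := by
      have : Tendsto (fun t : ℝ => 1 - Y / t) atTop (𝓝 1) := by
        simpa using tendsto_const_nhds.sub (tendsto_const_nhds.div_atTop (tendsto_id (α := ℝ)))
      simpa using ENNReal.tendsto_ofReal this
    simp only [slitFlux_rescale]
    by_cases h : (A, β, S, Y) ∈ slitFluxLimit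
    · rw [indicator_of_mem h]
      refine lY.congr' ?_
      filter_upwards [hev] with t ht
      rw [indicator_of_mem (ht.2 h)]
    · rw [indicator_of_notMem h]
      refine tendsto_const_nhds.congr' ?_
      filter_upwards [hev] with t ht
      rw [indicator_of_notMem fun h' => h (ht.1 h')]

theorem tendsto_fluxMeasure_slitFluxTail :
    Tendsto (fun t : ℝ => ENNReal.ofReal (t ^ 2) * fluxMeasure (slitFluxTail t))
      atTop (𝓝 (volume slitFluxLimit)) := by
  have h1 : Tendsto (fun t : ℝ => ENNReal.ofReal (t ^ 2) *
      fluxMeasure (slitFluxTail t \ slitFluxMain)) atTop (𝓝 0) := by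
    have h2 : Tendsto (fun t : ℝ => ENNReal.ofReal (128 / t)) atTop (𝓝 0) := by
      have : Tendsto (fun t : ℝ => 128 / t) atTop (𝓝 0) := tendsto_const_nhds.div_atTop tendsto_id
      simpa using ENNReal.tendsto_ofReal this
    refine tendsto_of_tendsto_of_tendsto_of_le_of_le' tendsto_const_nhds h2
      (Eventually.of_forall fun _ => zero_le) ?_
    filter_upwards [eventually_gt_atTop 0] with t ht
    refine (mul_le_mul_right (fluxMeasure_slitFluxTail_diff_le ht) _).trans_eq ?_
    rw [← ENNReal.ofReal_mul (by positivity)]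
    congr 1
    field_simp
  have h2 := tendsto_fluxMeasure_main.add h1
  rw [add_zero] at h2
  refine h2.congr fun t => ?_
  rw [← mul_add, measure_inter_add_sdiff _ measurableSet_slitFluxMain]

/-! ### Return times of doubled slit tori: short lattice vectors -/

theorem SlopesExceed.slit_vector {C : Set ℝ} {t a b x y : ℝ}
    (h : SlopesExceed C t (slitPair (a, b, x, y))) {c : ℝ} (hc : c ∈ C) (m n : ℤ)
    (h0 : 0 < a * (m + c * x) + b * (n + c * y)) (h1 : a * (m + c * x) + b * (n + c * y) ≤ 1)
    (h2 : 0 < (n + c * y) / a) :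
    t * (a * (m + c * x) + b * (n + c * y)) < (n + c * y) / a := by
  have := h c hc m n
  rw [gridX_slitPair, gridY_slitPair] at this
  exact this h0 h1 h2

theorem SlopesExceed.slit_row {C : Set ℝ} {t a b x y : ℝ} (ha : 0 < a) (ha1 : a < 1) (ht : 0 < t)
    (h : SlopesExceed C t (slitPair (a, b, x, y))) {c : ℝ} (hc : c ∈ C) (n : ℤ)
    (hn : 0 < n + c * y) : t * (1 - a) < (n + c * y) / a := by
  have h1 := Int.floor_le ((1 - b * (n + c * y)) / a - c * x)
  have h2 := Int.lt_floor_add_one ((1 - b * (n + c * y)) / a - c * x)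
  generalize ⌊(1 - b * (n + c * y)) / a - c * x⌋ = m at h1 h2
  have h3 : m + c * x ≤ (1 - b * (n + c * y)) / a := by linarith
  have h4 : (1 - b * (n + c * y)) / a < m + c * x + 1 := by linarith
  rw [le_div_iff₀ ha] at h3
  rw [div_lt_iff₀ ha] at h4
  have h5 := h.slit_vector hc m n (by linarith) (by linarith) (by positivity)
  have h6 : t * (1 - a) ≤ t * (a * (m + c * x) + b * (n + c * y)) :=
    mul_le_mul_of_nonneg_left (by linarith) ht.le
  linarith

theorem slopesExceed_slit_of_fract {t a b x y : ℝ} (ha : 0 < a) (ht : 0 < t)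
    (h1 : t * a < Int.fract y) (h2 : t * a < 1 - Int.fract y) :
    SlopesExceed {0, 1, -1} t (slitPair (a, b, x, y)) := by
  intro c hc m n _ hX hY
  have hy := Int.floor_add_fract y
  have hf0 := Int.fract_nonneg y
  have hf1 := Int.fract_lt_one y
  rw [gridY_slitPair] at hY ⊢
  simp only at hY ⊢
  have hη : 0 < n + c * y := by
    have := mul_pos hY ha
    rwa [div_mul_cancel₀ _ ha.ne'] at this
  have key : t * a < n + c * y := by
    rcases hc with rfl | rfl | rfl
    · have : (0 : ℝ) < n := by linarith
      have : (1 : ℝ) ≤ n := by exact_mod_cast (by exact_mod_cast this : 0 < n)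
      linarith
    · have : (-1 : ℝ) < n + ⌊y⌋ := by linarith
      have : (0 : ℝ) ≤ n + ⌊y⌋ := by
        exact_mod_cast Int.lt_iff_add_one_le.1 (by exact_mod_cast this : (-1 : ℤ) < n + ⌊y⌋)
      linarith
    · have : (0 : ℝ) < n - ⌊y⌋ := by linarith
      have : (1 : ℝ) ≤ n - ⌊y⌋ := by
        exact_mod_cast (by exact_mod_cast this : (0 : ℤ) < n - ⌊y⌋)
      linarith
  calc t * gridX (slitPair (a, b, x, y)) c m n ≤ t * 1 := by gcongr
    _ < (n + c * y) / a := by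
      rw [lt_div_iff₀ ha]
      linarith

/-- The coordinates of the slit tori of the lattice part with return time greater than `t`. -/
def slitLatticeTail (t : ℝ) : Set (ℝ × ℝ × ℝ × ℝ) :=
  {p | t < returnTime (gridVectors {0, 1, -1}) (slitPair p)}

theorem measurableSet_slitLatticeTail (t : ℝ) : MeasurableSet (slitLatticeTail t) :=
  ((measurable_returnTime (toFinite {0, 1, -1}).countable).comp measurable_slitPair)
    measurableSet_Ioi

theorem mem_slitLatticeTail_iff {p : ℝ × ℝ × ℝ × ℝ} (hp : p ∈ slitBox) (t : ℝ) :
    p ∈ slitLatticeTail t ↔ SlopesExceed {0, 1, -1} t (slitPair p) :=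
  lt_returnTime_slitPair (toFinite _) (by simp) hp t

theorem SlopesExceed.slit_lattice {t a b x y : ℝ} (hp : (a, b, x, y) ∈ slitBox)
    (h : SlopesExceed {0, 1, -1} t (slitPair (a, b, x, y))) : t * b < 1 / a := by
  obtain ⟨ha, ha1, hab, hb1, -⟩ := hp
  simp only at ha ha1 hab hb1
  have h1 := h.slit_vector (c := 0) (by simp) 0 1 (by push_cast; linarith) (by push_cast; linarith)
    (by push_cast; simp; exact ha)
  push_cast at h1
  simpa using h1

/-- The slit tori with a very short horizontal lattice vector. -/
def shortBase : Set (ℝ × ℝ × ℝ × ℝ) := {p | p.1 < 1 / 2}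

theorem measurableSet_shortBase : MeasurableSet shortBase := by
  unfold shortBase
  measurability

/-- A box that contains the rescaled coordinates. -/
def rescaledBox : Set (ℝ × ℝ × ℝ × ℝ) := Icc (0, 0, 0, 0) (2, 2, 2, 2)

theorem volume_rescaledBox_ne_top : volume rescaledBox ≠ ∞ := isCompact_Icc.measure_lt_top.ne

/-- The set of limiting rescaled coordinates of slit tori with a very short horizontal lattice
vector. -/
def slitLatticeLimit : Set (ℝ × ℝ × ℝ × ℝ) :=
  {q | (0 < q.1 ∧ 0 ≤ q.2.1 ∧ q.2.1 < q.1 ∧ 0 ≤ q.2.2.1 ∧ q.2.2.1 < 2 ∧ 0 ≤ q.2.2.2 ∧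
    q.2.2.2 < 2) ∧ q.1 < Int.fract q.2.2.2 ∧ q.1 < 1 - Int.fract q.2.2.2}

theorem measurableSet_slitLatticeLimit : MeasurableSet slitLatticeLimit := by
  unfold slitLatticeLimit
  measurability

theorem volume_slitLatticeLimit_ne_top : volume slitLatticeLimit ≠ ∞ := by
  refine ((measure_mono ?_).trans_lt volume_rescaledBox_ne_top.lt_top).ne
  rintro ⟨A, B, x, y⟩ ⟨⟨h1, h2, h3, h4, h5, h6, h7⟩, h8, h9⟩
  simp only at h1 h2 h3 h4 h5 h6 h7 h8 h9
  have := Int.fract_nonneg y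
  exact ⟨⟨h1.le, h2, h4, h6⟩, by simp only; linarith, by simp only; linarith, h5.le, h7.le⟩

theorem ae_fract_generic : ∀ᵐ q : ℝ × ℝ × ℝ × ℝ, q.1 ≠ Int.fract q.2.2.2 ∧
    q.1 ≠ 1 - Int.fract q.2.2.2 ∧ Int.fract q.2.2.2 ≠ 0 ∧ Int.fract q.2.2.1 ≠ 0 := by
  have cnt : ∀ d : ℝ, volume (range fun k : ℤ => (k : ℝ) + d) = 0 := fun d =>
    (countable_range _).measure_zero volume
  have h1 : ∀ᵐ q : ℝ × ℝ × ℝ × ℝ, q.1 ≠ Int.fract q.2.2.2 := by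
    rw [ae_iff]
    simp only [not_not]
    refine volume_four_eq_zero_of_last (measurableSet_eq_fun (by fun_prop) (by fun_prop))
      fun a b s => measure_mono_null ?_ (cnt a)
    intro y hy
    have hy' : a = Int.fract y := hy
    exact ⟨⌊y⌋, by simp only; rw [hy']; exact Int.floor_add_fract y⟩
  have h2 : ∀ᵐ q : ℝ × ℝ × ℝ × ℝ, q.1 ≠ 1 - Int.fract q.2.2.2 := by
    rw [ae_iff]
    simp only [not_not]
    refine volume_four_eq_zero_of_last (measurableSet_eq_fun (by fun_prop) (by fun_prop))
      fun a b s => measure_mono_null ?_ (cnt (1 - a))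
    intro y hy
    have hy' : a = 1 - Int.fract y := hy
    exact ⟨⌊y⌋, by simp only; rw [hy']; linarith [Int.floor_add_fract y]⟩
  have h3 : ∀ᵐ q : ℝ × ℝ × ℝ × ℝ, Int.fract q.2.2.2 ≠ 0 := by
    rw [ae_iff]
    simp only [not_not]
    refine volume_four_eq_zero_of_last (measurableSet_eq_fun (by fun_prop) (by fun_prop))
      fun a b s => measure_mono_null ?_ (cnt 0)
    intro y hy
    have hy' : Int.fract y = 0 := hy
    exact ⟨⌊y⌋, by simp only; linarith [Int.floor_add_fract y]⟩
  have h4 : ∀ᵐ q : ℝ × ℝ × ℝ × ℝ, Int.fract q.2.2.1 ≠ 0 := by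
    rw [ae_iff]
    simp only [not_not]
    refine volume_four_eq_zero_of_third (measurableSet_eq_fun (by fun_prop) (by fun_prop))
      fun a b r => measure_mono_null ?_ (cnt 0)
    intro y hy
    have hy' : Int.fract y = 0 := hy
    exact ⟨⌊y⌋, by simp only; linarith [Int.floor_add_fract y]⟩
  filter_upwards [h1, h2, h3, h4] with q a b c d using ⟨a, b, c, d⟩

theorem slitLattice_eventually_mem_iff {A B x y : ℝ} (h1 : A ≠ Int.fract y)
    (h2 : A ≠ 1 - Int.fract y) (h3 : Int.fract y ≠ 0) :
    ∀ᶠ t : ℝ in atTop, ((A / t, 1 - B / t, x, y) ∈ slitBox ∩ (slitLatticeTail t ∩ shortBase) ↔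
      (A, B, x, y) ∈ slitLatticeLimit) := by
  by_cases hdom : 0 < A ∧ 0 ≤ B ∧ B < A ∧ 0 ≤ x ∧ x < 2 ∧ 0 ≤ y ∧ y < 2
  swap
  · filter_upwards [eventually_gt_atTop 0] with t ht
    refine iff_of_false (fun h => hdom ?_) (fun h => hdom h.1)
    obtain ⟨⟨h1, h2, h3, h4, h5, h6, h7, h8⟩, -⟩ := h
    simp only at h1 h2 h3 h4 h5 h6 h7 h8
    have hBt : 0 ≤ B / t := by linarith
    have hBA : B / t < A / t := by linarith
    refine ⟨?_, ?_, (div_lt_div_iff_of_pos_right ht).1 hBA, h5, h6, h7, h8⟩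
    · simpa [ht.ne'] using mul_pos h1 ht
    · simpa [ht.ne'] using mul_nonneg hBt ht.le
  have hdom' := hdom
  obtain ⟨hA, hB, hBA, hx, hx2, hy, hy2⟩ := hdom
  have hf0 : 0 < Int.fract y := lt_of_le_of_ne (Int.fract_nonneg y) (Ne.symm h3)
  have hf1 := Int.fract_lt_one y
  have hfl := Int.floor_add_fract y
  have la : Tendsto (fun t : ℝ => A / t) atTop (𝓝 0) := tendsto_const_nhds.div_atTop tendsto_id
  have lb : Tendsto (fun t : ℝ => 1 - A / t) atTop (𝓝 1) := by simpa using la.const_sub 1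
  have hbox : ∀ᶠ t : ℝ in atTop, 0 < t ∧ (A / t, 1 - B / t, x, y) ∈ slitBox ∧ A / t < 1 / 2 := by
    filter_upwards [eventually_gt_atTop 0, la.eventually_lt_const (by norm_num : (0 : ℝ) < 1 / 2)]
      with t ht h4
    have hBt : 0 ≤ B / t := by positivity
    have hBA' : B / t < A / t := by gcongr
    exact ⟨ht, ⟨by simp only; positivity, by simp only; linarith, by simp only; linarith,
      by simp only; linarith, hx, hx2, hy, hy2⟩, h4⟩
  have hrow : ∀ c ∈ ({0, 1, -1} : Set ℝ), ∀ n : ℤ, 0 < n + c * y → n + c * y < A →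
      ∀ᶠ t : ℝ in atTop, (A / t, 1 - B / t, x, y) ∉
        slitBox ∩ (slitLatticeTail t ∩ shortBase) := by
    intro c hc n hn hnA
    filter_upwards [hbox, lb.eventually_const_lt (by rwa [div_lt_one hA] : (n + c * y) / A < 1)]
      with t ht h4 h5
    have h6 := ((mem_slitLatticeTail_iff h5.1 t).1 h5.2.1).slit_row (by have := ht.1; positivity)
      (by linarith [ht.2.2]) ht.1 hc n hn
    have h7 := mul_lt_mul_of_pos_left h4 ht.1
    have h8 : t * ((n + c * y) / A) = (n + c * y) / (A / t) := by
      have := ht.1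
      field_simp
    linarith
  rcases lt_or_gt_of_ne h1 with h1 | h1
  · rcases lt_or_gt_of_ne h2 with h2 | h2
    · filter_upwards [hbox] with t ht
      refine iff_of_true ⟨ht.2.1, (mem_slitLatticeTail_iff ht.2.1 t).2 ?_, ht.2.2⟩ ⟨hdom', h1, h2⟩
      have e : t * (A / t) = A := by
        have := ht.1
        field_simp
      exact slopesExceed_slit_of_fract (by have := ht.1; positivity) ht.1 (by rwa [e]) (by rwa [e])
    · filter_upwards [hrow (-1) (by simp) (⌊y⌋ + 1) (by push_cast; linarith)
        (by push_cast; linarith)] with t ht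
      exact iff_of_false ht fun h => not_lt_of_gt h2 h.2.2
  · filter_upwards [hrow 1 (by simp) (-⌊y⌋) (by push_cast; linarith)
      (by push_cast; linarith)] with t ht
    exact iff_of_false ht fun h => not_lt_of_gt h1 h.2.1

theorem slitLattice_eventually_notMem {A B x y : ℝ} (h3 : Int.fract y ≠ 0)
    (h4 : Int.fract x ≠ 0) :
    ∀ᶠ t : ℝ in atTop, (1 - A / t, B / t, x, y) ∉ slitBox ∩ (slitLatticeTail t \ shortBase) := by
  have hy0 : 0 < Int.fract y := lt_of_le_of_ne (Int.fract_nonneg y) (Ne.symm h3)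
  have hx0 : 0 < Int.fract x := lt_of_le_of_ne (Int.fract_nonneg x) (Ne.symm h4)
  have hy := Int.floor_add_fract y
  have hx := Int.floor_add_fract x
  have la : Tendsto (fun t : ℝ => A / t) atTop (𝓝 0) := tendsto_const_nhds.div_atTop tendsto_id
  have lb : Tendsto (fun t : ℝ => B / t) atTop (𝓝 0) := tendsto_const_nhds.div_atTop tendsto_id
  have l1 : Tendsto (fun t : ℝ => (1 - A / t) * Int.fract x + B / t * Int.fract y) atTop
      (𝓝 (Int.fract x)) := by
    simpa using ((la.const_sub 1).mul_const (Int.fract x)).add (lb.mul_const (Int.fract y))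
  filter_upwards [l1.eventually_le_const (Int.fract_lt_one x),
    l1.eventually_const_le (half_lt_self hx0), eventually_gt_atTop 0,
    eventually_gt_atTop (4 / Int.fract x)] with t h5 h6 ht h7 h
  obtain ⟨hp, h8, h9⟩ := h
  have h8 := (mem_slitLatticeTail_iff hp t).1 h8
  have ha : 1 / 2 ≤ 1 - A / t := not_lt.1 h9
  have ha0 : 0 < 1 - A / t := hp.1
  have ex : (1 - A / t) * ((-⌊x⌋ : ℤ) + 1 * x) + B / t * ((-⌊y⌋ : ℤ) + 1 * y) =
      (1 - A / t) * Int.fract x + B / t * Int.fract y := by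
    rw [Int.fract, Int.fract]
    push_cast
    ring
  have ey : ((-⌊y⌋ : ℤ) : ℝ) + 1 * y = Int.fract y := by
    rw [Int.fract]
    push_cast
    ring
  have h10 := h8.slit_vector (c := 1) (by simp) (-⌊x⌋) (-⌊y⌋) (by rw [ex]; linarith)
    (by rw [ex]; exact h5) (by rw [ey]; positivity)
  rw [ex, ey, lt_div_iff₀ ha0] at h10
  rw [div_lt_iff₀ hx0] at h7
  have h11 : t * (Int.fract x / 2) * (1 / 2) ≤
      t * ((1 - A / t) * Int.fract x + B / t * Int.fract y) * (1 - A / t) :=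
    mul_le_mul (mul_le_mul_of_nonneg_left h6 ht.le) ha (by norm_num)
      (mul_nonneg ht.le (by linarith))
  linarith [Int.fract_lt_one y]

theorem restrict_slitBox_apply {S : Set (ℝ × ℝ × ℝ × ℝ)} (hS : MeasurableSet S) :
    volume.restrict slitBox S = ∫⁻ p, (slitBox ∩ S).indicator 1 p := by
  rw [lintegral_indicator_one (measurableSet_slitBox.inter hS), Measure.restrict_apply hS,
    inter_comm]

theorem slitBox_lattice_bound {a b x y t : ℝ} (hp : (a, b, x, y) ∈ slitBox)
    (h : (a, b, x, y) ∈ slitLatticeTail t) : t * (a * b) < 1 := by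
  have h1 := ((mem_slitLatticeTail_iff hp t).1 h).slit_lattice hp
  rw [lt_div_iff₀ hp.1] at h1
  linarith

theorem indicator_le_indicator_of_imp {X : Type*} {S K : Set X} {p q : X} (h : p ∈ S → q ∈ K) :
    S.indicator (1 : X → ℝ≥0∞) p ≤ K.indicator 1 q := by
  by_cases hp : p ∈ S
  · rw [indicator_of_mem hp, indicator_of_mem (h hp)]
    exact le_rfl
  · rw [indicator_of_notMem hp]
    exact zero_le

theorem indicator_one_eq_of_iff {X : Type*} {S K : Set X} {p q : X} (h : p ∈ S ↔ q ∈ K) :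
    S.indicator (1 : X → ℝ≥0∞) p = K.indicator 1 q :=
  le_antisymm (indicator_le_indicator_of_imp h.1) (indicator_le_indicator_of_imp h.2)

theorem tendsto_slitLattice_short :
    Tendsto (fun t : ℝ => ENNReal.ofReal (t ^ 2) *
      volume.restrict slitBox (slitLatticeTail t ∩ shortBase)) atTop
      (𝓝 (volume slitLatticeLimit)) := by
  have hm : ∀ t, MeasurableSet (slitLatticeTail t ∩ shortBase) := fun t =>
    (measurableSet_slitLatticeTail t).inter measurableSet_shortBase
  simp only [restrict_slitBox_apply (hm _)]
  rw [← lintegral_indicator_one measurableSet_slitLatticeLimit]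
  have resc : ∀ t A B x y : ℝ, ((0, 1, 0, 0) + (t⁻¹, -t⁻¹, 1, 1) * (A, B, x, y) : ℝ × ℝ × ℝ × ℝ) =
      (A / t, 1 - B / t, x, y) := by
    intro t A B x y
    simp only [Prod.mk_mul_mk, Prod.mk_add_mk, Prod.mk.injEq]
    refine ⟨?_, ?_, ?_, ?_⟩ <;> ring
  refine tendsto_sq_mul_lintegral (K := rescaledBox) (0, 1, 0, 0) (fun t => (t⁻¹, -t⁻¹, 1, 1))
    (fun t => Measurable.indicator measurable_one (measurableSet_slitBox.inter (hm t))) ?_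
    measurableSet_Icc volume_rescaledBox_ne_top ?_ ?_
  · intro t ht
    have e : t⁻¹ * -t⁻¹ * 1 * 1 = -(t ^ 2)⁻¹ := by field_simp
    simp only
    rw [e, abs_neg, abs_of_pos (by positivity)]
  · filter_upwards [eventually_gt_atTop 0] with t ht
    rintro ⟨A, B, x, y⟩
    rw [resc]
    refine indicator_le_indicator_of_imp fun h => ?_
    have hb := slitBox_lattice_bound h.1 h.2.1
    have ha : A / t < 1 / 2 := h.2.2
    obtain ⟨h1, h2, h3, h4, h5, h6, h7, h8⟩ := h.1
    simp only at h1 h2 h3 h4 h5 h6 h7 h8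
    have hBt : 0 ≤ B / t := by linarith
    have hBA : B / t < A / t := by linarith
    have hBA' : B < A := (div_lt_div_iff_of_pos_right ht).1 hBA
    have hB : 0 ≤ B := by simpa [ht.ne'] using mul_nonneg hBt ht.le
    have e : t * (A / t * (1 - B / t)) = A * (1 - B / t) := by field_simp
    have hA2 : A * (1 / 2) ≤ A * (1 - B / t) := by
      gcongr
      · linarith
      · linarith
    exact ⟨⟨by simp only; linarith, hB, h5, h7⟩, by simp only; linarith, by simp only; linarith,
      h6.le, h8.le⟩
  · filter_upwards [ae_fract_generic] with q hq
    obtain ⟨A, B, x, y⟩ := q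
    simp only [resc]
    refine tendsto_const_nhds.congr' ?_
    filter_upwards [slitLattice_eventually_mem_iff (A := A) (B := B) (x := x) (y := y) hq.1 hq.2.1
      hq.2.2.1] with t ht
    exact indicator_one_eq_of_iff ht.symm

theorem tendsto_slitLattice_diff_short :
    Tendsto (fun t : ℝ => ENNReal.ofReal (t ^ 2) *
      volume.restrict slitBox (slitLatticeTail t \ shortBase)) atTop (𝓝 0) := by
  have hm : ∀ t, MeasurableSet (slitLatticeTail t \ shortBase) := fun t =>
    (measurableSet_slitLatticeTail t).diff measurableSet_shortBase
  simp only [restrict_slitBox_apply (hm _)]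
  rw [← lintegral_zero (μ := (volume : Measure (ℝ × ℝ × ℝ × ℝ)))]
  have resc : ∀ t A B x y : ℝ, ((1, 0, 0, 0) + (-t⁻¹, t⁻¹, 1, 1) * (A, B, x, y) : ℝ × ℝ × ℝ × ℝ) =
      (1 - A / t, B / t, x, y) := by
    intro t A B x y
    simp only [Prod.mk_mul_mk, Prod.mk_add_mk, Prod.mk.injEq]
    refine ⟨?_, ?_, ?_, ?_⟩ <;> ring
  refine tendsto_sq_mul_lintegral (K := rescaledBox) (1, 0, 0, 0) (fun t => (-t⁻¹, t⁻¹, 1, 1))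
    (fun t => Measurable.indicator measurable_one (measurableSet_slitBox.inter (hm t))) ?_
    measurableSet_Icc volume_rescaledBox_ne_top ?_ ?_
  · intro t ht
    have e : -t⁻¹ * t⁻¹ * 1 * 1 = -(t ^ 2)⁻¹ := by field_simp
    simp only
    rw [e, abs_neg, abs_of_pos (by positivity)]
  · filter_upwards [eventually_gt_atTop 0] with t ht
    rintro ⟨A, B, x, y⟩
    rw [resc]
    refine indicator_le_indicator_of_imp fun h => ?_
    have hb := slitBox_lattice_bound h.1 h.2.1
    have ha : 1 / 2 ≤ 1 - A / t := not_lt.1 h.2.2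
    obtain ⟨h1, h2, h3, h4, h5, h6, h7, h8⟩ := h.1
    simp only at h1 h2 h3 h4 h5 h6 h7 h8
    have hAt : 0 ≤ A / t := by linarith
    have hAB : A / t < B / t := by linarith
    have hAB' : A < B := (div_lt_div_iff_of_pos_right ht).1 hAB
    have hA : 0 ≤ A := by simpa [ht.ne'] using mul_nonneg hAt ht.le
    have e : t * ((1 - A / t) * (B / t)) = B * (1 - A / t) := by field_simp
    have hB2 : B * (1 / 2) ≤ B * (1 - A / t) := by
      gcongr
      linarith
    exact ⟨⟨hA, by simp only; linarith, h5, h7⟩, by simp only; linarith, by simp only; linarith,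
      h6.le, h8.le⟩
  · filter_upwards [ae_fract_generic] with q hq
    obtain ⟨A, B, x, y⟩ := q
    simp only [resc]
    refine tendsto_const_nhds.congr' ?_
    filter_upwards [slitLattice_eventually_notMem (A := A) (B := B) (x := x) (y := y) hq.2.2.1
      hq.2.2.2] with t ht
    rw [indicator_of_notMem ht]

theorem tendsto_slitLatticeTail :
    Tendsto (fun t : ℝ => ENNReal.ofReal (t ^ 2) * volume.restrict slitBox (slitLatticeTail t))
      atTop (𝓝 (volume slitLatticeLimit)) := by
  have h := tendsto_slitLattice_short.add tendsto_slitLattice_diff_short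
  rw [add_zero] at h
  refine h.congr fun t => ?_
  rw [← mul_add, measure_inter_add_sdiff _ measurableSet_shortBase]

/-! ### Tails and support of the gap densities -/

theorem tendsto_sq_mul_toReal {F : ℝ → ℝ≥0∞} {L : ℝ≥0∞} (hL : L ≠ ∞)
    (h : Tendsto (fun t : ℝ => ENNReal.ofReal (t ^ 2) * F t) atTop (𝓝 L)) :
    Tendsto (fun t : ℝ => t ^ 2 * (F t).toReal) atTop (𝓝 L.toReal) := by
  refine ((ENNReal.tendsto_toReal hL).comp h).congr fun t => ?_
  simp only [Function.comp_apply]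
  rw [ENNReal.toReal_mul, ENNReal.toReal_ofReal (sq_nonneg t)]

theorem gapTail_mSlit_isEquivalent : ∃ c : ℝ, 0 < c ∧
    gapTail saddleHolonomies mSlit ~[atTop] (fun t : ℝ => c * t ^ (-2 : ℤ)) := by
  have htail : ∀ t, gapTail saddleHolonomies mSlit t = (slitMeasure univ).toReal⁻¹ *
      (volume.restrict slitBox (slitLatticeTail t) + 8 * fluxMeasure (slitFluxTail t)).toReal :=
    fun t => setIntegral_mSlit measurableSet_Ioi
  set L := volume slitLatticeLimit + 8 * volume slitFluxLimit with hL
  have hL0 : L ≠ 0 := by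
    have := volume_slitFluxLimit_pos.ne'
    simp [hL, this]
  have hLt : L ≠ ∞ := ENNReal.add_ne_top.2 ⟨volume_slitLatticeLimit_ne_top,
    ENNReal.mul_ne_top (by simp) volume_slitFluxLimit_lt_top.ne⟩
  have h1 : Tendsto (fun t : ℝ => ENNReal.ofReal (t ^ 2) *
      (volume.restrict slitBox (slitLatticeTail t) + 8 * fluxMeasure (slitFluxTail t)))
      atTop (𝓝 L) := by
    refine (tendsto_slitLatticeTail.add (ENNReal.Tendsto.const_mul (a := 8)
      tendsto_fluxMeasure_slitFluxTail (Or.inr (by simp)))).congr fun t => ?_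
    ring
  have hZ := slitMeasure_univ_toReal_pos
  have hc : 0 < (slitMeasure univ).toReal⁻¹ * L.toReal :=
    mul_pos (inv_pos.2 hZ) (ENNReal.toReal_pos hL0 hLt)
  refine ⟨(slitMeasure univ).toReal⁻¹ * L.toReal, hc, ?_⟩
  rw [isEquivalent_iff_tendsto_one (by
    filter_upwards [eventually_gt_atTop 0] with t ht
    positivity)]
  have h2 := ((tendsto_sq_mul_toReal hLt h1).const_mul (slitMeasure univ).toReal⁻¹).div_const
    ((slitMeasure univ).toReal⁻¹ * L.toReal)
  rw [div_self hc.ne'] at h2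
  refine h2.congr' ?_
  filter_upwards [eventually_gt_atTop 0] with t ht
  simp only [Pi.div_apply, htail, zpow_neg]
  norm_cast
  rw [← div_div ((slitMeasure univ).toReal⁻¹ * _) _ (t ^ 2)⁻¹, div_inv_eq_mul]
  ring

theorem setIntegral_gapDensity_mSlit_pos {ε : ℝ} (hε : 0 < ε) :
    0 < ∫ t in Ioo 0 ε, gapDensity saddleHolonomies mSlit t := by
  rw [setIntegral_mSlit measurableSet_Ioo]
  refine mul_pos (inv_pos.2 slitMeasure_univ_toReal_pos) (ENNReal.toReal_pos ?_ ?_)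
  · have := (fluxMeasure_returnTime_pos (C := {0, 1, -1}) (toFinite _) (by simp) hε).ne'
    exact fun h => this (by simpa using (add_eq_zero.1 h).2)
  · exact ENNReal.add_ne_top.2 ⟨((measure_mono (subset_univ _)).trans_lt
      ((Measure.restrict_apply_univ slitBox).trans_lt volume_slitBox_lt_top)).ne, ENNReal.mul_ne_top (by simp)
      ((measure_mono (subset_univ _)).trans_lt fluxMeasure_univ_lt_top).ne⟩

theorem gapTail_mOmega_eq (t : ℝ) :
    gapTail affineLattice mOmega t = (fluxMeasure univ).toReal⁻¹ *
      (fluxMeasure {p | t < returnTime (gridVectors {1}) (fluxPair p)}).toReal :=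
  setIntegral_mOmega measurableSet_Ioi

theorem isBigO_gapTail_mOmega :
    (fun t : ℝ => t ^ (-2 : ℤ)) =O[atTop] gapTail affineLattice mOmega := by
  have hL : 0 < (volume slitFluxLimit).toReal :=
    ENNReal.toReal_pos volume_slitFluxLimit_pos.ne' volume_slitFluxLimit_lt_top.ne
  have hZ := fluxMeasure_univ_toReal_pos
  refine IsBigO.of_bound ((fluxMeasure univ).toReal * (2 / (volume slitFluxLimit).toReal)) ?_
  filter_upwards [eventually_gt_atTop 0, (tendsto_sq_mul_toReal volume_slitFluxLimit_lt_top.ne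
    tendsto_fluxMeasure_slitFluxTail).eventually_const_le (half_lt_self hL)] with t ht h1
  have h2 : (fluxMeasure (slitFluxTail t)).toReal ≤
      (fluxMeasure {p | t < returnTime (gridVectors {1}) (fluxPair p)}).toReal :=
    ENNReal.toReal_mono ((measure_mono (subset_univ _)).trans_lt fluxMeasure_univ_lt_top).ne
      (fluxMeasure_returnTime_mono t (finite_singleton _) (toFinite {0, 1, -1}) rfl (by simp))
  rw [gapTail_mOmega_eq, Real.norm_of_nonneg (by positivity), Real.norm_of_nonneg (by positivity)]
  generalize (fluxMeasure {p | t < returnTime (gridVectors {1}) (fluxPair p)}).toReal = x at h2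
  have e : (fluxMeasure univ).toReal * (2 / (volume slitFluxLimit).toReal) *
      ((fluxMeasure univ).toReal⁻¹ * x) = 2 * x / (volume slitFluxLimit).toReal := by
    field_simp
  rw [e, zpow_neg, le_div_iff₀ hL]
  norm_cast
  rw [inv_mul_le_iff₀ (by positivity)]
  have h3 := mul_le_mul_of_nonneg_left h2 (sq_nonneg t)
  linarith

theorem gapTail_mOmega_isBigO :
    gapTail affineLattice mOmega =O[atTop] (fun t : ℝ => t ^ (-1 : ℤ)) := by
  refine IsBigO.of_bound ((fluxMeasure univ).toReal⁻¹ * 336) ?_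
  filter_upwards [eventually_gt_atTop 0] with t ht
  rw [gapTail_mOmega_eq, Real.norm_of_nonneg (by positivity), Real.norm_of_nonneg (by positivity),
    zpow_neg_one, mul_assoc, ← div_eq_mul_inv]
  gcongr
  exact ENNReal.toReal_le_of_le_ofReal (by positivity) (fluxMeasure_returnTime_le ht)

theorem setIntegral_gapDensity_mOmega_pos {ε : ℝ} (hε : 0 < ε) :
    0 < ∫ t in Ioo 0 ε, gapDensity affineLattice mOmega t := by
  rw [setIntegral_mOmega measurableSet_Ioo]
  exact mul_pos (inv_pos.2 fluxMeasure_univ_toReal_pos) (ENNReal.toReal_pos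
    (fluxMeasure_returnTime_pos (finite_singleton _) rfl hε).ne'
    ((measure_mono (subset_univ _)).trans_lt fluxMeasure_univ_lt_top).ne)

end

theorem mainTheorem5 :
    -- affine lattices that are generic for the measure induced by Haar measure
    (GapDistributionHasDensity affineLattice affineLatticeSpace mOmega ∧
      (fun t : ℝ => t ^ (-2 : ℤ)) =O[atTop] gapTail affineLattice mOmega ∧
      gapTail affineLattice mOmega =O[atTop] (fun t : ℝ => t ^ (-1 : ℤ)) ∧
      ∀ ε : ℝ, 0 < ε → 0 < ∫ t in Ioo 0 ε, gapDensity affineLattice mOmega t) ∧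
    -- affine lattices that are generic for a torsion measure
    (∀ q : ℕ, 0 < q →
      GapDistributionHasDensity affineLattice affineLatticeSpace (mTorsion q) ∧
      gapTail affineLattice (mTorsion q) =Θ[atTop] (fun t : ℝ => t ^ (-2 : ℤ))) ∧
    -- generic doubled slit tori
    (GapDistributionHasDensity saddleHolonomies slitTorusSpace mSlit ∧
      (∃ c : ℝ, 0 < c ∧
        gapTail saddleHolonomies mSlit ~[atTop] (fun t : ℝ => c * t ^ (-2 : ℤ))) ∧
      ∀ ε : ℝ, 0 < ε → 0 < ∫ t in Ioo 0 ε, gapDensity saddleHolonomies mSlit t) :=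
  ⟨⟨mOmega_hasDensity, isBigO_gapTail_mOmega, gapTail_mOmega_isBigO,
      fun _ => setIntegral_gapDensity_mOmega_pos⟩,
    fun q hq => ⟨mTorsion_hasDensity q, gapTail_mTorsion_isTheta hq⟩,
    mSlit_hasDensity, gapTail_mSlit_isEquivalent, fun _ => setIntegral_gapDensity_mSlit_pos⟩
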